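/- For each $n\in\mathbb{N}$ let $a_n,b_n>0$ be real numbers and $s_n\in\mathbb{N}$, put $\rho_n=a_nb_n/s_n$, and assume that $a_n\to\infty$, $b_n\to\infty$ and, for some $\beta>0$, $(1-\rho_n)\sqrt{a_n}\to\beta$ as $n\to\infty$ (this holds in particular if $s_n=a_nb_n+\beta\sqrt{a_nb_n(b_n+1)}$ for all $n$). For each $n$ let $A_{0,n},A_{1,n},A_{2,n},\dots$ be i.i.d. demands with the Gamma–Poisson (negative binomial) law: given $\Lambda$, a Gamma variable with shape $a_n$ and scale $b_n$, the demand is Poisson with mean $\Lambda$. Let $Q_{0,n}=0$ and $Q_{k+1,n}=\max\{Q_{k,n}+A_{k,n}-s_n,0\}$, and let $Q_n$ be the stationary queue length, $\mathbb{P}(Q_n=i)=\lim_{k\to\infty}\mathbb{P}(Q_{k,n}=i)$; whenever $a_nb_n<s_n$, which is the case for all but finitely many $n$, these limits exist and form a probability distribution on $\{0,1,2,\dots\}$ with finite second moment. Define the robust hedge $\beta_n\ge 0$ by $$\beta_n^2=s_n\Bigl(\frac{1-\rho_n}{b_n+1}\Bigr)^2\Bigl(1+\frac{b_n}{\rho_n}\Bigr).$$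 Then, as $n\to\infty$, $$\mathbb{E}Q_n=(1+o(1))\,\frac{\sqrt2\,\beta_n}{\pi}\,\frac{b_n+\rho_n}{1-\rho_n}\int_0^\infty\frac{t^2}{\frac12\beta_n^2+t^2}\,\frac{\exp(-\frac12\beta_n^2-t^2)}{1-\exp(-\frac12\beta_n^2-t^2)}\,dt,$$ $$\mathbb{P}(Q_n=0)=(1+o(1))\,\exp\Bigl[\frac1\pi\,\frac{b_n+\rho_n}{b_n+1}\int_0^\infty\frac{\beta_n/\sqrt2}{\frac12\beta_n^2+t^2}\,\ln\bigl(1-e^{-\frac12\beta_n^2-t^2}\bigr)\,dt\Bigr],$$ $$\operatorname{Var}Q_n=(1+o(1))\,\frac{\beta_n^3}{\sqrt2\,\pi}\Bigl(\frac{b_n+\rho_n}{1-\rho_n}\Bigr)^2\Bigl(\frac{b_n+1}{b_n+\rho_n}+1\Bigr)\int_0^\infty\frac{t^2}{(\frac12\beta_n^2+t^2)^2}\,\frac{\exp(-\frac12\beta_n^2-t^2)}{1-\exp(-\frac12\beta_n^2-t^2)}\,dt.$$ -/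

import Mathlib

open MeasureTheory ProbabilityTheory Filter Asymptotics
open scoped Topology ENNReal NNReal

namespace RobustQueue

/-- The Poisson distribution depends measurably on its rate, so that mixing it makes sense. -/
theorem measurable_poisson :
    Measurable (fun r : ℝ => poissonMeasure r.toNNReal) := by
  refine Measure.measurable_of_measurable_coe _ fun t ht => ?_
  have h : ∀ r : ℝ, poissonMeasure r.toNNReal t
      = ∑' j : ℕ, t.indicator (fun j => ENNReal.ofReal
        (Real.exp (-(r.toNNReal : ℝ)) * (r.toNNReal : ℝ) ^ j / (Nat.factorial j))) j := by
    intro r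
    rw [← Measure.tsum_indicator_apply_singleton _ t ht]
    simp_rw [poissonMeasure_singleton]
  simp_rw [h]
  refine Measurable.tsum fun j => ?_
  by_cases hj : j ∈ t
  · simp only [Set.indicator_of_mem hj]
    fun_prop
  · simp only [Set.indicator_of_notMem hj]
    fun_prop

/-- The law of the demand per period: a Poisson variable whose random rate has the Gamma
distribution with shape `a` and scale `b` (that is, rate `1 / b`). This is the negative binomial
distribution with parameters `a` and `1 / (b + 1)`. -/
noncomputable def gammaPoisson (a b : ℝ) : Measure ℕ :=
  (gammaMeasure a (1 / b)).bind fun r => poissonMeasure r.toNNReal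

/-- The queue length process with service capacity `s` per period and demand `A k` in period `k`,
started empty: `Q 0 = 0` and `Q (k + 1) = max (Q k + A k - s) 0`. -/
def queue {Ω : Type*} (s : ℕ) (A : ℕ → Ω → ℕ) : ℕ → Ω → ℕ
  | 0, _ => 0
  | k + 1, ω => (max ((queue s A k ω : ℤ) + (A k ω : ℤ) - (s : ℤ)) 0).toNat

/-- The stationary queue length distribution: the mass of `i` is `lim P (Q k = i)` as `k → ∞`.
(That these limits exist and form a probability distribution when the queue is stable is part of
the theorem.) -/
noncomputable def stationaryLaw {Ω : Type*} [MeasurableSpace Ω] (P : Measure Ω)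
    (s : ℕ) (A : ℕ → Ω → ℕ) : Measure ℕ :=
  Measure.sum fun i : ℕ =>
    (limUnder atTop fun k : ℕ => P {ω | queue s A k ω = i}) • Measure.dirac i

/-- The utilization `ρ = μ / s`, where `μ = a b` is the mean demand per period. -/
noncomputable def utilization (a b : ℝ) (s : ℕ) : ℝ := a * b / s

/-- The robust hedge as a function of `b`, `s` and the utilization `ρ`: the nonnegative root of
`s ((1 - ρ) / (b + 1)) ^ 2 (1 + b / ρ)`. -/
noncomputable def robustHedge (b ρ : ℝ) (s : ℕ) : ℝ :=
  Real.sqrt (s * ((1 - ρ) / (b + 1)) ^ 2 * (1 + b / ρ))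

/-- The robust approximation of the mean queue length, `c` being the hedge. -/
noncomputable def meanApprox (b ρ c : ℝ) : ℝ :=
  Real.sqrt 2 * c / Real.pi * ((b + ρ) / (1 - ρ)) *
    ∫ t in Set.Ioi (0 : ℝ), t ^ 2 / (c ^ 2 / 2 + t ^ 2) *
      (Real.exp (-(c ^ 2 / 2) - t ^ 2) / (1 - Real.exp (-(c ^ 2 / 2) - t ^ 2)))

/-- The robust approximation of the empty-queue probability, `c` being the hedge. -/
noncomputable def emptyApprox (b ρ c : ℝ) : ℝ :=
  Real.exp (1 / Real.pi * ((b + ρ) / (b + 1)) *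
    ∫ t in Set.Ioi (0 : ℝ), c / Real.sqrt 2 / (c ^ 2 / 2 + t ^ 2) *
      Real.log (1 - Real.exp (-(c ^ 2 / 2) - t ^ 2)))

/-- The robust approximation of the variance of the queue length, `c` being the hedge. -/
noncomputable def varianceApprox (b ρ c : ℝ) : ℝ :=
  c ^ 3 / Real.sqrt 2 / Real.pi * ((b + ρ) / (1 - ρ)) ^ 2 * ((b + 1) / (b + ρ) + 1) *
    ∫ t in Set.Ioi (0 : ℝ), t ^ 2 / (c ^ 2 / 2 + t ^ 2) ^ 2 *
      (Real.exp (-(c ^ 2 / 2) - t ^ 2) / (1 - Real.exp (-(c ^ 2 / 2) - t ^ 2)))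

end RobustQueue

/-!
Let `b √a` be the unit of length. Spitzer's identity, applied to the queue started empty, expresses
the law of the queue length after `m` periods as the coefficient of `z ^ m` in
`exp (∑ k, z ^ k / k * law of (S k)⁺)`, `S k` being the sum of `k` demands minus `k s`
(`spitzer_measure`, `map_queue`). The proof is algebraic,
by generating functions; products and powers of laws are convolutions.

In a stable system some exponential moment of the step of the random walk `S` is less than `1`, so
the moments of `(S k)⁺` decay geometrically in `k`; hence `m → ∞` is allowed and the
stationary law satisfies (`limitLaw_spec`)
`E Q = ∑ k, E (S k)⁺ / k`, `Var Q = ∑ k, E ((S k)⁺) ^ 2 / k`, `P (Q = 0) = exp (-∑ k, P (S k > 0) / k)`.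

In heavy traffic the step divided by `b √a` converges in law, with exponential moments, to a normal
variable with mean `-β` and variance `1` (`tendsto_log_mgf`). So each term of the three series
converges to the term of the Gaussian random walk with drift `-β`, and the exponential moment at
`θ = β / (b √a)` gives a geometric bound uniform in `n` (`excessLaw_limits`). By dominated
convergence the three series converge to those of the Gaussian walk (`tendsto_limitLaw_moments`).

The Gaussian terms `P (S k > 0)`, `E (S k)⁺ / k` and `E ((S k)⁺) ^ 2 / k` are integrals over `t` of
rational weights times `exp (-k (β² / 2 + t²))`, by Craig's formula and integration by parts
(`gaussian_terms`); summing over `k` gives exactly the integrals of the robust approximations, with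
`β` for the hedge (`gaussian_series`). Finally the hedge tends to `β`, the prefactors have matching
limits, and the limits are nonzero (`heavyTraffic_limits`, `tendsto_approximations`,
`integral_mul_exp_hedge_pos`).
-/

namespace RobustQueue

/-! ### Wiener–Hopf splitting of Laurent series -/

/-- Substitution of `z⁻¹` for the variable of a polynomial. -/
noncomputable def invHom : Polynomial ℝ →+* LaurentSeries ℝ :=
  Polynomial.eval₂RingHom HahnSeries.C (HahnSeries.single (-1 : ℤ) (1 : ℝ))

theorem invHom_monomial (k : ℕ) (r : ℝ) :
    invHom (Polynomial.monomial k r) = HahnSeries.single (-(k : ℤ)) r := by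
  simp [invHom, HahnSeries.single_pow]

theorem coeff_invHom (p : Polynomial ℝ) (k : ℕ) :
    (invHom p).coeff (-(k : ℤ)) = p.coeff k := by
  induction p using Polynomial.induction_on' with
  | add p q hp hq => simp [hp, hq]
  | monomial n r =>
    rw [invHom_monomial, Polynomial.coeff_monomial, HahnSeries.coeff_single]
    simp [eq_comm]

/-- The Laurent series carried by exponents `≤ 0` whose (finitely many) coefficients sum to zero:
the kernel of the projection that pushes a mass at `x` to `max x 0`. -/
noncomputable def nonposPart : NonUnitalSubring (LaurentSeries ℝ) where
  carrier := {x | ∃ p : Polynomial ℝ, p.eval 1 = 0 ∧ invHom p = x}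
  zero_mem' := ⟨0, by simp⟩
  add_mem' := by
    rintro _ _ ⟨p, hp, rfl⟩ ⟨q, hq, rfl⟩
    exact ⟨p + q, by simp [hp, hq], by simp⟩
  mul_mem' := by
    rintro _ _ ⟨p, hp, rfl⟩ ⟨q, hq, rfl⟩
    exact ⟨p * q, by simp [hp], by simp⟩
  neg_mem' := by
    rintro _ ⟨p, hp, rfl⟩
    exact ⟨-p, by simp [hp], by simp⟩

theorem eq_zero_of_mem_nonposPart {f : PowerSeries ℝ}
    (hf : HahnSeries.ofPowerSeries ℤ ℝ f ∈ nonposPart) : f = 0 := by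
  obtain ⟨p, hp, hpf⟩ := hf
  have hcoeff : ∀ k : ℕ, k ≠ 0 → p.coeff k = 0 := by
    intro k hk
    rw [← coeff_invHom, hpf]
    have := PowerSeries.coeff_coe f (-(k : ℤ))
    rw [this, if_pos (by omega)]
  have hC : p = Polynomial.C (p.coeff 0) := by
    ext k
    rcases eq_or_ne k 0 with rfl | hk
    · simp
    · rw [hcoeff k hk, Polynomial.coeff_C, if_neg hk]
  have h0 : p = 0 := by
    rw [hC] at hp ⊢
    simpa using hp
  rw [h0, map_zero] at hpf
  exact HahnSeries.ofPowerSeries_injective (by rw [← hpf, map_zero])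

/-- The effect on generating functions of the map `j ↦ j - d` with truncation at `0`. -/
noncomputable def truncShift (d : ℕ) (f : PowerSeries ℝ) : PowerSeries ℝ :=
  PowerSeries.mk fun i =>
    if i = 0 then ∑ j ∈ Finset.range (d + 1), PowerSeries.coeff j f
    else PowerSeries.coeff (i + d) f

theorem shift_sub_truncShift_mem (d : ℕ) (f : PowerSeries ℝ) :
    HahnSeries.single (-(d : ℤ)) (1 : ℝ) * HahnSeries.ofPowerSeries ℤ ℝ f
      - HahnSeries.ofPowerSeries ℤ ℝ (truncShift d f) ∈ nonposPart := by
  refine ⟨∑ j ∈ Finset.range d, (Polynomial.monomial (d - j) (PowerSeries.coeff j f)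
    - Polynomial.monomial 0 (PowerSeries.coeff j f)), ?_, ?_⟩
  · simp [Polynomial.eval_finsetSum]
  · ext i
    have h1 : (HahnSeries.single (-(d : ℤ)) (1 : ℝ) * HahnSeries.ofPowerSeries ℤ ℝ f).coeff i
        = (HahnSeries.ofPowerSeries ℤ ℝ f).coeff (i + d) := by
      have := HahnSeries.coeff_single_mul_add (r := (1 : ℝ))
        (x := HahnSeries.ofPowerSeries ℤ ℝ f) (a := i + d) (b := -(d : ℤ))
      simpa using this
    rw [HahnSeries.coeff_sub, h1]
    have h2 := PowerSeries.coeff_coe f (i + d)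
    have h3 := PowerSeries.coeff_coe (truncShift d f) i
    rw [h2, h3]
    simp only [map_sum, map_sub, invHom_monomial, HahnSeries.coeff_sum, HahnSeries.coeff_sub,
      HahnSeries.coeff_single, truncShift, PowerSeries.coeff_mk]
    rcases lt_trichotomy i 0 with hi | rfl | hi
    · rw [if_pos hi, sub_zero]
      by_cases h : i + d < 0
      · rw [if_pos h]
        refine Finset.sum_eq_zero fun j hj => ?_
        rw [Finset.mem_range] at hj
        rw [if_neg (by omega), if_neg (by simpa using hi.ne), sub_zero]
      · rw [if_neg h, Finset.sum_eq_single ((i + d).natAbs)]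
        · rw [if_pos (by omega), if_neg (by simpa using hi.ne), sub_zero]
        · intro j hj hj'
          rw [Finset.mem_range] at hj
          rw [if_neg (by omega), if_neg (by simpa using hi.ne), sub_zero]
        · intro hj
          rw [Finset.mem_range] at hj
          omega
    · simp only [lt_self_iff_false, if_false, Int.natAbs_zero, if_true, zero_add,
        Int.natAbs_natCast]
      rw [if_neg (by omega), Finset.sum_range_succ, sub_add_cancel_right, ← Finset.sum_neg_distrib]
      refine Finset.sum_congr rfl fun j hj => ?_
      rw [Finset.mem_range] at hj
      rw [if_neg (by omega)]
      simp
    · rw [if_neg (by omega), if_neg (by omega), if_neg (by omega)]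
      rw [show (i + d).natAbs = i.natAbs + d by omega, sub_self]
      refine Finset.sum_eq_zero fun j hj => ?_
      rw [if_neg (by omega), if_neg (by simpa using hi.ne'), sub_zero]

/-- **Spitzer's identity**, in the algebraic form of Wendel and Baxter. If `p k` is the truncation
of `a ^ k` and the `m n` arise from `1` by multiplying by `a` and truncating, then
`∑ m n t ^ n = exp (∑ p k t ^ k / k)`; the identity is the `t`-derivative of this, coefficientwise.

With `M = ∑ m n t ^ n` and `P = ∑ p k t ^ k`, the coefficients of `(1 - a t) (t M' - P M)` all lie
in `nonposPart`, while those of `t M' - P M` are power series in `z`; by induction they vanish. -/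
theorem spitzer_series (a : LaurentSeries ℝ) (p m : ℕ → PowerSeries ℝ) (hm0 : m 0 = 1)
    (hp : ∀ k, a ^ k - HahnSeries.ofPowerSeries ℤ ℝ (p k) ∈ nonposPart)
    (hm : ∀ n, a * HahnSeries.ofPowerSeries ℤ ℝ (m n)
      - HahnSeries.ofPowerSeries ℤ ℝ (m (n + 1)) ∈ nonposPart) (n : ℕ) :
    ((n : PowerSeries ℝ) + 1) * m (n + 1)
      = ∑ ij ∈ Finset.HasAntidiagonal.antidiagonal n, p (ij.1 + 1) * m ij.2 := by
  set ι := HahnSeries.ofPowerSeries ℤ ℝ with hι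
  let M : PowerSeries (LaurentSeries ℝ) := PowerSeries.mk fun n => ι (m n)
  -- `P` and `G` are the series above divided by `t`
  let P : PowerSeries (LaurentSeries ℝ) := PowerSeries.mk fun n => ι (p (n + 1))
  let G : PowerSeries (LaurentSeries ℝ) := PowerSeries.mk fun n => a ^ (n + 1)
  let T : PowerSeries (LaurentSeries ℝ) := 1 - PowerSeries.X * PowerSeries.C a
  let D := T * M
  let R := PowerSeries.derivative _ M - P * M
  have hTG : T * G = PowerSeries.C a := by
    ext k
    rcases k with _ | k
    · simp [T, G, sub_mul, mul_assoc]
    · simp [T, G, sub_mul, mul_assoc, PowerSeries.coeff_succ_X_mul,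
        pow_succ']
  have hTR : T * R = PowerSeries.derivative _ D + (G - P) * D := by
    have hT' : PowerSeries.derivative _ T = - PowerSeries.C a := by
      simp [T]
    simp only [D, R, Derivation.leibniz, hT', smul_eq_mul]
    linear_combination (-M) * hTG
  have hD0 : PowerSeries.coeff 0 D = 1 := by simp [D, T, M, hm0]
  have hD : ∀ k, PowerSeries.coeff (k + 1) D ∈ nonposPart := by
    intro k
    have : PowerSeries.coeff (k + 1) D = -(a * ι (m k) - ι (m (k + 1))) := by
      simp [D, T, M, sub_mul, mul_assoc, PowerSeries.coeff_succ_X_mul]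
    rw [this]
    exact neg_mem (hm k)
  have hTRmem : ∀ k, PowerSeries.coeff k (T * R) ∈ nonposPart := by
    intro k
    rw [hTR, map_add]
    refine add_mem ?_ ?_
    · rw [PowerSeries.coeff_derivative]
      have : PowerSeries.coeff (k + 1) D * ((k : LaurentSeries ℝ) + 1)
          = (k + 1) • PowerSeries.coeff (k + 1) D := by
        rw [nsmul_eq_mul, mul_comm]; push_cast; rfl
      rw [this]
      exact nsmul_mem (hD k) _
    · rw [PowerSeries.coeff_mul]
      refine sum_mem fun ij _ => ?_
      have hGP : PowerSeries.coeff ij.1 (G - P) ∈ nonposPart := by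
        simpa [G, P] using hp (ij.1 + 1)
      rcases hj : ij.2 with _ | j
      · rw [hD0, mul_one]; exact hGP
      · exact mul_mem hGP (hD j)
  let r : ℕ → PowerSeries ℝ := fun k => (k + 1) * m (k + 1)
    - ∑ ij ∈ Finset.HasAntidiagonal.antidiagonal k, p (ij.1 + 1) * m ij.2
  have hR : ∀ k, PowerSeries.coeff k R = ι (r k) := by
    intro k
    simp only [R, map_sub, PowerSeries.coeff_derivative, PowerSeries.coeff_mul, M, P,
      PowerSeries.coeff_mk, r, map_mul, map_add, map_natCast, map_one, map_sum]
    rw [mul_comm]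
  have hr : ∀ k, r k = 0 := by
    intro k
    induction k with
    | zero =>
      refine eq_zero_of_mem_nonposPart ?_
      have := hTRmem 0
      rw [← hι, ← hR]
      simpa [T, sub_mul, mul_assoc] using this
    | succ k ih =>
      refine eq_zero_of_mem_nonposPart ?_
      have := hTRmem (k + 1)
      simp only [T, sub_mul, one_mul, mul_assoc, map_sub, PowerSeries.coeff_succ_X_mul,
        PowerSeries.coeff_C_mul, hR, ih, map_zero, mul_zero, sub_zero] at this
      exact this
  exact sub_eq_zero.mp (hr n)

/-! ### Spitzer's identity for the queue length laws -/

open Measure in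
/-- The law of the total demand of `k` periods, `ν` being the law of the demand per period. -/
noncomputable def totalLaw (ν : Measure ℕ) : ℕ → Measure ℕ
  | 0 => dirac 0
  | k + 1 => totalLaw ν k ∗ ν

/-- The law of the positive part of the excess of the demand of `k` periods over the capacity
(natural number subtraction truncates at `0`). -/
noncomputable def excessLaw (ν : Measure ℕ) (s k : ℕ) : Measure ℕ :=
  (totalLaw ν k).map (· - k * s)

open Measure in
/-- The law of the queue length at time `k`, started empty. -/
noncomputable def queueLaw (ν : Measure ℕ) (s : ℕ) : ℕ → Measure ℕ
  | 0 => dirac 0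
  | k + 1 => (queueLaw ν s k ∗ ν).map (· - s)

instance isProbabilityMeasure_totalLaw (ν : Measure ℕ) [IsProbabilityMeasure ν] (k : ℕ) :
    IsProbabilityMeasure (totalLaw ν k) := by
  induction k with
  | zero => unfold totalLaw; infer_instance
  | succ k ih => unfold totalLaw; infer_instance

instance isProbabilityMeasure_excessLaw (ν : Measure ℕ) [IsProbabilityMeasure ν] (s k : ℕ) :
    IsProbabilityMeasure (excessLaw ν s k) :=
  Measure.isProbabilityMeasure_map (by fun_prop)

instance isProbabilityMeasure_queueLaw (ν : Measure ℕ) [IsProbabilityMeasure ν] (s k : ℕ) :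
    IsProbabilityMeasure (queueLaw ν s k) := by
  induction k with
  | zero => unfold queueLaw; infer_instance
  | succ k ih => unfold queueLaw; exact Measure.isProbabilityMeasure_map (by fun_prop)

/-- The probability generating function of a law on `ℕ`. -/
noncomputable def genSeries (μ : Measure ℕ) : PowerSeries ℝ :=
  PowerSeries.mk fun j => μ.real {j}

theorem genSeries_dirac_zero : genSeries (Measure.dirac 0) = 1 := by
  ext j
  rw [genSeries, PowerSeries.coeff_mk, PowerSeries.coeff_one]
  by_cases h : j = 0 <;> simp [h, Measure.real]

open Measure in
theorem genSeries_conv (μ ν : Measure ℕ) [IsProbabilityMeasure μ] [IsProbabilityMeasure ν] :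
    genSeries (μ ∗ ν) = genSeries μ * genSeries ν := by
  ext n
  rw [PowerSeries.coeff_mul]
  simp only [genSeries, PowerSeries.coeff_mk]
  rw [conv, map_measureReal_apply (by fun_prop) (by measurability)]
  have : (fun x : ℕ × ℕ => x.1 + x.2) ⁻¹' {n}
      = ⋃ ij ∈ Finset.HasAntidiagonal.antidiagonal n, ({ij.1} : Set ℕ) ×ˢ ({ij.2} : Set ℕ) := by
    ext ⟨i, j⟩
    simp
  rw [this, measureReal_biUnion_finset]
  · simp only [measureReal_prod_prod]
  · intro x _ y _ hxy
    simp only [Function.onFun]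
    rw [Set.disjoint_left]
    rintro ⟨i, j⟩ h1 h2
    simp only [Set.mem_prod, Set.mem_singleton_iff] at h1 h2
    exact hxy (Prod.ext (h1.1.symm.trans h2.1) (h1.2.symm.trans h2.2))
  · intro x _
    measurability

theorem genSeries_map_sub (μ : Measure ℕ) [IsProbabilityMeasure μ] (d : ℕ) :
    genSeries (μ.map (· - d)) = truncShift d (genSeries μ) := by
  ext i
  simp only [genSeries, truncShift, PowerSeries.coeff_mk]
  rw [map_measureReal_apply (by fun_prop) (by measurability)]
  split_ifs with h
  · have : (fun x : ℕ => x - d) ⁻¹' {i} = ⋃ j ∈ Finset.range (d + 1), {j} := by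
      ext x; simp; omega
    rw [this, measureReal_biUnion_finset]
    · intro x _ y _ hxy
      simpa [Function.onFun] using hxy
    · intro x _; measurability
  · congr 1
    ext x; simp; omega

theorem genSeries_totalLaw (ν : Measure ℕ) [IsProbabilityMeasure ν] (k : ℕ) :
    genSeries (totalLaw ν k) = genSeries ν ^ k := by
  induction k with
  | zero => simp [totalLaw, genSeries_dirac_zero]
  | succ k ih => rw [totalLaw, genSeries_conv, ih, pow_succ]

theorem measure_ext_genSeries {μ ν : Measure ℕ} [IsFiniteMeasure μ] [IsFiniteMeasure ν]
    (h : genSeries μ = genSeries ν) : μ = ν := by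
  refine Measure.ext_of_singleton fun j => ?_
  have := congrArg (PowerSeries.coeff j) h
  simp only [genSeries, PowerSeries.coeff_mk] at this
  exact (measureReal_eq_measureReal_iff).mp this

open Measure in
/-- Spitzer's identity for the queue started empty. -/
theorem spitzer_measure (ν : Measure ℕ) [IsProbabilityMeasure ν] (s n : ℕ) :
    ((n : ℝ≥0∞) + 1) • queueLaw ν s (n + 1)
      = ∑ ij ∈ Finset.HasAntidiagonal.antidiagonal n,
        (excessLaw ν s (ij.1 + 1) ∗ queueLaw ν s ij.2) := by
  have hfin : IsFiniteMeasure (((n : ℝ≥0∞) + 1) • queueLaw ν s (n + 1)) :=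
    Measure.smul_finite _ (by finiteness)
  refine measure_ext_genSeries ?_
  have key := spitzer_series
    (HahnSeries.single (-(s : ℤ)) (1 : ℝ) * HahnSeries.ofPowerSeries ℤ ℝ (genSeries ν))
    (fun k => genSeries (excessLaw ν s k)) (fun k => genSeries (queueLaw ν s k))
    (by simp [queueLaw, genSeries_dirac_zero]) ?_ ?_ n
  · ext j
    have h1 := congrArg (PowerSeries.coeff j) key
    simp only [← genSeries_conv, _root_.map_sum] at h1
    have h2 : ((n : PowerSeries ℝ) + 1) = PowerSeries.C ((n : ℝ) + 1) := by simp
    rw [h2, PowerSeries.coeff_C_mul] at h1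
    simp only [genSeries, PowerSeries.coeff_mk] at h1 ⊢
    rw [measureReal_ennreal_smul_apply, measureReal_def _ {j},
      measureReal_def, Measure.finsetSum_apply, ENNReal.toReal_sum fun _ _ => by finiteness]
    simp only [measureReal_def] at h1
    rw [← h1]
    congr 1
  · intro k
    have := shift_sub_truncShift_mem (k * s) (genSeries ν ^ k)
    rw [excessLaw, genSeries_map_sub, genSeries_totalLaw, mul_pow,
      HahnSeries.single_pow, ← map_pow (HahnSeries.ofPowerSeries ℤ ℝ)]
    simpa using this
  · intro k
    have := shift_sub_truncShift_mem s (genSeries (queueLaw ν s k ∗ ν))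
    rw [genSeries_conv, map_mul] at this
    rw [queueLaw, genSeries_map_sub, genSeries_conv]
    convert this using 1
    ring

/-! ### The law of the queue length process -/

theorem queue_succ {Ω : Type*} (s : ℕ) (A : ℕ → Ω → ℕ) (k : ℕ) (ω : Ω) :
    queue s A (k + 1) ω = queue s A k ω + A k ω - s := by
  simp only [queue]
  omega

theorem queue_congr {Ω Ω' : Type*} (s : ℕ) {A : ℕ → Ω → ℕ} {B : ℕ → Ω' → ℕ} {ω : Ω} {ω' : Ω'}
    (k : ℕ) (h : ∀ i < k, A i ω = B i ω') : queue s A k ω = queue s B k ω' := by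
  induction k with
  | zero => rfl
  | succ k ih => rw [queue_succ, queue_succ, ih fun i hi => h i (by omega), h k (by omega)]

theorem aemeasurable_queue {Ω : Type*} [MeasurableSpace Ω] {P : Measure Ω} (s : ℕ)
    {A : ℕ → Ω → ℕ} (hA : ∀ k, AEMeasurable (A k) P) (k : ℕ) :
    AEMeasurable (queue s A k) P := by
  induction k with
  | zero => exact aemeasurable_const
  | succ k ih =>
    have : queue s A (k + 1) = fun ω => queue s A k ω + A k ω - s := funext (queue_succ s A k)
    rw [this]
    exact (measurable_of_countable (fun j : ℕ => j - s)).comp_aemeasurable (ih.add (hA k))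

theorem indepFun_queue {Ω : Type*} [MeasurableSpace Ω] {P : Measure Ω} [IsProbabilityMeasure P]
    (s : ℕ) {A : ℕ → Ω → ℕ} (hA : ∀ k, AEMeasurable (A k) P) (hindep : iIndepFun A P) (k : ℕ) :
    IndepFun (queue s A k) (A k) P := by
  have h := hindep.indepFun_finset₀ (Finset.range k) {k} (by simp) hA
  let g : (Finset.range k → ℕ) → ℕ :=
    queue s (fun i x => if h : i ∈ Finset.range k then x ⟨i, h⟩ else 0) k
  have := h.comp (φ := g) (ψ := fun x : ({k} : Finset ℕ) → ℕ => x ⟨k, by simp⟩) (measurable_of_countable _)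
    (measurable_of_countable _)
  have hg : queue s A k = g ∘ fun ω (i : Finset.range k) => A i ω := by
    ext ω
    refine queue_congr s k fun i hi => ?_
    simp [hi]
  rw [hg]
  exact this

theorem map_queue {Ω : Type*} [MeasurableSpace Ω] {P : Measure Ω} [IsProbabilityMeasure P]
    (s : ℕ) {A : ℕ → Ω → ℕ} {ν : Measure ℕ} (hA : ∀ k, HasLaw (A k) ν P)
    (hindep : iIndepFun A P) (k : ℕ) : P.map (queue s A k) = queueLaw ν s k := by
  have hm := fun k => (hA k).aemeasurable
  induction k with
  | zero =>
    have : queue s A 0 = fun _ => 0 := rfl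
    rw [this, Measure.map_const, queueLaw]
    simp
  | succ k ih =>
    have hq := aemeasurable_queue s hm k
    have : queue s A (k + 1) = (fun j : ℕ => j - s) ∘ (fun ω => queue s A k ω + A k ω) :=
      funext (queue_succ s A k)
    rw [this, queueLaw, ← ih, ← (hA k).map_eq, Measure.conv,
      ← (indepFun_iff_map_prod_eq_prod_map_map hq (hm k)).mp (indepFun_queue s hm hindep k),
      AEMeasurable.map_map_of_aemeasurable (by fun_prop) (hq.prodMk (hm k)),
      AEMeasurable.map_map_of_aemeasurable (by fun_prop)]
    · rfl
    · exact Measurable.comp_aemeasurable (by fun_prop) (hq.prodMk (hm k))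

/-! ### Solving the recursions that Spitzer's identity gives for moments -/

open Finset.HasAntidiagonal in
/-- The recursion for the first moments `m n`, solved. -/
theorem first_moment_recursion {x m : ℕ → ℝ} (h0 : m 0 = 0)
    (h : ∀ n : ℕ, ((n : ℝ) + 1) * m (n + 1) = ∑ ij ∈ antidiagonal n, (x (ij.1 + 1) + m ij.2))
    (n : ℕ) : m (n + 1) = m n + x (n + 1) / (n + 1) := by
  rcases n with _ | n
  · have := h 0
    simp only [Nat.cast_zero, zero_add, one_mul, antidiagonal_zero, Finset.sum_singleton, h0] at this
    simp [h0, this]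
  · have h1 := h n
    have h2 := h (n + 1)
    rw [Finset.sum_add_distrib] at h1 h2
    rw [Finset.Nat.sum_antidiagonal_succ (f := fun ij => m ij.2),
      ← Finset.Nat.sum_antidiagonal_swap (f := fun ij => x (ij.1 + 1)),
      Finset.Nat.sum_antidiagonal_succ] at h2
    rw [← Finset.Nat.sum_antidiagonal_swap (f := fun ij => x (ij.1 + 1))] at h1
    simp only [Prod.fst_swap] at h1 h2
    push_cast at h2 ⊢
    have : (n : ℝ) + 1 + 1 ≠ 0 := by positivity
    field_simp
    linear_combination h2 - h1

/-- A power series with coefficients bounded by `1` may be differentiated term by term. -/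
theorem hasDerivAt_tsum_pow {c : ℕ → ℝ} (hc : ∀ n, |c n| ≤ 1) {t : ℝ} (ht : t ∈ Set.Ioo (-1 : ℝ) 1) :
    HasDerivAt (fun t => ∑' n, c n * t ^ n) (∑' n : ℕ, ((n : ℝ) + 1) * c (n + 1) * t ^ n) t := by
  have hs : ∀ r : ℝ, |r| < 1 → Summable fun n : ℕ => (n : ℝ) * r ^ (n - 1) := by
    intro r hr
    rw [← summable_nat_add_iff 1]
    have h1 := summable_pow_mul_geometric_of_norm_lt_one 1 (r := r) (by simpa using hr)
    have h2 := summable_geometric_of_norm_lt_one (x := r) (by simpa using hr)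
    refine (h1.add h2).congr fun n => ?_
    simp; ring
  obtain ⟨r, hr, hr1⟩ : ∃ r, |t| < r ∧ r < 1 := exists_between (abs_lt.mpr ht)
  have hr0 : 0 < r := (abs_nonneg t).trans_lt hr
  have key := hasDerivAt_tsum_of_isPreconnected (𝕜 := ℝ) (t := Set.Ioo (-r) r)
    (u := fun n : ℕ => (n : ℝ) * r ^ (n - 1))
    (g := fun n t => c n * t ^ n) (g' := fun n t => c n * (n * t ^ (n - 1))) (y₀ := 0) (y := t)
    (hs r (by rwa [abs_of_pos hr0])) isOpen_Ioo isPreconnected_Ioo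
    (fun n y _ => (hasDerivAt_pow n y).const_mul _) ?_ ⟨by linarith, hr0⟩ ?_ (abs_lt.mp hr)
  · have hsum : Summable fun n : ℕ => c n * (n * t ^ (n - 1)) := by
      refine Summable.of_norm_bounded (hs |t| (by rw [abs_abs]; exact abs_lt.mpr ht)) fun n => ?_
      rw [norm_mul, norm_mul, norm_pow]
      simp only [Real.norm_eq_abs, Nat.abs_cast]
      exact mul_le_of_le_one_left (by positivity) (hc n)
    rw [hsum.tsum_eq_zero_add] at key
    simp only [CharP.cast_eq_zero, zero_mul, mul_zero, zero_add, Nat.cast_add, Nat.cast_one,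
      Nat.add_sub_cancel] at key
    refine key.congr_deriv (tsum_congr fun n => by ring)
  · intro n y hy
    have hy' : |y| ≤ r := (abs_lt.mpr hy).le
    rw [norm_mul, norm_mul, norm_pow]
    simp only [Real.norm_eq_abs, Nat.abs_cast]
    calc |c n| * (n * |y| ^ (n - 1)) ≤ 1 * (n * r ^ (n - 1)) := by gcongr; exact hc n
      _ = _ := one_mul _
  · refine summable_of_ne_finset_zero (s := {0}) fun n hn => ?_
    simp at hn
    simp [hn]

open Finset.HasAntidiagonal in
/-- The recursion for the second moments `v n`, solved; `m n` are the first moments. -/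
theorem second_moment_recursion {x q m v : ℕ → ℝ} (h0 : m 0 = 0)
    (hm : ∀ n : ℕ, m (n + 1) = m n + x (n + 1) / (n + 1)) (hv0 : v 0 = 0)
    (h : ∀ n : ℕ, ((n : ℝ) + 1) * v (n + 1)
      = ∑ ij ∈ antidiagonal n, (q (ij.1 + 1) + 2 * (x (ij.1 + 1) * m ij.2) + v ij.2))
    (n : ℕ) : v (n + 1) = ∑ k ∈ Finset.range (n + 1), q (k + 1) / (k + 1)
      + ∑ k ∈ Finset.range n, ∑ ij ∈ antidiagonal k,
        x (ij.1 + 1) / (ij.1 + 1) * (x (ij.2 + 1) / (ij.2 + 1)) := by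
  induction n with
  | zero =>
    have := h 0
    simp only [Nat.cast_zero, zero_add, one_mul, antidiagonal_zero, Finset.sum_singleton, h0,
      hv0] at this
    simp [this]
  | succ n ih =>
    rw [Finset.sum_range_succ _ (n + 1),
      Finset.sum_range_succ (fun k => ∑ ij ∈ antidiagonal k, _ / _ * (_ / _)) n]
    have h1 := h n
    have h2 := h (n + 1)
    simp only [Finset.sum_add_distrib] at h1 h2
    rw [Finset.Nat.sum_antidiagonal_succ' (f := fun ij => 2 * (x (ij.1 + 1) * m ij.2)),
      Finset.Nat.sum_antidiagonal_succ (f := fun ij => v ij.2),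
      ← Finset.Nat.sum_antidiagonal_swap (f := fun ij => q (ij.1 + 1)),
      Finset.Nat.sum_antidiagonal_succ] at h2
    rw [← Finset.Nat.sum_antidiagonal_swap (f := fun ij => q (ij.1 + 1))] at h1
    simp only [Prod.fst_swap, h0, mul_zero, zero_add] at h1 h2
    -- the mixed terms of consecutive instances differ by `2 ∑ x m' = (n + 2) ∑ (x / ·) (x / ·)`
    have hmix : ∑ ij ∈ antidiagonal n, 2 * (x (ij.1 + 1) * m (ij.2 + 1))
        - ∑ ij ∈ antidiagonal n, 2 * (x (ij.1 + 1) * m ij.2)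
        = ((n : ℝ) + 2) * ∑ ij ∈ antidiagonal n,
          x (ij.1 + 1) / (ij.1 + 1) * (x (ij.2 + 1) / (ij.2 + 1)) := by
      have e1 : ∑ ij ∈ antidiagonal n, 2 * (x (ij.1 + 1) * m (ij.2 + 1))
          - ∑ ij ∈ antidiagonal n, 2 * (x (ij.1 + 1) * m ij.2)
          = ∑ ij ∈ antidiagonal n, (x (ij.1 + 1) * (x (ij.2 + 1) / (ij.2 + 1)))
          + ∑ ij ∈ antidiagonal n, (x (ij.1 + 1) * (x (ij.2 + 1) / (ij.2 + 1))) := by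
        rw [← Finset.sum_sub_distrib, ← Finset.sum_add_distrib]
        refine Finset.sum_congr rfl fun ij _ => ?_
        rw [hm]; ring
      rw [e1]
      nth_rw 2 [← Finset.Nat.sum_antidiagonal_swap]
      rw [← Finset.sum_add_distrib, Finset.mul_sum]
      refine Finset.sum_congr rfl fun ij hij => ?_
      have hij' : ((ij.1 : ℝ) + 1) + ((ij.2 : ℝ) + 1) = n + 2 := by
        rw [← mem_antidiagonal.mp hij]; push_cast; ring
      rw [← hij']
      simp only [Prod.fst_swap, Prod.snd_swap]
      have : (ij.1 : ℝ) + 1 ≠ 0 := by positivity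
      have : (ij.2 : ℝ) + 1 ≠ 0 := by positivity
      field_simp
    push_cast at h2 ⊢
    have hn : (n : ℝ) + 1 + 1 ≠ 0 := by positivity
    have hstep : ((n : ℝ) + 1 + 1) * v (n + 1 + 1) = ((n : ℝ) + 1 + 1) * v (n + 1) + q (n + 1 + 1)
        + ((n : ℝ) + 2) * ∑ ij ∈ antidiagonal n,
          x (ij.1 + 1) / (ij.1 + 1) * (x (ij.2 + 1) / (ij.2 + 1)) := by
      linear_combination h2 - h1 + hmix
    apply mul_left_cancel₀ hn
    rw [hstep, ih]
    generalize ∑ k ∈ Finset.range (n + 1), q (k + 1) / ((k : ℝ) + 1) = S₁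
    generalize ∑ k ∈ Finset.range n, ∑ ij ∈ antidiagonal k,
      x (ij.1 + 1) / ((ij.1 : ℝ) + 1) * (x (ij.2 + 1) / (ij.2 + 1)) = S₂
    field_simp
    ring

open Finset.HasAntidiagonal in
/-- The recursion for the probabilities `u n` of an empty queue, solved in the limit: in terms of
generating functions, `(1 - t) ∑ u n t ^ n = exp (-∑ w k t ^ k / k)` for `0 ≤ t < 1`, and Abel's
theorem gives the value at `t = 1`. -/
theorem empty_recursion_limit {w u : ℕ → ℝ} {l : ℝ} (h0 : u 0 = 1)
    (hu : ∀ n, |u n| ≤ 1) (hw : ∀ n, w n ∈ Set.Icc (0 : ℝ) 1)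
    (h : ∀ n : ℕ, ((n : ℝ) + 1) * u (n + 1)
      = ∑ ij ∈ antidiagonal n, (1 - w (ij.1 + 1)) * u ij.2)
    (hws : Summable fun n : ℕ => w (n + 1) / (n + 1)) (hl : Tendsto u atTop (𝓝 l)) :
    l = Real.exp (-∑' n : ℕ, w (n + 1) / (n + 1)) := by
  set W : ℝ → ℝ := fun t => ∑' n : ℕ, w n / n * t ^ n with hW
  set U : ℝ → ℝ := fun t => ∑' n : ℕ, u n * t ^ n with hU
  have hwn : ∀ n : ℕ, |w n / n| ≤ 1 := by
    intro n
    rcases n with _ | n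
    · simp
    · rw [abs_of_nonneg (div_nonneg (hw _).1 (by positivity)), div_le_one (by positivity)]
      exact (hw _).2.trans (by simp)
  have hgs : ∀ t ∈ Set.Ioo (-1 : ℝ) 1, Summable fun n => ‖t ^ n‖ := fun t ht => by
    simpa using summable_geometric_of_lt_one (abs_nonneg t) (abs_lt.mpr ht)
  have hbs : ∀ c : ℕ → ℝ, (∀ n, |c n| ≤ 1) → ∀ t ∈ Set.Ioo (-1 : ℝ) 1,
      Summable fun n => ‖c n * t ^ n‖ := fun c hc t ht => by
    refine Summable.of_nonneg_of_le (fun _ => norm_nonneg _) (fun n => ?_) (hgs t ht)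
    rw [norm_mul]
    exact mul_le_of_le_one_left (norm_nonneg _) (hc n)
  have hrb : ∀ n, |1 - w (n + 1)| ≤ 1 := fun n => by
    rw [abs_le]; constructor <;> linarith [(hw (n + 1)).1, (hw (n + 1)).2]
  have hwb : ∀ n, |w (n + 1)| ≤ 1 := fun n => by
    rw [abs_le]; constructor <;> linarith [(hw (n + 1)).1, (hw (n + 1)).2]
  have hdW : ∀ t ∈ Set.Ioo (-1 : ℝ) 1, HasDerivAt W (∑' n : ℕ, w (n + 1) * t ^ n) t := by
    intro t ht
    convert hasDerivAt_tsum_pow hwn ht using 3 with n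
    have : (n : ℝ) + 1 ≠ 0 := by positivity
    push_cast
    field_simp
  have hdU : ∀ t ∈ Set.Ioo (-1 : ℝ) 1,
      HasDerivAt U ((∑' n : ℕ, (1 - w (n + 1)) * t ^ n) * U t) t := by
    intro t ht
    convert hasDerivAt_tsum_pow hu ht using 1
    rw [hU, tsum_mul_tsum_eq_tsum_sum_antidiagonal_of_summable_norm
      (hbs (fun n => 1 - w (n + 1)) hrb t ht) (hbs u hu t ht)]
    refine tsum_congr fun n => ?_
    rw [h, Finset.sum_mul]
    refine Finset.sum_congr rfl fun ij hij => ?_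
    rw [← mem_antidiagonal.mp hij, pow_add]
    ring
  have hG : ∀ t ∈ Set.Ioo (-1 : ℝ) 1, (1 - t) * U t * Real.exp (W t) = 1 := by
    have hd : ∀ t ∈ Set.Ioo (-1 : ℝ) 1,
        HasDerivAt (fun t => (1 - t) * U t * Real.exp (W t)) 0 t := by
      intro t ht
      have h1 := ((((hasDerivAt_id t).const_sub 1).mul (hdU t ht)).mul (hdW t ht).exp)
      refine h1.congr_deriv (Eq.symm ?_)
      have hsum : (∑' n : ℕ, (1 - w (n + 1)) * t ^ n) + ∑' n : ℕ, w (n + 1) * t ^ n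
          = (1 - t)⁻¹ := by
        rw [← Summable.tsum_add (hbs _ hrb t ht).of_norm (hbs _ hwb t ht).of_norm,
          ← tsum_geometric_of_abs_lt_one (abs_lt.mpr ht)]
        exact tsum_congr fun n => by ring
      have ht1 : (1 - t) ≠ 0 := by linarith [ht.2]
      have : (1 - t) * ((∑' n : ℕ, (1 - w (n + 1)) * t ^ n) + ∑' n : ℕ, w (n + 1) * t ^ n)
          = 1 := by rw [hsum]; exact mul_inv_cancel₀ ht1
      simp only [Pi.mul_apply, id]
      linear_combination (-U t * Real.exp (W t)) * this
    have hzero : (0 : ℝ) ∈ Set.Ioo (-1 : ℝ) 1 := by norm_num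
    intro t ht
    have := IsOpen.is_const_of_deriv_eq_zero isOpen_Ioo isPreconnected_Ioo
      (fun t ht => (hd t ht).differentiableAt.differentiableWithinAt)
      (fun t ht => (hd t ht).deriv) ht hzero
    rw [this]
    have hW0 : W 0 = 0 := by
      simp only [hW]
      rw [tsum_eq_single 0 (fun n hn => by simp [hn])]
      simp
    have hU0 : U 0 = 1 := by
      simp only [hU]
      rw [tsum_eq_single 0 (fun n hn => by simp [hn])]
      simp [h0]
    simp [hW0, hU0]
  -- the limits at `1` of both factors, by Abel's theorem
  have hWlim : Tendsto W (𝓝[<] 1) (𝓝 (∑' n : ℕ, w (n + 1) / (n + 1))) := by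
    refine Real.tendsto_tsum_powerSeries_nhdsWithin_lt ?_
    rw [← tendsto_add_atTop_iff_nat 1]
    have := hws.hasSum.tendsto_sum_nat
    refine this.congr fun n => ?_
    rw [Finset.sum_range_succ']
    simp
  have hUlim : Tendsto (fun t => (1 - t) * U t) (𝓝[<] 1) (𝓝 l) := by
    have h1 := Real.tendsto_tsum_powerSeries_nhdsWithin_lt
      (f := fun n => u n - if n = 0 then 0 else u (n - 1)) (l := l) (by
        rw [← tendsto_add_atTop_iff_nat 1]
        refine hl.congr fun n => ?_
        induction n with
        | zero => simp
        | succ n ih => rw [Finset.sum_range_succ, ← ih]; simp)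
    refine h1.congr' ?_
    filter_upwards [Ioo_mem_nhdsLT (show (-1 : ℝ) < 1 by norm_num)] with t ht
    have hs1 := (hbs u hu t ht).of_norm
    have hs2 : Summable fun n : ℕ => (if n = 0 then 0 else u (n - 1)) * t ^ n := by
      rw [← summable_nat_add_iff 1]
      refine (hs1.mul_left t).congr fun n => ?_
      simp [pow_succ]; ring
    simp only [sub_mul, one_mul]
    rw [hs1.tsum_sub hs2, hs2.tsum_eq_zero_add]
    simp only [hU, if_true, zero_mul, zero_add, ← tsum_mul_left]
    congr 1
    refine tsum_congr fun n => ?_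
    simp [pow_succ]; ring
  have hlim := hUlim.mul ((Real.continuous_exp.tendsto _).comp hWlim)
  have hone : Tendsto (fun t => (1 - t) * U t * (Real.exp ∘ W) t) (𝓝[<] 1) (𝓝 1) := by
    refine tendsto_const_nhds.congr' ?_
    filter_upwards [Ioo_mem_nhdsLT (show (-1 : ℝ) < 1 by norm_num)] with t ht
    exact (hG t ht).symm
  have := tendsto_nhds_unique hlim hone
  rw [Real.exp_neg]
  exact eq_inv_of_mul_eq_one_left this

/-! ### Moments of the queue length at finite times -/

section Moments
open Measure

theorem integrable_natCast_of_sq {μ : Measure ℕ} [IsProbabilityMeasure μ]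
    (h : Integrable (fun j : ℕ => (j : ℝ) ^ 2) μ) : Integrable (fun j : ℕ => (j : ℝ)) μ := by
  refine h.mono' (by fun_prop) (Eventually.of_forall fun j => ?_)
  rw [Real.norm_eq_abs, Nat.abs_cast]
  exact_mod_cast Nat.le_self_pow two_ne_zero j

theorem integrable_sq_conv {μ ν : Measure ℕ} [IsProbabilityMeasure μ] [IsProbabilityMeasure ν]
    (hμ : Integrable (fun j : ℕ => (j : ℝ) ^ 2) μ) (hν : Integrable (fun j : ℕ => (j : ℝ) ^ 2) ν) :
    Integrable (fun j : ℕ => (j : ℝ) ^ 2) (μ ∗ ν) := by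
  rw [conv, integrable_map_measure (by fun_prop) (by fun_prop)]
  have h := ((hμ.comp_fst ν).const_mul 2).add ((hν.comp_snd μ).const_mul 2)
  refine h.mono' (by fun_prop) (Eventually.of_forall fun z => ?_)
  simp only [Function.comp, Pi.add_apply, Nat.cast_add, norm_pow, Real.norm_eq_abs, sq_abs]
  nlinarith [sq_nonneg ((z.1 : ℝ) - z.2)]

theorem integrable_sq_map_sub {μ : Measure ℕ} [IsProbabilityMeasure μ] (d : ℕ)
    (hμ : Integrable (fun j : ℕ => (j : ℝ) ^ 2) μ) :
    Integrable (fun j : ℕ => (j : ℝ) ^ 2) (μ.map (· - d)) := by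
  rw [integrable_map_measure (by fun_prop) (by fun_prop)]
  refine hμ.mono' (by fun_prop) (Eventually.of_forall fun z => ?_)
  simp only [Function.comp, norm_pow, Real.norm_eq_abs, sq_abs]
  gcongr
  omega

theorem integral_conv_natCast {μ ν : Measure ℕ} [IsProbabilityMeasure μ] [IsProbabilityMeasure ν]
    (hμ : Integrable (fun j : ℕ => (j : ℝ) ^ 2) μ) (hν : Integrable (fun j : ℕ => (j : ℝ) ^ 2) ν) :
    ∫ j, (j : ℝ) ∂(μ ∗ ν) = ∫ j, (j : ℝ) ∂μ + ∫ j, (j : ℝ) ∂ν := by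
  have h1 := (integrable_natCast_of_sq hμ).comp_fst ν
  have h2 := (integrable_natCast_of_sq hν).comp_snd μ
  rw [conv, integral_map (by fun_prop) (by fun_prop)]
  simp only [Nat.cast_add]
  rw [integral_add h1 h2, integral_fun_fst (fun j : ℕ => (j : ℝ)),
    integral_fun_snd (fun j : ℕ => (j : ℝ))]
  simp

theorem integral_conv_sq {μ ν : Measure ℕ} [IsProbabilityMeasure μ] [IsProbabilityMeasure ν]
    (hμ : Integrable (fun j : ℕ => (j : ℝ) ^ 2) μ) (hν : Integrable (fun j : ℕ => (j : ℝ) ^ 2) ν) :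
    ∫ j, (j : ℝ) ^ 2 ∂(μ ∗ ν) = ∫ j, (j : ℝ) ^ 2 ∂μ
      + 2 * ((∫ j, (j : ℝ) ∂μ) * ∫ j, (j : ℝ) ∂ν) + ∫ j, (j : ℝ) ^ 2 ∂ν := by
  have h1 := hμ.comp_fst ν
  have h2 := hν.comp_snd μ
  have h3 := ((integrable_natCast_of_sq hμ).mul_prod (integrable_natCast_of_sq hν)).const_mul 2
  rw [conv, integral_map (by fun_prop) (by fun_prop)]
  have : ∀ z : ℕ × ℕ, ((z.1 + z.2 : ℕ) : ℝ) ^ 2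
      = (z.1 : ℝ) ^ 2 + 2 * ((z.1 : ℝ) * z.2) + (z.2 : ℝ) ^ 2 := fun z => by push_cast; ring
  simp only [this]
  have e := integral_add (f := fun z : ℕ × ℕ => (z.1 : ℝ) ^ 2 + 2 * ((z.1 : ℝ) * z.2))
    (h1.add h3) h2
  rw [e, integral_add h1 h3, integral_fun_fst (fun j : ℕ => (j : ℝ) ^ 2),
    integral_fun_snd (fun j : ℕ => (j : ℝ) ^ 2), integral_const_mul,
    integral_prod_mul (fun j : ℕ => (j : ℝ)) (fun j : ℕ => (j : ℝ))]
  simp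

variable {ν : Measure ℕ} [IsProbabilityMeasure ν]

theorem integrable_sq_excessLaw (hν : Integrable (fun j : ℕ => (j : ℝ) ^ 2) ν) (s k : ℕ) :
    Integrable (fun j : ℕ => (j : ℝ) ^ 2) (excessLaw ν s k) := by
  refine integrable_sq_map_sub _ ?_
  induction k with
  | zero => exact integrable_dirac (by simp)
  | succ k ih => exact integrable_sq_conv ih hν

theorem integrable_sq_queueLaw (hν : Integrable (fun j : ℕ => (j : ℝ) ^ 2) ν) (s k : ℕ) :
    Integrable (fun j : ℕ => (j : ℝ) ^ 2) (queueLaw ν s k) := by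
  induction k with
  | zero => exact integrable_dirac (by simp)
  | succ k ih => exact integrable_sq_map_sub _ (integrable_sq_conv ih hν)

theorem integral_spitzer (s n : ℕ) {f : ℕ → ℝ}
    (hf : ∀ i j, Integrable f (excessLaw ν s i ∗ queueLaw ν s j)) :
    ((n : ℝ) + 1) * ∫ j, f j ∂(queueLaw ν s (n + 1))
      = ∑ ij ∈ Finset.HasAntidiagonal.antidiagonal n,
        ∫ j, f j ∂(excessLaw ν s (ij.1 + 1) ∗ queueLaw ν s ij.2) := by
  rw [← integral_finsetSum_measure fun ij _ => hf _ _, ← spitzer_measure, integral_smul_measure]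
  congr 1

theorem integral_queueLaw_succ (hν : Integrable (fun j : ℕ => (j : ℝ) ^ 2) ν) (s n : ℕ) :
    ∫ j, (j : ℝ) ∂(queueLaw ν s (n + 1)) = ∫ j, (j : ℝ) ∂(queueLaw ν s n)
      + (∫ j, (j : ℝ) ∂(excessLaw ν s (n + 1))) / (n + 1) := by
  refine first_moment_recursion (x := fun k => ∫ j, (j : ℝ) ∂(excessLaw ν s k))
    (m := fun k => ∫ j, (j : ℝ) ∂(queueLaw ν s k)) (by simp [queueLaw]) (fun n => ?_) n
  have hE := integrable_sq_excessLaw hν s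
  have hQ := integrable_sq_queueLaw hν s
  rw [integral_spitzer s n fun i j =>
    integrable_natCast_of_sq (integrable_sq_conv (hE i) (hQ j))]
  exact Finset.sum_congr rfl fun ij _ => integral_conv_natCast (hE _) (hQ _)

theorem integral_queueLaw (hν : Integrable (fun j : ℕ => (j : ℝ) ^ 2) ν) (s n : ℕ) :
    ∫ j, (j : ℝ) ∂(queueLaw ν s n)
      = ∑ k ∈ Finset.range n, (∫ j, (j : ℝ) ∂(excessLaw ν s (k + 1))) / (k + 1) := by
  induction n with
  | zero => simp [queueLaw]
  | succ n ih => rw [integral_queueLaw_succ hν, Finset.sum_range_succ, ih]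

theorem integral_sq_queueLaw (hν : Integrable (fun j : ℕ => (j : ℝ) ^ 2) ν) (s n : ℕ) :
    ∫ j, (j : ℝ) ^ 2 ∂(queueLaw ν s (n + 1))
      = ∑ k ∈ Finset.range (n + 1), (∫ j, (j : ℝ) ^ 2 ∂(excessLaw ν s (k + 1))) / (k + 1)
      + ∑ k ∈ Finset.range n, ∑ ij ∈ Finset.HasAntidiagonal.antidiagonal k,
        (∫ j, (j : ℝ) ∂(excessLaw ν s (ij.1 + 1))) / (ij.1 + 1)
          * ((∫ j, (j : ℝ) ∂(excessLaw ν s (ij.2 + 1))) / (ij.2 + 1)) := by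
  refine second_moment_recursion (x := fun k => ∫ j, (j : ℝ) ∂(excessLaw ν s k))
    (q := fun k => ∫ j, (j : ℝ) ^ 2 ∂(excessLaw ν s k))
    (m := fun k => ∫ j, (j : ℝ) ∂(queueLaw ν s k))
    (v := fun k => ∫ j, (j : ℝ) ^ 2 ∂(queueLaw ν s k)) (by simp [queueLaw])
    (integral_queueLaw_succ hν s) (by simp [queueLaw]) (fun n => ?_) n
  have hE := integrable_sq_excessLaw hν s
  have hQ := integrable_sq_queueLaw hν s
  rw [integral_spitzer s n fun i j => integrable_sq_conv (hE i) (hQ j)]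
  exact Finset.sum_congr rfl fun ij _ => integral_conv_sq (hE _) (hQ _)

theorem conv_real_zero (μ ν : Measure ℕ) [IsProbabilityMeasure μ] [IsProbabilityMeasure ν] :
    (μ ∗ ν).real {0} = μ.real {0} * ν.real {0} := by
  have := congrArg (PowerSeries.coeff 0) (genSeries_conv μ ν)
  simpa [PowerSeries.coeff_mul, genSeries] using this

theorem queueLaw_real_zero (s n : ℕ) :
    ((n : ℝ) + 1) * (queueLaw ν s (n + 1)).real {0}
      = ∑ ij ∈ Finset.HasAntidiagonal.antidiagonal n,
        (1 - (excessLaw ν s (ij.1 + 1)).real {0}ᶜ) * (queueLaw ν s ij.2).real {0} := by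
  have h := integral_spitzer (ν := ν) s n (f := Set.indicator {0} 1) fun i j =>
    (integrable_const (1 : ℝ)).indicator (by measurability)
  have h1 : ∀ μ : Measure ℕ, ∫ j, Set.indicator {0} (1 : ℕ → ℝ) j ∂μ = μ.real {0} := fun μ =>
    integral_indicator_one (by measurability)
  simp only [h1, conv_real_zero] at h
  rw [h]
  refine Finset.sum_congr rfl fun ij _ => ?_
  rw [probReal_compl_eq_one_sub (by measurability), sub_sub_cancel]

end Moments

/-! ### The stationary law -/

section Stationary
open Measure

theorem queueLaw_succ_Ici {ν : Measure ℕ} [SFinite ν] (s k : ℕ) {i : ℕ} (hi : i ≠ 0) :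
    queueLaw ν s (k + 1) (Set.Ici i) = ∫⁻ l, queueLaw ν s k (Set.Ici (i + s - l)) ∂ν := by
  rw [queueLaw, map_apply (by fun_prop) (by measurability), conv,
    map_apply (by fun_prop) (by measurability), prod_apply_symm (by measurability)]
  refine lintegral_congr fun l => ?_
  congr 1
  ext x
  simp
  omega

variable {ν : Measure ℕ} [IsProbabilityMeasure ν]

/-- Started empty, the queue length grows stochastically in time. -/
theorem monotone_queueLaw_Ici (s i : ℕ) : Monotone fun k => queueLaw ν s k (Set.Ici i) := by
  refine monotone_nat_of_le_succ fun k => ?_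
  induction k generalizing i with
  | zero =>
    rcases eq_or_ne i 0 with rfl | hi
    · simp
    · simp [queueLaw, hi]
  | succ k ih =>
    rcases eq_or_ne i 0 with rfl | hi
    · simp
    · rw [queueLaw_succ_Ici s k hi, queueLaw_succ_Ici s (k + 1) hi]
      exact lintegral_mono fun l => ih _

/-- The measure on `ℕ` whose point masses are the limits of those of the queue lengths. -/
noncomputable def limitLaw (ν : Measure ℕ) (s : ℕ) : Measure ℕ :=
  Measure.sum fun i : ℕ => (limUnder atTop fun k : ℕ => queueLaw ν s k {i}) • Measure.dirac i

theorem tendsto_queueLaw_singleton (s i : ℕ) :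
    Tendsto (fun k => queueLaw ν s k {i}) atTop (𝓝 (limitLaw ν s {i})) := by
  have h : ∀ k, queueLaw ν s k {i}
      = queueLaw ν s k (Set.Ici i) - queueLaw ν s k (Set.Ici (i + 1)) := by
    intro k
    rw [← measure_sdiff (Set.Ici_subset_Ici.mpr (by omega)) (by measurability) (by finiteness)]
    congr 1
    ext x; simp; omega
  have hT := fun i => tendsto_atTop_iSup (monotone_queueLaw_Ici (ν := ν) s i)
  have hlim : ∃ l, Tendsto (fun k => queueLaw ν s k {i}) atTop (𝓝 l) := by
    simp only [h]
    refine ⟨_, ENNReal.Tendsto.sub (hT i) (hT (i + 1)) (Or.inl ?_)⟩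
    exact ((iSup_le fun k => prob_le_one).trans_lt ENNReal.one_lt_top).ne
  convert tendsto_nhds_limUnder hlim
  rw [limitLaw, Measure.sum_apply _ (by measurability), tsum_eq_single i fun j hj => by simp [hj]]
  simp

theorem tendsto_queueLaw_Iio (s i : ℕ) :
    Tendsto (fun k => queueLaw ν s k (Set.Iio i)) atTop (𝓝 (limitLaw ν s (Set.Iio i))) := by
  have h : ∀ μ : Measure ℕ, μ (Set.Iio i) = ∑ j ∈ Finset.range i, μ {j} := by
    intro μ
    rw [sum_measure_singleton]
    congr 1
    ext; simp
  simp only [h]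
  exact tendsto_finsetSum _ fun j _ => tendsto_queueLaw_singleton s j

theorem isProbabilityMeasure_limitLaw {s : ℕ} {M : ℝ≥0∞} (hM : M ≠ ∞)
    (hbound : ∀ k, ∫⁻ j : ℕ, (j : ℝ≥0∞) ∂(queueLaw ν s k) ≤ M) :
    IsProbabilityMeasure (limitLaw ν s) := by
  have hsup : Tendsto (fun i : ℕ => limitLaw ν s (Set.Iio i)) atTop
      (𝓝 (limitLaw ν s Set.univ)) := by
    have := tendsto_measure_iUnion_atTop (μ := limitLaw ν s) (s := fun i : ℕ => Set.Iio i)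
      (fun i j hij => Set.Iio_subset_Iio hij)
    rwa [show ⋃ i : ℕ, Set.Iio i = Set.univ from
      Set.eq_univ_of_forall fun x => Set.mem_iUnion.mpr ⟨x + 1, Nat.lt_succ_self x⟩] at this
  constructor
  refine le_antisymm (le_of_tendsto' hsup fun i =>
    le_of_tendsto' (tendsto_queueLaw_Iio s i) fun k => prob_le_one) ?_
  have h1 : ∀ i : ℕ, i ≠ 0 → 1 ≤ limitLaw ν s (Set.Iio i) + M / i := by
    intro i hi
    refine ge_of_tendsto' ((tendsto_queueLaw_Iio s i).add_const _) fun k => ?_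
    have h2 : queueLaw ν s k (Set.Ici i) ≤ M / i := by
      refine (meas_ge_le_lintegral_div (f := fun j : ℕ => (j : ℝ≥0∞)) (ε := i) (by fun_prop)
        (by simpa using hi) (by simp)).trans' (le_of_eq ?_) |>.trans
        (ENNReal.div_le_div_right (hbound k) _)
      congr 1
      ext; simp
    calc (1 : ℝ≥0∞) = queueLaw ν s k (Set.Iio i ∪ Set.Ici i) := by
          rw [Set.Iio_union_Ici, measure_univ]
      _ ≤ queueLaw ν s k (Set.Iio i) + queueLaw ν s k (Set.Ici i) := measure_union_le _ _
      _ ≤ _ := by gcongr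
  have h3 : Tendsto (fun i : ℕ => limitLaw ν s (Set.Iio i) + M / i) atTop
      (𝓝 (limitLaw ν s Set.univ + 0)) :=
    hsup.add (by
      simpa using ENNReal.Tendsto.const_div ENNReal.tendsto_nat_nhds_top (Or.inr hM))
  rw [add_zero] at h3
  refine ge_of_tendsto h3 ?_
  filter_upwards [eventually_ne_atTop 0] with i hi using h1 i hi

theorem lintegral_eq_tsum_Ici (μ : Measure ℕ) (g : ℕ → ℝ≥0∞) :
    ∫⁻ j, ∑ i ∈ Finset.range j, g i ∂μ = ∑' i : ℕ, g i * μ (Set.Ici (i + 1)) := by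
  have : ∀ j : ℕ, ∑ i ∈ Finset.range j, g i
      = ∑' i : ℕ, (Set.Ici (i + 1)).indicator (fun _ => g i) j := by
    intro j
    rw [tsum_eq_sum (s := Finset.range j)]
    · refine Finset.sum_congr rfl fun i hi => ?_
      rw [Set.indicator_of_mem]
      simpa using hi
    · intro i hi
      rw [Set.indicator_of_notMem]
      simpa using hi
  simp only [this]
  rw [lintegral_tsum fun i => by fun_prop]
  refine tsum_congr fun i => ?_
  rw [lintegral_indicator_const (by measurability)]

/-- Monotone convergence of expectations of nondecreasing functions (here in the form
`j ↦ ∑ i < j, g i`) along the stochastically increasing laws of the queue length. -/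
theorem tendsto_lintegral_queueLaw {s : ℕ} [IsProbabilityMeasure (limitLaw ν s)] {g : ℕ → ℝ≥0∞}
    (hg : ∀ i, g i ≠ ∞) :
    Tendsto (fun k => ∫⁻ j, ∑ i ∈ Finset.range j, g i ∂(queueLaw ν s k)) atTop
      (𝓝 (∫⁻ j, ∑ i ∈ Finset.range j, g i ∂(limitLaw ν s))) := by
  have hIci : ∀ i, Tendsto (fun k => queueLaw ν s k (Set.Ici i)) atTop
      (𝓝 (limitLaw ν s (Set.Ici i))) := by
    intro i
    have h : ∀ μ : Measure ℕ, IsProbabilityMeasure μ → μ (Set.Ici i) = 1 - μ (Set.Iio i) := by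
      intro μ _
      rw [← prob_compl_eq_one_sub (by measurability), Set.compl_Iio]
    rw [h _ inferInstance]
    simp only [fun k => h (queueLaw ν s k) inferInstance]
    exact ENNReal.Tendsto.sub tendsto_const_nhds (tendsto_queueLaw_Iio s i)
      (Or.inl ENNReal.one_ne_top)
  simp only [lintegral_eq_tsum_Ici, ← lintegral_count]
  refine lintegral_tendsto_of_tendsto_of_monotone (fun k => by fun_prop) ?_ ?_
  · exact Eventually.of_forall fun i k l hkl =>
      mul_le_mul_right (monotone_queueLaw_Ici s (i + 1) hkl) _
  · exact Eventually.of_forall fun i =>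
      ENNReal.Tendsto.const_mul (hIci (i + 1)) (Or.inr (hg i))

theorem tendsto_sum_antidiagonal {y : ℕ → ℝ} (hy : Summable y) (h0 : ∀ k, 0 ≤ y k) :
    Tendsto (fun n => ∑ k ∈ Finset.range n, ∑ ij ∈ Finset.HasAntidiagonal.antidiagonal k,
      y ij.1 * y ij.2) atTop (𝓝 ((∑' k, y k) * ∑' k, y k)) := by
  have hyy := hy.mul_of_nonneg hy h0 h0
  rw [hy.tsum_mul_tsum_eq_tsum_sum_antidiagonal hy hyy]
  exact (summable_sum_mul_antidiagonal_of_summable_mul hyy).hasSum.tendsto_sum_nat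

/-- The stationary queue length: existence, and its first two cumulants and mass at `0` in terms
of the positive parts of the random walk. -/
theorem limitLaw_spec {s : ℕ} (hν : Integrable (fun j : ℕ => (j : ℝ) ^ 2) ν)
    (hq : Summable fun k : ℕ => (∫ j, (j : ℝ) ^ 2 ∂(excessLaw ν s (k + 1))) / ((k : ℝ) + 1)) :
    IsProbabilityMeasure (limitLaw ν s) ∧ MemLp (fun j : ℕ => (j : ℝ)) 2 (limitLaw ν s) ∧
    ∫ j, (j : ℝ) ∂(limitLaw ν s)
      = ∑' k : ℕ, (∫ j, (j : ℝ) ∂(excessLaw ν s (k + 1))) / ((k : ℝ) + 1) ∧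
    (limitLaw ν s).real {0}
      = Real.exp (-∑' k : ℕ, (excessLaw ν s (k + 1)).real {0}ᶜ / ((k : ℝ) + 1)) ∧
    variance (fun j : ℕ => (j : ℝ)) (limitLaw ν s)
      = ∑' k : ℕ, (∫ j, (j : ℝ) ^ 2 ∂(excessLaw ν s (k + 1))) / ((k : ℝ) + 1) := by
  have hE := integrable_sq_excessLaw hν s
  have hQ := integrable_sq_queueLaw hν s
  have hx0 : ∀ k : ℕ, 0 ≤ (∫ j, (j : ℝ) ∂(excessLaw ν s (k + 1))) / ((k : ℝ) + 1) := fun k =>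
    div_nonneg (integral_nonneg fun j => by positivity) (by positivity)
  have hx : Summable fun k : ℕ => (∫ j, (j : ℝ) ∂(excessLaw ν s (k + 1))) / ((k : ℝ) + 1) := by
    refine Summable.of_nonneg_of_le hx0 (fun k => ?_) hq
    refine div_le_div_of_nonneg_right ?_ (by positivity)
    refine integral_mono (integrable_natCast_of_sq (hE _)) (hE _) fun j => ?_
    change (j : ℝ) ≤ (j : ℝ) ^ 2
    exact_mod_cast Nat.le_self_pow two_ne_zero j
  have hw : Summable fun k : ℕ => (excessLaw ν s (k + 1)).real {0}ᶜ / ((k : ℝ) + 1) := by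
    refine Summable.of_nonneg_of_le (fun k => by positivity) (fun k => ?_) hq
    refine div_le_div_of_nonneg_right ?_ (by positivity)
    rw [← integral_indicator_one (by measurability)]
    refine integral_mono ((integrable_const (1 : ℝ)).indicator (by measurability)) (hE _)
      fun j => ?_
    rcases eq_or_ne j 0 with rfl | hj
    · simp
    · simp only [Set.indicator, Set.mem_compl_iff, Set.mem_singleton_iff, hj, not_false_eq_true,
        if_true, Pi.one_apply]
      exact_mod_cast Nat.one_le_pow _ _ (Nat.pos_of_ne_zero hj)
  set X := ∑' k : ℕ, (∫ j, (j : ℝ) ∂(excessLaw ν s (k + 1))) / ((k : ℝ) + 1) with hX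
  set V := ∑' k : ℕ, (∫ j, (j : ℝ) ^ 2 ∂(excessLaw ν s (k + 1))) / ((k : ℝ) + 1) with hV
  have hm : Tendsto (fun n => ∫ j, (j : ℝ) ∂(queueLaw ν s n)) atTop (𝓝 X) := by
    simp only [integral_queueLaw hν]
    exact hx.hasSum.tendsto_sum_nat
  have hv : Tendsto (fun n => ∫ j, (j : ℝ) ^ 2 ∂(queueLaw ν s n)) atTop (𝓝 (V + X * X)) := by
    rw [← tendsto_add_atTop_iff_nat 1]
    simp only [integral_sq_queueLaw hν]
    refine ((tendsto_add_atTop_iff_nat 1).mpr hq.hasSum.tendsto_sum_nat).add ?_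
    have hxx := tendsto_sum_antidiagonal hx hx0
    rw [← hX] at hxx
    exact hxx
  -- nonnegative integrals as Lebesgue integrals, in the two forms needed
  have hl1 : ∀ (μ : Measure ℕ), ∫⁻ j, ∑ i ∈ Finset.range j, 1 ∂μ
      = ∫⁻ j : ℕ, ENNReal.ofReal (j : ℝ) ∂μ := by
    intro μ
    refine lintegral_congr fun j => ?_
    simp
  have hl2 : ∀ (μ : Measure ℕ), ∫⁻ j, ∑ i ∈ Finset.range j, ((2 * i + 1 : ℕ) : ℝ≥0∞) ∂μ
      = ∫⁻ j : ℕ, ENNReal.ofReal ((j : ℝ) ^ 2) ∂μ := by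
    intro μ
    refine lintegral_congr fun j => ?_
    rw [← Nat.cast_sum, ← Nat.cast_pow, ENNReal.ofReal_natCast]
    congr 1
    induction j with
    | zero => simp
    | succ j ih => rw [Finset.sum_range_succ, ih]; ring
  have hb : ∀ k, ∫⁻ j : ℕ, (j : ℝ≥0∞) ∂(queueLaw ν s k) ≤ ENNReal.ofReal X := by
    intro k
    have : ∫⁻ j : ℕ, (j : ℝ≥0∞) ∂(queueLaw ν s k)
        = ENNReal.ofReal (∫ j, (j : ℝ) ∂(queueLaw ν s k)) := by
      rw [ofReal_integral_eq_lintegral_ofReal (integrable_natCast_of_sq (hQ k))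
        (Eventually.of_forall fun j => by positivity)]
      simp
    rw [this, integral_queueLaw hν]
    exact ENNReal.ofReal_le_ofReal (hx.sum_le_tsum _ fun k _ => hx0 k)
  have hprob : IsProbabilityMeasure (limitLaw ν s) :=
    isProbabilityMeasure_limitLaw ENNReal.ofReal_ne_top hb
  have hm' : ∫⁻ j : ℕ, ENNReal.ofReal (j : ℝ) ∂(limitLaw ν s) = ENNReal.ofReal X := by
    have h1 := tendsto_lintegral_queueLaw (ν := ν) (s := s) (g := fun _ => 1) (by simp)
    simp only [hl1] at h1
    refine tendsto_nhds_unique h1 ((ENNReal.tendsto_ofReal hm).congr fun k => ?_)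
    exact ofReal_integral_eq_lintegral_ofReal (integrable_natCast_of_sq (hQ k))
      (Eventually.of_forall fun j => by positivity)
  have hv' : ∫⁻ j : ℕ, ENNReal.ofReal ((j : ℝ) ^ 2) ∂(limitLaw ν s)
      = ENNReal.ofReal (V + X * X) := by
    have h1 := tendsto_lintegral_queueLaw (ν := ν) (s := s)
      (g := fun i => ((2 * i + 1 : ℕ) : ℝ≥0∞)) (fun i => ENNReal.natCast_ne_top _)
    simp only [hl2] at h1
    refine tendsto_nhds_unique h1 ((ENNReal.tendsto_ofReal hv).congr fun k => ?_)
    exact ofReal_integral_eq_lintegral_ofReal (hQ k)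
      (Eventually.of_forall fun j => by positivity)
  have hX0 : 0 ≤ X := tsum_nonneg hx0
  have hV0 : 0 ≤ V := tsum_nonneg fun k =>
    div_nonneg (integral_nonneg fun j => by positivity) (by positivity)
  have hmean : ∫ j, (j : ℝ) ∂(limitLaw ν s) = X := by
    rw [integral_eq_lintegral_of_nonneg_ae (Eventually.of_forall fun j => by positivity)
      (by fun_prop), hm', ENNReal.toReal_ofReal hX0]
  have hsecond : ∫ j, (j : ℝ) ^ 2 ∂(limitLaw ν s) = V + X * X := by
    rw [integral_eq_lintegral_of_nonneg_ae (Eventually.of_forall fun j => by positivity)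
      (by fun_prop), hv', ENNReal.toReal_ofReal (by positivity)]
  have hL2 : MemLp (fun j : ℕ => (j : ℝ)) 2 (limitLaw ν s) := by
    rw [memLp_two_iff_integrable_sq (by fun_prop)]
    refine ⟨by fun_prop, ?_⟩
    rw [hasFiniteIntegral_iff_ofReal (Eventually.of_forall fun j => by positivity), hv']
    exact ENNReal.ofReal_lt_top
  refine ⟨hprob, hL2, hmean, ?_, ?_⟩
  · refine empty_recursion_limit (w := fun k => (excessLaw ν s k).real {0}ᶜ)
      (u := fun k => (queueLaw ν s k).real {0}) (by simp [queueLaw, measureReal_def])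
      (fun n => ?_) (fun n => ⟨measureReal_nonneg, measureReal_le_one⟩) (queueLaw_real_zero s) hw ?_
    · rw [abs_of_nonneg measureReal_nonneg]
      exact measureReal_le_one
    · exact (ENNReal.tendsto_toReal (by finiteness)).comp (tendsto_queueLaw_singleton s 0)
  · rw [variance_eq_sub hL2]
    simp only [Pi.pow_apply]
    rw [hsecond, hmean]
    ring

end Stationary

/-! ### The moment generating function of the Gamma–Poisson law -/

section GammaPoisson
variable {a b : ℝ}

theorem isProbabilityMeasure_gammaPoisson (ha : 0 < a) (hb : 0 < b) :
    IsProbabilityMeasure (gammaPoisson a b) := by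
  have := isProbabilityMeasure_gammaMeasure ha (one_div_pos.mpr hb)
  refine ⟨?_⟩
  rw [gammaPoisson, Measure.bind_apply MeasurableSet.univ measurable_poisson.aemeasurable]
  simp only [measure_univ, lintegral_one]

theorem lintegral_exp_poissonMeasure (r : ℝ≥0) (θ : ℝ) :
    ∫⁻ j : ℕ, ENNReal.ofReal (Real.exp (θ * j)) ∂(poissonMeasure r)
      = ENNReal.ofReal (Real.exp (r * (Real.exp θ - 1))) := by
  have hs : HasSum (fun j : ℕ => Real.exp (-r) * r ^ j / j.factorial * Real.exp (θ * j))
      (Real.exp (r * (Real.exp θ - 1))) := by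
    have := (NormedSpace.expSeries_div_hasSum_exp ((r : ℝ) * Real.exp θ)).mul_left (Real.exp (-r))
    rw [← Real.exp_eq_exp_ℝ, ← Real.exp_add] at this
    have e1 : (r : ℝ) * (Real.exp θ - 1) = -r + r * Real.exp θ := by ring
    rw [e1]
    refine this.congr_fun fun j => ?_
    rw [mul_pow, ← Real.exp_nat_mul, mul_comm θ]
    ring
  have hint : Integrable (fun j : ℕ => Real.exp (θ * j)) (poissonMeasure r) := by
    rw [integrable_poissonMeasure_iff]
    simpa using hs.summable
  rw [← ofReal_integral_eq_lintegral_ofReal hint (Eventually.of_forall fun j => (Real.exp_pos _).le),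
    integral_poissonMeasure]
  simp only [smul_eq_mul, hs.tsum_eq]

theorem lintegral_exp_gammaPoisson (ha : 0 < a) (hb : 0 < b) {θ : ℝ}
    (hθ : 0 < 1 - b * (Real.exp θ - 1)) :
    ∫⁻ j : ℕ, ENNReal.ofReal (Real.exp (θ * j)) ∂(gammaPoisson a b)
      = ENNReal.ofReal ((1 - b * (Real.exp θ - 1)) ^ (-a)) := by
  set R : ℝ := 1 / b - (Real.exp θ - 1) with hR
  have hRb : 1 - b * (Real.exp θ - 1) = b * R := by rw [hR]; field_simp
  have hR0 : 0 < R := by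
    rw [hRb] at hθ
    exact pos_of_mul_pos_right hθ hb.le
  rw [gammaPoisson, Measure.lintegral_bind measurable_poisson.aemeasurable (by fun_prop)]
  simp only [lintegral_exp_poissonMeasure]
  have hmeas : ∀ R, Measurable (gammaPDF a R) := fun R =>
    (measurable_gammaPDFReal a R).ennreal_ofReal
  rw [gammaMeasure, lintegral_withDensity_eq_lintegral_mul _
    (hmeas (1 / b)) (by fun_prop), hRb]
  have hpt : ∀ r : ℝ, (gammaPDF a (1 / b) * fun r : ℝ => ENNReal.ofReal
      (Real.exp ((r.toNNReal : ℝ) * (Real.exp θ - 1)))) r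
      = ENNReal.ofReal ((b * R) ^ (-a)) * gammaPDF a R r := by
    intro r
    rw [Pi.mul_apply]
    rcases lt_or_ge r 0 with hr | hr
    · rw [gammaPDF_of_neg hr, gammaPDF_of_neg hr]; simp
    · rw [gammaPDF_of_nonneg hr, gammaPDF_of_nonneg hr, ← ENNReal.ofReal_mul (by positivity),
        ← ENNReal.ofReal_mul (by positivity)]
      congr 1
      rw [Real.coe_toNNReal r hr, Real.rpow_neg (by positivity), Real.mul_rpow hb.le hR0.le,
        Real.div_rpow zero_le_one hb.le, Real.one_rpow]
      have h1 : Real.exp (-(1 / b * r)) * Real.exp (r * (Real.exp θ - 1)) = Real.exp (-(R * r)) := by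
        rw [← Real.exp_add]; congr 1; rw [hR]; ring
      have h2 : R ^ a ≠ 0 := (Real.rpow_pos_of_pos hR0 a).ne'
      have h3 : b ^ a ≠ 0 := (Real.rpow_pos_of_pos hb a).ne'
      rw [mul_assoc, h1]
      field_simp
  simp only [hpt]
  rw [lintegral_const_mul _ (hmeas R),
    lintegral_gammaPDF_eq_one ha hR0, mul_one]

theorem integrable_exp_gammaPoisson (ha : 0 < a) (hb : 0 < b) {θ : ℝ}
    (hθ : 0 < 1 - b * (Real.exp θ - 1)) :
    Integrable (fun j : ℕ => Real.exp (θ * j)) (gammaPoisson a b) := by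
  refine ⟨by fun_prop, ?_⟩
  rw [hasFiniteIntegral_iff_ofReal (Eventually.of_forall fun j => (Real.exp_pos _).le),
    lintegral_exp_gammaPoisson ha hb hθ]
  exact ENNReal.ofReal_lt_top

theorem mgf_gammaPoisson (ha : 0 < a) (hb : 0 < b) {θ : ℝ}
    (hθ : 0 < 1 - b * (Real.exp θ - 1)) :
    mgf (fun j : ℕ => (j : ℝ)) (gammaPoisson a b) θ = (1 - b * (Real.exp θ - 1)) ^ (-a) := by
  rw [mgf, integral_eq_lintegral_of_nonneg_ae (Eventually.of_forall fun j => (Real.exp_pos _).le)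
    (by fun_prop), lintegral_exp_gammaPoisson ha hb hθ, ENNReal.toReal_ofReal (by positivity)]

theorem re_one_sub_pos (hb : 0 < b) {z : ℂ} (hz : 0 < 1 - b * (Real.exp z.re - 1)) :
    0 < (1 - b * (Complex.exp z - 1)).re := by
  have h : (Complex.exp z).re ≤ Real.exp z.re := by
    rw [← Complex.norm_exp]; exact Complex.re_le_norm _
  simp only [Complex.sub_re, Complex.one_re, Complex.re_ofReal_mul]
  nlinarith

/-- The moment generating function of the Gamma–Poisson law at complex arguments, by analytic
continuation from the real axis. -/
theorem complexMGF_gammaPoisson (ha : 0 < a) (hb : 0 < b) {z : ℂ}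
    (hz : 0 < 1 - b * (Real.exp z.re - 1)) :
    complexMGF (fun j : ℕ => (j : ℝ)) (gammaPoisson a b) z
      = Complex.exp (-a * Complex.log (1 - b * (Complex.exp z - 1))) := by
  set U : Set ℂ := {z | z.re < Real.log (1 + 1 / b)} with hU
  have hmem : ∀ t : ℝ, t < Real.log (1 + 1 / b) ↔ 0 < 1 - b * (Real.exp t - 1) := by
    intro t
    rw [Real.lt_log_iff_exp_lt (by positivity)]
    have : b * (1 / b) = 1 := by field_simp
    constructor <;> intro h <;> nlinarith
  have hUo : IsOpen U := isOpen_lt Complex.continuous_re continuous_const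
  have hUc : IsPreconnected U := (convex_halfSpace_re_lt _).isPreconnected
  have h0 : (0 : ℂ) ∈ U := (hmem (0 : ℂ).re).mpr (by simp)
  have hsub : Set.Iio (Real.log (1 + 1 / b))
      ⊆ interior (integrableExpSet (fun j : ℕ => (j : ℝ)) (gammaPoisson a b)) := by
    refine interior_maximal (fun t ht => ?_) isOpen_Iio
    exact integrable_exp_gammaPoisson ha hb ((hmem t).mp ht)
  have hf : AnalyticOnNhd ℂ (complexMGF (fun j : ℕ => (j : ℝ)) (gammaPoisson a b)) U :=
    analyticOnNhd_complexMGF.mono fun z hz => hsub hz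
  have hg : AnalyticOnNhd ℂ
      (fun z => Complex.exp (-a * Complex.log (1 - b * (Complex.exp z - 1)))) U := by
    refine DifferentiableOn.analyticOnNhd (fun z hz => ?_) hUo
    have hz' : (1 - b * (Complex.exp z - 1)) ∈ Complex.slitPlane :=
      Or.inl (re_one_sub_pos hb ((hmem z.re).mp hz))
    refine DifferentiableAt.differentiableWithinAt ?_
    fun_prop (disch := assumption)
  refine hf.eqOn_of_preconnected_of_frequently_eq hg hUc h0 ?_ ((hmem z.re).mpr hz)
  have htend : Tendsto (fun t : ℝ => (t : ℂ)) (𝓝[≠] 0) (𝓝[≠] 0) := by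
    refine tendsto_nhdsWithin_of_tendsto_nhds_of_eventually_within _ ?_ ?_
    · exact (Complex.continuous_ofReal.tendsto' 0 0 (by simp)).mono_left nhdsWithin_le_nhds
    · filter_upwards [self_mem_nhdsWithin] with t ht
      simpa using ht
  refine htend.frequently (Eventually.frequently ?_)
  have h0' : (0 : ℝ) < Real.log (1 + 1 / b) := by simpa [hU] using h0
  filter_upwards [nhdsWithin_le_nhds (Iio_mem_nhds h0')] with t ht
  have ht' := (hmem t).mp ht
  rw [complexMGF_ofReal, mgf_gammaPoisson ha hb ht', Real.rpow_def_of_pos ht']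
  push_cast
  rw [Complex.ofReal_log ht'.le]
  push_cast
  congr 1
  ring

end GammaPoisson

/-- The logarithm of the moment generating function of the demand in excess of the capacity, on
the scale `b √a` of its standard deviation, converges to that of the normal law with mean `-β` and
variance `1`. -/
theorem tendsto_log_mgf {a b s : ℕ → ℝ} {β : ℝ} (ha : ∀ n, 0 < a n) (hb : ∀ n, 0 < b n)
    (ha_lim : Tendsto a atTop atTop) (hb_lim : Tendsto b atTop atTop)
    (hs : Tendsto (fun n => (s n - a n * b n) / (b n * √(a n))) atTop (𝓝 β)) (ζ : ℂ) :
    Tendsto (fun n => -(a n : ℂ) * Complex.log (1 - b n *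
        (Complex.exp (ζ / ((b n * √(a n) : ℝ) : ℂ)) - 1)) - s n * (ζ / ((b n * √(a n) : ℝ) : ℂ)))
      atTop (𝓝 (ζ ^ 2 / 2 - β * ζ)) := by
  have hσ : Tendsto (fun n => √(a n)) atTop atTop := Real.tendsto_sqrt_atTop.comp ha_lim
  have hσ0 : ∀ n, √(a n) ≠ 0 := fun n => (Real.sqrt_pos.mpr (ha n)).ne'
  have hb0 : ∀ n, b n ≠ 0 := fun n => (hb n).ne'
  have hσσ : ∀ n, ((√(a n) : ℝ) : ℂ) * (√(a n) : ℝ) = a n := fun n => by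
    rw [← Complex.ofReal_mul, Real.mul_self_sqrt (ha n).le]
  set w : ℕ → ℂ := fun n => ζ / ((b n * √(a n) : ℝ) : ℂ) with hw
  set ε : ℕ → ℂ := fun n => Complex.exp (w n) - 1 - w n with hε
  set y : ℕ → ℂ := fun n => b n * (Complex.exp (w n) - 1) with hy
  have hinv : ∀ {f : ℕ → ℝ}, Tendsto f atTop atTop →
      Tendsto (fun n => ((f n : ℂ))⁻¹) atTop (𝓝 0) := by
    intro f hf
    have := (Complex.continuous_ofReal.tendsto 0).comp hf.inv_tendsto_atTop
    simpa [Function.comp_def] using this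
  have hw0 : Tendsto w atTop (𝓝 0) := by
    have := (hinv (hb_lim.atTop_mul_atTop₀ hσ)).const_mul ζ
    simpa [hw, div_eq_mul_inv] using this
  have hwle : ∀ᶠ n in atTop, ‖w n‖ ≤ 1 := by
    have := (tendsto_zero_iff_norm_tendsto_zero.mp hw0).eventually (gt_mem_nhds one_pos)
    filter_upwards [this] with n hn using hn.le
  -- the quadratic remainder of the exponential is negligible
  have hε0 : Tendsto (fun n => (a n : ℂ) * b n * ε n) atTop (𝓝 0) := by
    have hlim : Tendsto (fun n => ‖ζ‖ ^ 2 * (b n)⁻¹) atTop (𝓝 0) := by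
      simpa using hb_lim.inv_tendsto_atTop.const_mul (‖ζ‖ ^ 2)
    refine squeeze_zero_norm' ?_ hlim
    filter_upwards [hwle] with n hn
    have h1 := Complex.norm_exp_sub_one_sub_id_le hn
    have hwn : ‖w n‖ ^ 2 = ‖ζ‖ ^ 2 / (b n ^ 2 * a n) := by
      simp only [hw]
      rw [norm_div, Complex.norm_real, div_pow, Real.norm_eq_abs, sq_abs, mul_pow,
        Real.sq_sqrt (ha n).le]
    rw [norm_mul, norm_mul, Complex.norm_real, Complex.norm_real, Real.norm_of_nonneg (ha n).le,
      Real.norm_of_nonneg (hb n).le]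
    calc a n * b n * ‖ε n‖ ≤ a n * b n * ‖w n‖ ^ 2 := by
          have := ha n; have := hb n; gcongr
      _ = ‖ζ‖ ^ 2 * (b n)⁻¹ := by
          rw [hwn]
          have := ha n; have := hb n
          field_simp
  have hye : ∀ n, y n = ζ / (√(a n) : ℝ) + b n * ε n := by
    intro n
    have h1 : (b n : ℂ) ≠ 0 := by exact_mod_cast hb0 n
    have h2 : ((√(a n) : ℝ) : ℂ) ≠ 0 := by exact_mod_cast hσ0 n
    simp only [hy, hε, hw]
    push_cast
    field_simp
    ring
  have hσy : Tendsto (fun n => ((√(a n) : ℝ) : ℂ) * y n) atTop (𝓝 ζ) := by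
    have h1 := ((hinv hσ).mul hε0).const_add ζ
    simp only [zero_mul, add_zero] at h1
    refine h1.congr fun n => ?_
    have h2 : ((√(a n) : ℝ) : ℂ) ≠ 0 := by exact_mod_cast hσ0 n
    rw [hye, ← hσσ n]
    field_simp
  have hy0 : Tendsto y atTop (𝓝 0) := by
    have := (hinv hσ).mul hσy
    rw [zero_mul] at this
    refine this.congr fun n => ?_
    have h2 : ((√(a n) : ℝ) : ℂ) ≠ 0 := by exact_mod_cast hσ0 n
    field_simp
  have hlin : Tendsto (fun n => (a n : ℂ) * y n - s n * w n) atTop (𝓝 (-(β * ζ))) := by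
    have h1 := ((Complex.continuous_ofReal.tendsto β).comp hs).mul_const ζ
    have h2 := hε0.sub h1
    rw [zero_sub] at h2
    refine h2.congr fun n => ?_
    have h3 : (b n : ℂ) ≠ 0 := by exact_mod_cast hb0 n
    have h4 : ((√(a n) : ℝ) : ℂ) ≠ 0 := by exact_mod_cast hσ0 n
    rw [hye]
    simp only [Function.comp, hw]
    push_cast
    rw [← hσσ n]
    field_simp
    ring
  have hquad : Tendsto (fun n => (a n : ℂ) * y n ^ 2 / 2) atTop (𝓝 (ζ ^ 2 / 2)) := by
    refine ((hσy.pow 2).div_const 2).congr fun n => ?_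
    rw [← hσσ n]; ring
  have hcub : Tendsto (fun n => (a n : ℂ) *
      (Complex.log (1 - y n) + y n + y n ^ 2 / 2)) atTop (𝓝 0) := by
    have hy1 : ∀ᶠ n in atTop, ‖y n‖ ≤ 1 / 2 := by
      have := (tendsto_zero_iff_norm_tendsto_zero.mp hy0).eventually
        (gt_mem_nhds (show (0 : ℝ) < 1 / 2 by norm_num))
      filter_upwards [this] with n hn using hn.le
    have hlim : Tendsto (fun n => ‖((√(a n) : ℝ) : ℂ) * y n‖ ^ 2 * ‖y n‖) atTop (𝓝 0) := by
      simpa using (hσy.norm.pow 2).mul hy0.norm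
    refine squeeze_zero_norm' ?_ hlim
    filter_upwards [hy1] with n hn
    have h1 := Complex.norm_log_sub_logTaylor_le 2 (z := -y n) (by rw [norm_neg]; linarith)
    have h2 : Complex.log (1 + -y n) - Complex.logTaylor (2 + 1) (-y n)
        = Complex.log (1 - y n) + y n + y n ^ 2 / 2 := by
      simp [Complex.logTaylor, Finset.sum_range_succ]
      ring_nf
    rw [h2, norm_neg] at h1
    have h3 : (1 - ‖y n‖)⁻¹ ≤ 2 := by
      rw [inv_le_comm₀ (by linarith) (by norm_num)]; linarith
    rw [norm_mul (a n : ℂ), norm_mul ((√(a n) : ℝ) : ℂ), Complex.norm_real, Complex.norm_real,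
      Real.norm_of_nonneg (ha n).le, Real.norm_of_nonneg (Real.sqrt_nonneg _), mul_pow (√(a n)), Real.sq_sqrt (ha n).le,
      mul_assoc]
    have := ha n
    gcongr
    refine h1.trans ?_
    norm_num
    have h4 : 0 ≤ ‖y n‖ ^ 3 := by positivity
    nlinarith
  have hfin := (hlin.add hquad).sub hcub
  rw [sub_zero, neg_add_eq_sub] at hfin
  refine hfin.congr fun n => ?_
  simp only [hy]
  ring

/-! ### Exponential bounds for the random walk -/

section Chernoff

theorem integral_totalLaw_of_mul {𝕜 : Type*} [RCLike 𝕜] (ν : Measure ℕ) [IsProbabilityMeasure ν]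
    {f : ℕ → 𝕜} (h0 : f 0 = 1) (hf : ∀ i j, f (i + j) = f i * f j) (k : ℕ) :
    ∫ j, f j ∂(totalLaw ν k) = (∫ j, f j ∂ν) ^ k := by
  induction k with
  | zero => simp [totalLaw, h0]
  | succ k ih =>
    rw [totalLaw, Measure.conv, integral_map (by fun_prop) (by fun_prop)]
    simp only [hf]
    rw [integral_prod_mul, ih, pow_succ]

theorem integrable_totalLaw_of_mul (ν : Measure ℕ) [IsProbabilityMeasure ν]
    {f : ℕ → ℝ} (hf : ∀ i j, f (i + j) = f i * f j) (hint : Integrable f ν) (k : ℕ) :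
    Integrable f (totalLaw ν k) := by
  induction k with
  | zero => exact integrable_dirac (by simp)
  | succ k ih =>
    rw [totalLaw, Measure.conv, integrable_map_measure (by fun_prop) (by fun_prop)]
    have : (f ∘ fun x : ℕ × ℕ => x.1 + x.2) = fun x => f x.1 * f x.2 := funext fun x => hf _ _
    rw [this]
    exact ih.mul_prod hint

theorem integrable_pow_of_exp {μ : Measure ℕ} {θ : ℝ} (hθ : 0 < θ)
    (hint : Integrable (fun j : ℕ => Real.exp (θ * j)) μ) (p : ℕ) :
    Integrable (fun j : ℕ => (j : ℝ) ^ p) μ := by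
  refine (hint.const_mul (p.factorial / θ ^ p)).mono' (by fun_prop)
    (Eventually.of_forall fun j => ?_)
  have h := Real.pow_div_factorial_le_exp (θ * j) (by positivity) p
  rw [norm_pow, Real.norm_eq_abs, Nat.abs_cast]
  rw [div_le_iff₀ (by positivity), mul_pow] at h
  rw [div_mul_eq_mul_div, le_div_iff₀ (by positivity)]
  linarith

variable {ν : Measure ℕ} [IsProbabilityMeasure ν] {θ : ℝ}

theorem integral_exp_sub_totalLaw (s k : ℕ) :
    ∫ m : ℕ, Real.exp (θ * (m - k * s)) ∂(totalLaw ν k)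
      = (Real.exp (-(θ * s)) * ∫ j : ℕ, Real.exp (θ * j) ∂ν) ^ k := by
  rw [mul_pow, ← integral_totalLaw_of_mul ν (f := fun j : ℕ => Real.exp (θ * j)) (by simp)
    (fun i j => by rw [← Real.exp_add]; push_cast; congr 1; ring), ← Real.exp_nat_mul,
    ← integral_const_mul]
  refine integral_congr_ae (Eventually.of_forall fun m => ?_)
  simp only
  rw [← Real.exp_add]
  congr 1
  ring

theorem integrable_exp_sub_totalLaw (hint : Integrable (fun j : ℕ => Real.exp (θ * j)) ν)
    (s k : ℕ) : Integrable (fun m : ℕ => Real.exp (θ * (m - k * s))) (totalLaw ν k) := by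
  refine ((integrable_totalLaw_of_mul ν (f := fun j : ℕ => Real.exp (θ * j))
    (fun i j => by rw [← Real.exp_add]; push_cast; congr 1; ring) hint k).const_mul
    (Real.exp (-(θ * (k * s))))).congr (Eventually.of_forall fun m => ?_)
  simp only
  rw [← Real.exp_add]
  congr 1
  ring

/-- Chernoff bound for the moments of the positive part of the random walk. -/
theorem integral_pow_excessLaw_le (hθ : 0 < θ)
    (hint : Integrable (fun j : ℕ => Real.exp (θ * j)) ν) (s k : ℕ) {p : ℕ} (hp : p ≠ 0) :
    ∫ j, (j : ℝ) ^ p ∂(excessLaw ν s k) ≤ p.factorial / θ ^ p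
      * (Real.exp (-(θ * s)) * ∫ j : ℕ, Real.exp (θ * j) ∂ν) ^ k := by
  rw [excessLaw, integral_map (by fun_prop) (by fun_prop), ← integral_exp_sub_totalLaw,
    ← integral_const_mul]
  refine integral_mono_of_nonneg (Eventually.of_forall fun m => by positivity)
    ((integrable_exp_sub_totalLaw hint s k).const_mul _) (Eventually.of_forall fun m => ?_)
  simp only
  rcases le_total m (k * s) with hm | hm
  · rw [Nat.sub_eq_zero_of_le hm, Nat.cast_zero, zero_pow hp]
    positivity
  · rw [Nat.cast_sub hm, Nat.cast_mul]
    have hm' : (0 : ℝ) ≤ (m : ℝ) - k * s := by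
      rw [sub_nonneg]; exact_mod_cast hm
    have h := Real.pow_div_factorial_le_exp (θ * ((m : ℝ) - k * s)) (by positivity) p
    rw [div_le_iff₀ (by positivity), mul_pow] at h
    rw [div_mul_eq_mul_div, le_div_iff₀ (by positivity)]
    linarith

theorem excessLaw_real_compl_zero_le (hθ : 0 < θ)
    (hint : Integrable (fun j : ℕ => Real.exp (θ * j)) ν) (s k : ℕ) :
    (excessLaw ν s k).real {0}ᶜ
      ≤ (Real.exp (-(θ * s)) * ∫ j : ℕ, Real.exp (θ * j) ∂ν) ^ k := by
  rw [← integral_exp_sub_totalLaw, excessLaw,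
    map_measureReal_apply (by fun_prop) (by measurability),
    ← integral_indicator_one (by measurability)]
  refine integral_mono_of_nonneg (Eventually.of_forall fun m => Set.indicator_nonneg (by simp) _)
    (integrable_exp_sub_totalLaw hint s k) (Eventually.of_forall fun m => ?_)
  simp only [Set.indicator, Set.mem_preimage, Set.mem_compl_iff, Set.mem_singleton_iff,
    Pi.one_apply]
  split_ifs with h
  · positivity
  · have hm : (0 : ℝ) ≤ (m : ℝ) - k * s := by
      rw [sub_nonneg]
      exact_mod_cast (show k * s ≤ m by omega)
    exact Real.one_le_exp (by positivity)

/-- A walk whose steps have an exponential moment below `1` satisfies the summability on which the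
description of the stationary law rests. -/
theorem summable_sq_excessLaw (hθ : 0 < θ)
    (hint : Integrable (fun j : ℕ => Real.exp (θ * j)) ν) {s : ℕ}
    (hr : Real.exp (-(θ * s)) * ∫ j : ℕ, Real.exp (θ * j) ∂ν < 1) :
    Summable fun k : ℕ => (∫ j, (j : ℝ) ^ 2 ∂(excessLaw ν s (k + 1))) / ((k : ℝ) + 1) := by
  set r := Real.exp (-(θ * s)) * ∫ j : ℕ, Real.exp (θ * j) ∂ν with hrdef
  have hr0 : 0 ≤ r := mul_nonneg (Real.exp_pos _).le (integral_nonneg fun j => (Real.exp_pos _).le)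
  refine Summable.of_nonneg_of_le
    (fun k => div_nonneg (integral_nonneg fun j => by positivity) (by positivity)) (fun k => ?_)
    (((summable_geometric_of_lt_one hr0 hr).mul_left r).mul_left ((2 : ℕ).factorial / θ ^ 2))
  refine (div_le_self (integral_nonneg fun j => by positivity) (by simp)).trans ?_
  rw [← pow_succ']
  exact integral_pow_excessLaw_le hθ hint s (k + 1) two_ne_zero

end Chernoff

/-- In a stable system the demand in excess of the capacity has an exponential moment below `1`. -/
theorem exists_exp_moment_lt_one {a b : ℝ} (ha : 0 < a) (hb : 0 < b) {s : ℕ} (hs : a * b < s) :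
    ∃ θ > 0, Integrable (fun j : ℕ => Real.exp (θ * j)) (gammaPoisson a b) ∧
      Real.exp (-(θ * s)) * ∫ j : ℕ, Real.exp (θ * j) ∂(gammaPoisson a b) < 1 := by
  have hd : HasDerivAt (fun θ : ℝ => -(a * Real.log (1 - b * (Real.exp θ - 1))) - θ * s)
      (a * b - s) 0 := by
    have h1 : HasDerivAt (fun θ : ℝ => 1 - b * (Real.exp θ - 1)) (-(b * Real.exp 0)) 0 :=
      (((Real.hasDerivAt_exp 0).sub_const 1).const_mul b).const_sub 1
    have h2 := ((h1.log (by simp)).const_mul a).neg.sub ((hasDerivAt_id (0 : ℝ)).mul_const (s : ℝ))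
    refine h2.congr_deriv ?_
    simp
  have hneg : ∀ᶠ θ in 𝓝[>] (0 : ℝ),
      -(a * Real.log (1 - b * (Real.exp θ - 1))) - θ * s < 0 := by
    have h3 := (hasDerivAt_iff_tendsto_slope.mp hd).mono_left
      (nhdsWithin_mono (0 : ℝ) (fun x hx => ne_of_gt hx : Set.Ioi (0 : ℝ) ⊆ {0}ᶜ))
    filter_upwards [h3.eventually (gt_mem_nhds (show a * b - (s : ℝ) < 0 by linarith)),
      self_mem_nhdsWithin] with θ h4 h5
    rw [slope_def_field] at h4
    simp only [Real.exp_zero, sub_self, mul_zero, sub_zero, Real.log_one, zero_mul, neg_zero] at h4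
    have := (div_neg_iff.mp h4).resolve_left (fun h => absurd h5 (not_lt.mpr h.2.le))
    exact this.1
  have hpos : ∀ᶠ θ in 𝓝[>] (0 : ℝ), 0 < 1 - b * (Real.exp θ - 1) := by
    have hc : Continuous fun θ : ℝ => 1 - b * (Real.exp θ - 1) := by fun_prop
    exact ((hc.tendsto 0).eventually (lt_mem_nhds (by simp))).filter_mono nhdsWithin_le_nhds
  obtain ⟨θ, ⟨h1, h2⟩, h3⟩ := ((hneg.and hpos).and self_mem_nhdsWithin).exists
  refine ⟨θ, h3, integrable_exp_gammaPoisson ha hb h2, ?_⟩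
  have := mgf_gammaPoisson ha hb h2
  rw [mgf] at this
  rw [this, Real.rpow_def_of_pos h2, ← Real.exp_add, Real.exp_lt_one_iff]
  linarith

/-! ### Weak convergence of the rescaled random walk -/

/-- Weak convergence together with bounded second moments of a nonnegative continuous function
gives convergence of its first moments, by the layer cake formula. -/
theorem tendsto_integral_of_weak {μ : ℕ → ProbabilityMeasure ℝ} {μ₀ : ProbabilityMeasure ℝ}
    (hμ : Tendsto μ atTop (𝓝 μ₀)) {f : ℝ → ℝ} (hf : Continuous f) (hf0 : ∀ x, 0 ≤ f x)
    (hnull : ∀ t > 0, (μ₀ : Measure ℝ) {x | f x = t} = 0) (hint₀ : Integrable f (μ₀ : Measure ℝ))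
    (hint : ∀ᶠ n in atTop, Integrable f (μ n : Measure ℝ)) {C : ℝ}
    (hint2 : ∀ᶠ n in atTop, Integrable (fun x => f x ^ 2) (μ n : Measure ℝ))
    (hC : ∀ᶠ n in atTop, ∫ x, f x ^ 2 ∂(μ n : Measure ℝ) ≤ C) :
    Tendsto (fun n => ∫ x, f x ∂(μ n : Measure ℝ)) atTop (𝓝 (∫ x, f x ∂(μ₀ : Measure ℝ))) := by
  have hC0 : 0 ≤ C := by
    obtain ⟨n, hn⟩ := hC.exists
    exact (integral_nonneg fun x => sq_nonneg _).trans hn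
  rw [hint₀.integral_eq_integral_meas_lt (Eventually.of_forall hf0)]
  have hlim : Tendsto (fun n => ∫ t in Set.Ioi 0, (μ n : Measure ℝ).real {x | t < f x}) atTop
      (𝓝 (∫ t in Set.Ioi 0, (μ₀ : Measure ℝ).real {x | t < f x})) := by
    refine tendsto_integral_filter_of_dominated_convergence
      (fun t => (1 + C) * (1 + t ^ 2)⁻¹) ?_ ?_ ?_ ?_
    · refine Eventually.of_forall fun n => ?_
      have : Antitone fun t : ℝ => (μ n : Measure ℝ).real {x | t < f x} := fun t u htu =>
        measureReal_mono fun x hx => htu.trans_lt hx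
      exact this.measurable.aestronglyMeasurable
    · filter_upwards [hint2, hC] with n h2 hn
      refine (ae_restrict_iff' measurableSet_Ioi).mpr (Eventually.of_forall fun t ht => ?_)
      rw [Real.norm_of_nonneg measureReal_nonneg, ← div_eq_mul_inv, le_div_iff₀ (by positivity)]
      have h3 := mul_meas_ge_le_integral_of_nonneg (μ := (μ n : Measure ℝ))
        (Eventually.of_forall fun x => sq_nonneg (f x)) h2 (t ^ 2)
      have h4 : (μ n : Measure ℝ).real {x | t < f x}
          ≤ (μ n : Measure ℝ).real {x | t ^ 2 ≤ f x ^ 2} :=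
        measureReal_mono fun x hx => by
          have ht0 : (0 : ℝ) < t := ht
          have hx' : t < f x := hx
          simp only [Set.mem_ofPred_eq]
          gcongr
      have h5 : (μ n : Measure ℝ).real {x | t < f x} ≤ 1 := measureReal_le_one
      nlinarith [sq_nonneg t]
    · exact (integrable_inv_one_add_sq.const_mul _).integrableOn
    · refine (ae_restrict_iff' measurableSet_Ioi).mpr (Eventually.of_forall fun t ht => ?_)
      have hfr : (μ₀ : Measure ℝ) (frontier {x | t < f x}) = 0 :=
        measure_mono_null ((frontier_lt_subset_eq continuous_const hf).trans fun x hx =>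
          (show f x = t from (Eq.symm hx))) (hnull t ht)
      exact (ENNReal.tendsto_toReal (by finiteness)).comp
        (ProbabilityMeasure.tendsto_measure_of_null_frontier_of_tendsto' hμ hfr)
  refine hlim.congr' ?_
  filter_upwards [hint] with n hn
  exact (hn.integral_eq_integral_meas_lt (Eventually.of_forall hf0)).symm

/-- The law of the random walk after `k` steps, divided by `σ`. -/
noncomputable def scaledLaw (ν : Measure ℕ) (s : ℕ) (σ : ℝ) (k : ℕ) : Measure ℝ :=
  (totalLaw ν k).map fun m : ℕ => ((m : ℝ) - k * s) / σ

instance isProbabilityMeasure_scaledLaw (ν : Measure ℕ) [IsProbabilityMeasure ν] (s : ℕ) (σ : ℝ)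
    (k : ℕ) : IsProbabilityMeasure (scaledLaw ν s σ k) :=
  Measure.isProbabilityMeasure_map (by fun_prop)

theorem max_scaled {σ : ℝ} (hσ : 0 < σ) (m d : ℕ) :
    max (((m : ℝ) - d) / σ) 0 = ((m - d : ℕ) : ℝ) / σ := by
  rcases le_total m d with h | h
  · rw [Nat.sub_eq_zero_of_le h, Nat.cast_zero, zero_div, max_eq_right]
    refine div_nonpos_of_nonpos_of_nonneg ?_ hσ.le
    rw [sub_nonpos]; exact_mod_cast h
  · rw [Nat.cast_sub h, max_eq_left]
    refine div_nonneg ?_ hσ.le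
    rw [sub_nonneg]; exact_mod_cast h

theorem integral_max_pow_scaledLaw (ν : Measure ℕ) (s : ℕ) {σ : ℝ} (hσ : 0 < σ) (k p : ℕ) :
    ∫ x, max x 0 ^ p ∂(scaledLaw ν s σ k) = (∫ j, (j : ℝ) ^ p ∂(excessLaw ν s k)) / σ ^ p := by
  rw [scaledLaw, excessLaw, integral_map (by fun_prop) (by fun_prop),
    integral_map (by fun_prop) (by fun_prop), ← integral_div]
  refine integral_congr_ae (Eventually.of_forall fun m => ?_)
  simp only
  have := max_scaled hσ m (k * s)
  rw [Nat.cast_mul] at this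
  rw [this, div_pow]

theorem integrable_max_pow_scaledLaw {ν : Measure ℕ} {s : ℕ} {σ : ℝ} (hσ : 0 < σ) {k p : ℕ}
    (h : Integrable (fun j : ℕ => (j : ℝ) ^ p) (excessLaw ν s k)) :
    Integrable (fun x => max x 0 ^ p) (scaledLaw ν s σ k) := by
  rw [scaledLaw, integrable_map_measure (by fun_prop) (by fun_prop)]
  rw [excessLaw, integrable_map_measure (by fun_prop) (by fun_prop)] at h
  refine (h.div_const (σ ^ p)).congr (Eventually.of_forall fun m => ?_)
  have := max_scaled hσ m (k * s)
  rw [Nat.cast_mul] at this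
  simp only [Function.comp]
  rw [this, div_pow]

theorem scaledLaw_real_Ioi (ν : Measure ℕ) (s : ℕ) {σ : ℝ} (hσ : 0 < σ) (k : ℕ) :
    (scaledLaw ν s σ k).real (Set.Ioi 0) = (excessLaw ν s k).real {0}ᶜ := by
  rw [scaledLaw, excessLaw, map_measureReal_apply (by fun_prop) (by measurability),
    map_measureReal_apply (by fun_prop) (by measurability)]
  congr 1
  ext m
  simp only [Set.mem_preimage, Set.mem_Ioi, Set.mem_compl_iff, Set.mem_singleton_iff]
  rw [div_pos_iff_of_pos_right hσ, sub_pos, ← Nat.cast_mul, Nat.cast_lt]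
  omega

theorem charFun_scaledLaw {a b : ℝ} (ha : 0 < a) (hb : 0 < b) (s : ℕ) (σ : ℝ) (k : ℕ) (t : ℝ) :
    charFun (scaledLaw (gammaPoisson a b) s σ k) t
      = Complex.exp (-(a : ℂ) * Complex.log (1 - b * (Complex.exp (t * Complex.I / σ) - 1))
        - s * (t * Complex.I / σ)) ^ k := by
  have := isProbabilityMeasure_gammaPoisson ha hb
  have hre : (t * Complex.I / (σ : ℂ)).re = 0 := by
    rw [Complex.div_ofReal_re]; simp
  have hmgf := complexMGF_gammaPoisson ha hb (z := t * Complex.I / σ) (by rw [hre]; simp)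
  rw [charFun_apply_real, scaledLaw, integral_map (by fun_prop) (by fun_prop), sub_eq_add_neg,
    Complex.exp_add, ← hmgf, mul_pow, complexMGF,
    ← integral_totalLaw_of_mul _ (f := fun j : ℕ => Complex.exp (t * Complex.I / σ * (j : ℝ)))
      (by simp) (fun i j => by rw [← Complex.exp_add]; push_cast; congr 1; ring),
    ← Complex.exp_nat_mul, ← integral_mul_const]
  refine integral_congr_ae (Eventually.of_forall fun m => ?_)
  simp only
  rw [← Complex.exp_add]
  congr 1
  push_cast
  ring

section Limit
variable {a b : ℕ → ℝ} {s : ℕ → ℕ} {β : ℝ}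

/-- The exponential moment of the steps at `β / (b √a)` converges to `exp (-β ^ 2 / 2)`. -/
theorem tendsto_exp_moment (ha : ∀ n, 0 < a n) (hb : ∀ n, 0 < b n)
    (ha_lim : Tendsto a atTop atTop) (hb_lim : Tendsto b atTop atTop)
    (hs : Tendsto (fun n => (s n - a n * b n) / (b n * √(a n))) atTop (𝓝 β)) :
    (∀ᶠ n in atTop, Integrable (fun j : ℕ => Real.exp (β / (b n * √(a n)) * j))
      (gammaPoisson (a n) (b n))) ∧
    Tendsto (fun n => Real.exp (-(β / (b n * √(a n)) * s n))
      * ∫ j : ℕ, Real.exp (β / (b n * √(a n)) * j) ∂(gammaPoisson (a n) (b n))) atTop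
      (𝓝 (Real.exp (-β ^ 2 / 2))) := by
  have hpos : ∀ᶠ n in atTop, 0 < 1 - b n * (Real.exp (β / (b n * √(a n))) - 1) := by
    have hσ : Tendsto (fun n => √(a n)) atTop atTop := Real.tendsto_sqrt_atTop.comp ha_lim
    have h1 : Tendsto (fun n => β / (b n * √(a n))) atTop (𝓝 0) :=
      tendsto_const_nhds.div_atTop (hb_lim.atTop_mul_atTop₀ hσ)
    have h2 : ∀ᶠ n in atTop, |β / (b n * √(a n))| ≤ 1 := by
      have := (tendsto_zero_iff_abs_tendsto_zero _).mp h1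
      filter_upwards [this.eventually (gt_mem_nhds one_pos)] with n hn using le_of_lt hn
    have h3 : Tendsto (fun n => 2 * (|β| / √(a n))) atTop (𝓝 0) := by
      simpa using (tendsto_const_nhds (x := |β|).div_atTop hσ).const_mul 2
    filter_upwards [h2, h3.eventually (gt_mem_nhds one_pos)] with n h4 h5
    have h6 := Real.abs_exp_sub_one_le h4
    have h7 : |b n * (Real.exp (β / (b n * √(a n))) - 1)| ≤ 2 * (|β| / √(a n)) := by
      rw [abs_mul, abs_of_pos (hb n)]
      have hbn := hb n
      have hsn := Real.sqrt_pos.mpr (ha n)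
      calc b n * |Real.exp (β / (b n * √(a n))) - 1| ≤ b n * (2 * |β / (b n * √(a n))|) := by
            gcongr
        _ = _ := by
            rw [abs_div, abs_of_pos (show 0 < b n * √(a n) by positivity)]
            field_simp
    linarith [le_abs_self (b n * (Real.exp (β / (b n * √(a n))) - 1))]
  refine ⟨hpos.mono fun n hn => integrable_exp_gammaPoisson (ha n) (hb n) hn, ?_⟩
  have hlim := (Complex.continuous_re.tendsto _).comp ((Complex.continuous_exp.tendsto _).comp
    (tendsto_log_mgf (s := fun n => (s n : ℝ)) ha hb ha_lim hb_lim hs (β : ℂ)))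
  have hval : (Complex.exp ((β : ℂ) ^ 2 / 2 - β * β)).re = Real.exp (-β ^ 2 / 2) := by
    rw [← Complex.ofReal_re (Real.exp _), Complex.ofReal_exp]
    congr 2
    push_cast
    ring
  rw [hval] at hlim
  refine hlim.congr' ?_
  filter_upwards [hpos] with n hn
  have hm := complexMGF_gammaPoisson (ha n) (hb n) (z := ((β / (b n * √(a n)) : ℝ) : ℂ))
    (by rwa [Complex.ofReal_re])
  rw [complexMGF_ofReal] at hm
  simp only [Function.comp]
  have e : Complex.exp (-(a n : ℂ) * Complex.log (1 - b n *
      (Complex.exp (β / ((b n * √(a n) : ℝ) : ℂ)) - 1)) - (s n : ℝ) * (β / ((b n * √(a n) : ℝ) : ℂ)))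
      = ((Real.exp (-(β / (b n * √(a n)) * s n)) * mgf (fun j : ℕ => (j : ℝ))
        (gammaPoisson (a n) (b n)) (β / (b n * √(a n))) : ℝ) : ℂ) := by
    rw [← Complex.ofReal_div, sub_eq_neg_add, Complex.exp_add, ← hm, Complex.ofReal_mul,
      Complex.ofReal_exp, Complex.ofReal_neg, Complex.ofReal_mul, mul_comm ((s n : ℝ) : ℂ)]
  rw [e, Complex.ofReal_re, mgf]

/-- The rescaled random walk converges in law to the Gaussian random walk with drift `-β`. -/
theorem tendsto_scaledLaw (ha : ∀ n, 0 < a n) (hb : ∀ n, 0 < b n)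
    (ha_lim : Tendsto a atTop atTop) (hb_lim : Tendsto b atTop atTop)
    (hs : Tendsto (fun n => (s n - a n * b n) / (b n * √(a n))) atTop (𝓝 β)) (k : ℕ)
    (hprob : ∀ n, IsProbabilityMeasure (gammaPoisson (a n) (b n))) :
    Tendsto (β := ProbabilityMeasure ℝ)
      (fun n => ⟨scaledLaw (gammaPoisson (a n) (b n)) (s n) (b n * √(a n)) k, inferInstance⟩) atTop
      (𝓝 (⟨gaussianReal (-(k * β)) k, inferInstance⟩ : ProbabilityMeasure ℝ)) := by
  refine ProbabilityMeasure.tendsto_iff_tendsto_charFun.mpr fun t => ?_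
  simp only [ProbabilityMeasure.coe_mk, charFun_gaussianReal, charFun_scaledLaw (ha _) (hb _)]
  have h := ((Complex.continuous_exp.tendsto _).comp (tendsto_log_mgf (s := fun n => (s n : ℝ))
    ha hb ha_lim hb_lim hs (t * Complex.I))).pow k
  rw [← Complex.exp_nat_mul] at h
  have e : (k : ℂ) * ((t * Complex.I) ^ 2 / 2 - β * (t * Complex.I))
      = t * ((-(k * β) : ℝ) : ℂ) * Complex.I - ((k : ℝ≥0) : ℝ) * t ^ 2 / 2 := by
    rw [mul_pow, Complex.I_sq]
    push_cast
    ring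
  rw [e] at h
  simpa [Function.comp_def] using h

/-- Convergence of the positive parts of the rescaled random walk, with the geometric bounds that
allow summation over the number `k` of steps. -/
theorem excessLaw_limits (ha : ∀ n, 0 < a n) (hb : ∀ n, 0 < b n) (hβ : 0 < β)
    (ha_lim : Tendsto a atTop atTop) (hb_lim : Tendsto b atTop atTop)
    (hs : Tendsto (fun n => (s n - a n * b n) / (b n * √(a n))) atTop (𝓝 β)) :
    (∀ k : ℕ, k ≠ 0 → Tendsto
      (fun n => (excessLaw (gammaPoisson (a n) (b n)) (s n) k).real {0}ᶜ) atTop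
      (𝓝 ((gaussianReal (-(k * β)) k).real (Set.Ioi 0)))) ∧
    (∀ k : ℕ, k ≠ 0 → ∀ p : ℕ, p ≠ 0 → Tendsto
      (fun n => (∫ j, (j : ℝ) ^ p ∂(excessLaw (gammaPoisson (a n) (b n)) (s n) k))
        / (b n * √(a n)) ^ p) atTop
      (𝓝 (∫ x, max x 0 ^ p ∂(gaussianReal (-(k * β)) k)))) ∧
    ∃ r, 0 ≤ r ∧ r < 1 ∧ ∀ᶠ n in atTop, ∀ k : ℕ,
      (excessLaw (gammaPoisson (a n) (b n)) (s n) k).real {0}ᶜ ≤ r ^ k ∧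
      ∀ p : ℕ, p ≠ 0 → (∫ j, (j : ℝ) ^ p ∂(excessLaw (gammaPoisson (a n) (b n)) (s n) k))
        / (b n * √(a n)) ^ p ≤ p.factorial / β ^ p * r ^ k := by
  have hprob : ∀ n, IsProbabilityMeasure (gammaPoisson (a n) (b n)) := fun n =>
    isProbabilityMeasure_gammaPoisson (ha n) (hb n)
  have hσ : ∀ n, 0 < b n * √(a n) := fun n => mul_pos (hb n) (Real.sqrt_pos.mpr (ha n))
  have hatom : ∀ k : ℕ, k ≠ 0 → NullSingletonClass (gaussianReal (-(k * β)) k) := fun k hk =>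
    nullSingletonClass_gaussianReal (by exact_mod_cast hk)
  obtain ⟨hint, hmom⟩ := tendsto_exp_moment ha hb ha_lim hb_lim hs
  obtain ⟨r, hr1, hr2⟩ : ∃ r, Real.exp (-β ^ 2 / 2) < r ∧ r < 1 := by
    refine exists_between ?_
    rw [Real.exp_lt_one_iff]
    have : 0 < β ^ 2 := by positivity
    linarith
  have hr0 : 0 ≤ r := (Real.exp_pos _).le.trans hr1.le
  have hmom' := hmom.eventually (gt_mem_nhds hr1)
  have hbound : ∀ᶠ n in atTop, ∀ k : ℕ,
      (excessLaw (gammaPoisson (a n) (b n)) (s n) k).real {0}ᶜ ≤ r ^ k ∧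
      ∀ p : ℕ, p ≠ 0 → (∫ j, (j : ℝ) ^ p ∂(excessLaw (gammaPoisson (a n) (b n)) (s n) k))
        / (b n * √(a n)) ^ p ≤ p.factorial / β ^ p * r ^ k := by
    filter_upwards [hint, hmom'] with n h1 h2 k
    have hθ : 0 < β / (b n * √(a n)) := div_pos hβ (hσ n)
    have h3 : (Real.exp (-(β / (b n * √(a n)) * s n))
        * ∫ j : ℕ, Real.exp (β / (b n * √(a n)) * j) ∂(gammaPoisson (a n) (b n))) ^ k ≤ r ^ k :=
      pow_le_pow_left₀ (mul_nonneg (Real.exp_pos _).le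
        (integral_nonneg fun j => (Real.exp_pos _).le)) h2.le k
    refine ⟨(excessLaw_real_compl_zero_le hθ h1 (s n) k).trans h3, fun p hp => ?_⟩
    rw [div_le_iff₀ (pow_pos (hσ n) p)]
    refine (integral_pow_excessLaw_le hθ h1 (s n) k hp).trans
      ((mul_le_mul_of_nonneg_left h3 (by positivity)).trans_eq ?_)
    have := (hσ n).ne'
    rw [div_pow]
    field_simp
  have hintp : ∀ᶠ n in atTop, ∀ k p : ℕ, p ≠ 0 → Integrable (fun j : ℕ => (j : ℝ) ^ p)
      (excessLaw (gammaPoisson (a n) (b n)) (s n) k) := by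
    filter_upwards [hint] with n h1 k p hp
    have hθ : 0 < β / (b n * √(a n)) := div_pos hβ (hσ n)
    rw [excessLaw, integrable_map_measure (by fun_prop) (by fun_prop)]
    refine (integrable_pow_of_exp hθ (integrable_totalLaw_of_mul _
      (f := fun j : ℕ => Real.exp (β / (b n * √(a n)) * j))
      (fun i j => by rw [← Real.exp_add]; push_cast; congr 1; ring) h1 k) p).mono'
      (by fun_prop) (Eventually.of_forall fun m => ?_)
    simp only [Function.comp, norm_pow, Real.norm_eq_abs, Nat.abs_cast]
    gcongr
    omega
  refine ⟨fun k hk => ?_, fun k hk p hp => ?_, r, hr0, hr2, hbound⟩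
  · refine Tendsto.congr (fun n => scaledLaw_real_Ioi _ _ (hσ n) k) ?_
    refine (ENNReal.tendsto_toReal (by finiteness)).comp
      (ProbabilityMeasure.tendsto_measure_of_null_frontier_of_tendsto'
        (tendsto_scaledLaw ha hb ha_lim hb_lim hs k hprob) ?_)
    rw [frontier_Ioi]
    have := hatom k hk
    exact measure_singleton (μ := gaussianReal (-(k * β)) k) 0
  · refine Tendsto.congr (fun n => integral_max_pow_scaledLaw _ _ (hσ n) k p) ?_
    have hpp : ∀ x : ℝ, (max x 0 ^ p) ^ 2 = max x 0 ^ (p * 2) := fun x => by rw [pow_mul]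
    refine tendsto_integral_of_weak (f := fun x => max x 0 ^ p)
      (C := (p * 2).factorial / β ^ (p * 2) * r ^ k)
      (tendsto_scaledLaw ha hb ha_lim hb_lim hs k hprob) (by fun_prop) (fun x => by positivity)
      (fun t ht => ?_) ?_ ?_ ?_ ?_
    · have := hatom k hk
      refine Set.Subsingleton.measure_zero (μ := gaussianReal (-(k * β)) k) ?_
      intro x hx y hy
      have hpos : ∀ z : ℝ, max z 0 ^ p = t → 0 < z := by
        intro z hz
        by_contra hneg
        rw [max_eq_right (not_lt.mp hneg), zero_pow hp] at hz
        exact ht.ne hz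
      have hx' := hpos x hx
      have hy' := hpos y hy
      simp only [Set.mem_ofPred_eq, max_eq_left hx'.le] at hx
      simp only [Set.mem_ofPred_eq, max_eq_left hy'.le] at hy
      exact (pow_left_inj₀ hx'.le hy'.le hp).mp (hx.trans hy.symm)
    · have hL := memLp_id_gaussianReal (μ := -(k * β)) (v := k) (p : ℝ≥0)
      have hL' := hL.integrable_norm_pow (p := p) hp
      refine hL'.mono' (by fun_prop) (Eventually.of_forall fun x => ?_)
      rw [norm_pow]
      gcongr
      simp only [id, Real.norm_eq_abs]
      rw [abs_of_nonneg (le_max_right _ _)]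
      exact max_le (le_abs_self x) (abs_nonneg x)
    · filter_upwards [hintp] with n hn
      exact integrable_max_pow_scaledLaw (hσ n) (hn k p hp)
    · filter_upwards [hintp] with n hn
      simp only [hpp]
      exact integrable_max_pow_scaledLaw (hσ n) (hn k (p * 2) (by omega))
    · filter_upwards [hbound] with n hn
      simp only [hpp, ProbabilityMeasure.coe_mk]
      rw [integral_max_pow_scaledLaw _ _ (hσ n)]
      exact (hn k).2 (p * 2) (by omega)

end Limit

/-! ### Moments of the positive part of the Gaussian random walk -/

section GaussianMoments
variable {β κ : ℝ}

theorem integrable_mul_exp_of_bounded {α C : ℝ} (hκ : 0 < κ) {h : ℝ → ℝ} (hm : Measurable h)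
    (hC : ∀ t, |h t| ≤ C) :
    Integrable (fun t => h t * Real.exp (-(κ * (α + t ^ 2)))) := by
  refine ((integrable_exp_neg_mul_sq hκ).const_mul (C * Real.exp (-(κ * α)))).mono'
    (by fun_prop) (Eventually.of_forall fun t => ?_)
  have : Real.exp (-(κ * (α + t ^ 2))) = Real.exp (-(κ * α)) * Real.exp (-κ * t ^ 2) := by
    rw [← Real.exp_add]; congr 1; ring
  rw [norm_mul, Real.norm_eq_abs, Real.norm_of_nonneg (Real.exp_pos _).le, this, mul_assoc]
  exact mul_le_mul_of_nonneg_right (hC t) (by positivity)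

/-- The unnormalized probability that a normal variable with mean `-κ β` and variance `κ` is
positive. -/
noncomputable def gaussTail (β κ : ℝ) : ℝ :=
  ∫ y in Set.Ioi 0, Real.exp (-(y + κ * β) ^ 2 / (2 * κ))

theorem tendsto_exp_shift {c : ℝ} (hc : 0 < c) :
    Tendsto (fun y => Real.exp (-(c * (y + κ * β) ^ 2))) atTop (𝓝 0) := by
  refine Real.tendsto_exp_neg_atTop_nhds_zero.comp ?_
  refine Tendsto.const_mul_atTop hc ?_
  exact (tendsto_pow_atTop two_ne_zero).comp (tendsto_atTop_add_const_right _ _ tendsto_id)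

/-- Craig's formula: with `e ^ (-κ (α + t ^ 2)) / (α + t ^ 2)` written as an integral over `y`,
the order of integration is exchanged. -/
theorem integral_exp_div (hβ : 0 < β) (hκ : 0 < κ) :
    ∫ t in Set.Ioi (0 : ℝ), (β ^ 2 / 2 + t ^ 2)⁻¹ * Real.exp (-(κ * (β ^ 2 / 2 + t ^ 2)))
      = √Real.pi / (√κ * β) * gaussTail β κ := by
  set f : ℝ → ℝ → ℝ := fun t y => 2 * (y + κ * β) / (κ * β ^ 2)
    * Real.exp (-((β ^ 2 / 2 + t ^ 2) / (κ * β ^ 2) * (y + κ * β) ^ 2)) with hf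
  have hpos : ∀ t : ℝ, 0 < β ^ 2 / 2 + t ^ 2 := fun t => by positivity
  -- integration over `y`
  have hderiv : ∀ t y : ℝ, HasDerivAt (fun y => -((β ^ 2 / 2 + t ^ 2)⁻¹
      * Real.exp (-((β ^ 2 / 2 + t ^ 2) / (κ * β ^ 2) * (y + κ * β) ^ 2)))) (f t y) y := by
    intro t y
    have h1 := ((((((hasDerivAt_id y).add_const (κ * β)).pow 2).const_mul
      ((β ^ 2 / 2 + t ^ 2) / (κ * β ^ 2))).neg.exp).const_mul ((β ^ 2 / 2 + t ^ 2)⁻¹)).neg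
    refine h1.congr_deriv ?_
    have := (hpos t).ne'
    simp only [hf, Pi.neg_apply, Pi.pow_apply, id]
    push_cast
    field_simp
  have hlim : ∀ t : ℝ, Tendsto (fun y => -((β ^ 2 / 2 + t ^ 2)⁻¹
      * Real.exp (-((β ^ 2 / 2 + t ^ 2) / (κ * β ^ 2) * (y + κ * β) ^ 2)))) atTop (𝓝 0) := by
    intro t
    simpa using ((tendsto_exp_shift (β := β) (κ := κ)
      (div_pos (hpos t) (by positivity : 0 < κ * β ^ 2))).const_mul (β ^ 2 / 2 + t ^ 2)⁻¹).neg
  have hf0 : ∀ t, ∀ y ∈ Set.Ioi (0 : ℝ), 0 ≤ f t y := by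
    intro t y hy
    have : (0 : ℝ) < y := hy
    simp only [hf]
    positivity
  have hy : ∀ t, ∫ y in Set.Ioi 0, f t y
      = (β ^ 2 / 2 + t ^ 2)⁻¹ * Real.exp (-(κ * (β ^ 2 / 2 + t ^ 2))) := by
    intro t
    rw [integral_Ioi_of_hasDerivAt_of_nonneg (hderiv t 0).continuousAt.continuousWithinAt
      (fun y _ => hderiv t y) (hf0 t) (hlim t), zero_sub, neg_neg]
    congr 3
    field_simp
    ring
  have hyint : ∀ t, IntegrableOn (f t) (Set.Ioi 0) := fun t =>
    integrableOn_Ioi_deriv_of_nonneg (hderiv t 0).continuousAt.continuousWithinAt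
      (fun y _ => hderiv t y) (hf0 t) (hlim t)
  -- integration over `t`
  have ht : ∀ y ∈ Set.Ioi (0 : ℝ), ∫ t in Set.Ioi 0, f t y
      = √Real.pi / (√κ * β) * Real.exp (-(y + κ * β) ^ 2 / (2 * κ)) := by
    intro y hy
    have hyp : 0 < y + κ * β := add_pos hy (by positivity)
    have e : ∀ t, f t y = 2 * (y + κ * β) / (κ * β ^ 2) * Real.exp (-(y + κ * β) ^ 2 / (2 * κ))
        * Real.exp (-((y + κ * β) ^ 2 / (κ * β ^ 2)) * t ^ 2) := by
      intro t
      simp only [hf]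
      rw [mul_assoc, ← Real.exp_add]
      congr 2
      field_simp
      ring
    simp only [e]
    rw [integral_const_mul, integral_gaussian_Ioi, div_div_eq_mul_div, Real.sqrt_div' _ (by positivity),
      Real.sqrt_sq hyp.le, Real.sqrt_mul (by positivity), Real.sqrt_mul hκ.le,
      Real.sqrt_sq hβ.le]
    have h1 : √κ ^ 2 = κ := Real.sq_sqrt hκ.le
    have h2 : √κ ≠ 0 := (Real.sqrt_pos.mpr hκ).ne'
    generalize Real.exp _ = E
    field_simp
    rw [h1, mul_comm]
  have hint : Integrable (Function.uncurry f)
      ((volume.restrict (Set.Ioi 0)).prod (volume.restrict (Set.Ioi 0))) := by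
    rw [integrable_prod_iff]
    · refine ⟨Eventually.of_forall fun t => hyint t, ?_⟩
      have hC : ∀ t : ℝ, |(β ^ 2 / 2 + t ^ 2)⁻¹| ≤ (β ^ 2 / 2)⁻¹ := fun t => by
        rw [abs_of_pos (inv_pos.mpr (hpos t))]
        exact inv_anti₀ (by positivity) (by nlinarith [sq_nonneg t])
      refine (integrable_mul_exp_of_bounded (α := β ^ 2 / 2) hκ (by fun_prop)
        hC).integrableOn.congr (Eventually.of_forall fun t => ?_)
      simp only [Function.uncurry]
      rw [← hy t]
      refine setIntegral_congr_fun measurableSet_Ioi fun y hy => ?_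
      exact (Real.norm_of_nonneg (hf0 t y hy)).symm
    · refine Measurable.aestronglyMeasurable ?_
      simp only [hf, Function.uncurry_def]
      fun_prop
  calc _ = ∫ t in Set.Ioi 0, ∫ y in Set.Ioi 0, f t y := by simp only [hy]
    _ = ∫ y in Set.Ioi 0, ∫ t in Set.Ioi 0, f t y := integral_integral_swap hint
    _ = _ := by
      rw [setIntegral_congr_fun measurableSet_Ioi ht, integral_const_mul, gaussTail]

theorem integral_sq_div (hβ : 0 < β) (hκ : 0 < κ) :
    ∫ t in Set.Ioi (0 : ℝ), t ^ 2 / (β ^ 2 / 2 + t ^ 2) * Real.exp (-(κ * (β ^ 2 / 2 + t ^ 2)))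
      = √Real.pi / (2 * √κ) * (Real.exp (-(κ * β ^ 2 / 2)) - β * gaussTail β κ) := by
  have hpos : ∀ t : ℝ, 0 < β ^ 2 / 2 + t ^ 2 := fun t => by positivity
  have hC : ∀ t : ℝ, |(β ^ 2 / 2 + t ^ 2)⁻¹| ≤ (β ^ 2 / 2)⁻¹ := fun t => by
    rw [abs_of_pos (inv_pos.mpr (hpos t))]
    exact inv_anti₀ (by positivity) (by nlinarith [sq_nonneg t])
  have e : ∀ t : ℝ, t ^ 2 / (β ^ 2 / 2 + t ^ 2) * Real.exp (-(κ * (β ^ 2 / 2 + t ^ 2)))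
      = 1 * Real.exp (-(κ * (β ^ 2 / 2 + t ^ 2)))
        - β ^ 2 / 2 * ((β ^ 2 / 2 + t ^ 2)⁻¹ * Real.exp (-(κ * (β ^ 2 / 2 + t ^ 2)))) := by
    intro t
    have := (hpos t).ne'
    field_simp
    ring
  simp only [e]
  rw [integral_sub (integrable_mul_exp_of_bounded (C := 1) hκ (by fun_prop) (by simp)).integrableOn
    ((integrable_mul_exp_of_bounded hκ (by fun_prop) hC).const_mul _).integrableOn,
    integral_const_mul (β ^ 2 / 2), integral_exp_div hβ hκ]
  have e2 : ∀ t : ℝ, 1 * Real.exp (-(κ * (β ^ 2 / 2 + t ^ 2)))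
      = Real.exp (-(κ * β ^ 2 / 2)) * Real.exp (-κ * t ^ 2) := fun t => by
    rw [one_mul, ← Real.exp_add]; congr 1; ring
  simp only [e2]
  rw [integral_const_mul, integral_gaussian_Ioi, Real.sqrt_div' _ hκ.le]
  have h2 : √κ ≠ 0 := (Real.sqrt_pos.mpr hκ).ne'
  field_simp

theorem integral_sq_div_sq (hβ : 0 < β) (hκ : 0 < κ) :
    ∫ t in Set.Ioi (0 : ℝ), t ^ 2 / (β ^ 2 / 2 + t ^ 2) ^ 2
        * Real.exp (-(κ * (β ^ 2 / 2 + t ^ 2)))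
      = √Real.pi / (2 * √κ * β)
        * ((1 + κ * β ^ 2) * gaussTail β κ - κ * β * Real.exp (-(κ * β ^ 2 / 2))) := by
  have hpos : ∀ t : ℝ, 0 < β ^ 2 / 2 + t ^ 2 := fun t => by positivity
  have hC : ∀ t : ℝ, |(β ^ 2 / 2 + t ^ 2)⁻¹| ≤ (β ^ 2 / 2)⁻¹ := fun t => by
    rw [abs_of_pos (inv_pos.mpr (hpos t))]
    exact inv_anti₀ (by positivity) (by nlinarith [sq_nonneg t])
  have hC1 : ∀ t : ℝ, |t ^ 2 / (β ^ 2 / 2 + t ^ 2)| ≤ 1 := fun t => by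
    rw [abs_of_nonneg (by positivity), div_le_one (hpos t)]
    nlinarith [sq_nonneg β]
  have hC2 : ∀ t : ℝ, |t ^ 2 / (β ^ 2 / 2 + t ^ 2) ^ 2| ≤ (β ^ 2 / 2)⁻¹ := fun t => by
    have : t ^ 2 / (β ^ 2 / 2 + t ^ 2) ^ 2
        = t ^ 2 / (β ^ 2 / 2 + t ^ 2) * (β ^ 2 / 2 + t ^ 2)⁻¹ := by
      have := (hpos t).ne'
      field_simp
    rw [this, abs_mul]
    exact (mul_le_mul (hC1 t) (hC t) (abs_nonneg _) zero_le_one).trans_eq (one_mul _)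
  have hC3 : ∀ t : ℝ, |-(t / (2 * (β ^ 2 / 2 + t ^ 2)))| ≤ β⁻¹ := fun t => by
    rw [abs_neg, abs_div, abs_of_pos (mul_pos two_pos (hpos t)),
      div_le_iff₀ (mul_pos two_pos (hpos t)), inv_mul_eq_div, le_div_iff₀ hβ]
    nlinarith [sq_nonneg (|t| - β), sq_abs t]
  have i1 := (integrable_mul_exp_of_bounded (α := β ^ 2 / 2) hκ (by fun_prop) hC).integrableOn
    (s := Set.Ioi 0)
  have i2 := (integrable_mul_exp_of_bounded (α := β ^ 2 / 2) hκ (by fun_prop) hC1).integrableOn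
    (s := Set.Ioi 0)
  have i3 := (integrable_mul_exp_of_bounded (α := β ^ 2 / 2) hκ (by fun_prop) hC2).integrableOn
    (s := Set.Ioi 0)
  have i4 := (integrable_mul_exp_of_bounded (α := β ^ 2 / 2) hκ (by fun_prop) hC3).integrableOn
    (s := Set.Ioi 0)
  -- integration by parts
  have hderiv : ∀ t : ℝ, HasDerivAt (fun t => -(t / (2 * (β ^ 2 / 2 + t ^ 2)))
      * Real.exp (-(κ * (β ^ 2 / 2 + t ^ 2))))
      (t ^ 2 / (β ^ 2 / 2 + t ^ 2) ^ 2 * Real.exp (-(κ * (β ^ 2 / 2 + t ^ 2)))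
        - (1 / 2 * ((β ^ 2 / 2 + t ^ 2)⁻¹ * Real.exp (-(κ * (β ^ 2 / 2 + t ^ 2))))
        - κ * (t ^ 2 / (β ^ 2 / 2 + t ^ 2) * Real.exp (-(κ * (β ^ 2 / 2 + t ^ 2)))))) t := by
    intro t
    have h0 : HasDerivAt (fun t : ℝ => β ^ 2 / 2 + t ^ 2) (2 * t) t := by
      simpa using (hasDerivAt_pow 2 t).const_add (β ^ 2 / 2)
    have h1 := (((hasDerivAt_id t).div (h0.const_mul 2) (mul_pos two_pos (hpos t)).ne').neg).mul
      (h0.const_mul κ).neg.exp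
    refine h1.congr_deriv ?_
    have := (hpos t).ne'
    simp only [Pi.neg_apply, Pi.div_apply, id]
    field_simp
    ring
  have hint := i3.sub ((i1.const_mul (1 / 2)).sub (i2.const_mul κ))
  have hlim := tendsto_zero_of_hasDerivAt_of_integrableOn_Ioi (a := 0)
    (fun t _ => hderiv t) hint i4
  have key := integral_Ioi_of_hasDerivAt_of_tendsto (hderiv 0).continuousAt.continuousWithinAt
    (fun t _ => hderiv t) hint hlim
  have e1 := integral_sub (i1.const_mul (1 / 2)) (i2.const_mul κ)
  have e2 := integral_sub i3 ((i1.const_mul (1 / 2)).sub (i2.const_mul κ))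
  simp only [Pi.sub_apply] at e2
  rw [e2, e1, integral_const_mul, integral_const_mul, integral_exp_div hβ hκ, integral_sq_div hβ hκ] at key
  simp only [zero_div, neg_zero, zero_mul, sub_zero] at key
  rw [sub_eq_zero.mp key]
  have h1 : √κ ^ 2 = κ := Real.sq_sqrt hκ.le
  have h2 : √κ ≠ 0 := (Real.sqrt_pos.mpr hκ).ne'
  field_simp
  ring

theorem integrable_shift_mul (hκ : 0 < κ) (p : ℕ) :
    Integrable fun y => (y + κ * β) ^ p * Real.exp (-(y + κ * β) ^ 2 / (2 * κ)) := by
  have h := integrable_rpow_mul_exp_neg_mul_sq (b := 1 / (2 * κ)) (by positivity) (s := p)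
    (by have : (0 : ℝ) ≤ p := by positivity
        linarith)
  refine (h.comp_add_right (κ * β)).congr (Eventually.of_forall fun y => ?_)
  simp only [Real.rpow_natCast]
  congr 2
  ring

/-- The first two moments on the positive half line of the unnormalized normal density. -/
theorem gaussTail_moments (hκ : 0 < κ) :
    ∫ y in Set.Ioi 0, y * Real.exp (-(y + κ * β) ^ 2 / (2 * κ))
      = κ * Real.exp (-(κ * β ^ 2 / 2)) - κ * β * gaussTail β κ ∧
    ∫ y in Set.Ioi 0, y ^ 2 * Real.exp (-(y + κ * β) ^ 2 / (2 * κ))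
      = κ * (1 + κ * β ^ 2) * gaussTail β κ - κ ^ 2 * β * Real.exp (-(κ * β ^ 2 / 2)) := by
  have i0 := (integrable_shift_mul (β := β) hκ 0).integrableOn (s := Set.Ioi 0)
  have i1 := (integrable_shift_mul (β := β) hκ 1).integrableOn (s := Set.Ioi 0)
  have i2 := (integrable_shift_mul (β := β) hκ 2).integrableOn (s := Set.Ioi 0)
  simp only [pow_zero, pow_one, one_mul] at i0 i1
  have hd : ∀ y, HasDerivAt (fun y => Real.exp (-(y + κ * β) ^ 2 / (2 * κ)))
      (-(y + κ * β) / κ * Real.exp (-(y + κ * β) ^ 2 / (2 * κ))) y := by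
    intro y
    have h1 := ((((hasDerivAt_id y).add_const (κ * β)).pow 2).neg.div_const (2 * κ)).exp
    refine h1.congr_deriv ?_
    simp only [Pi.neg_apply, Pi.pow_apply, id]
    push_cast
    field_simp
  have h0val : Real.exp (-(0 + κ * β) ^ 2 / (2 * κ)) = Real.exp (-(κ * β ^ 2 / 2)) := by
    congr 1; field_simp; ring
  have m1 : ∫ y in Set.Ioi 0, (y + κ * β) * Real.exp (-(y + κ * β) ^ 2 / (2 * κ))
      = κ * Real.exp (-(κ * β ^ 2 / 2)) := by
    have hd1 : ∀ y, HasDerivAt (fun y => -κ * Real.exp (-(y + κ * β) ^ 2 / (2 * κ)))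
        ((y + κ * β) * Real.exp (-(y + κ * β) ^ 2 / (2 * κ))) y := fun y => by
      refine ((hd y).const_mul (-κ)).congr_deriv ?_
      field_simp
    have hl := tendsto_zero_of_hasDerivAt_of_integrableOn_Ioi (a := 0) (fun y _ => hd1 y) i1
      (i0.const_mul (-κ))
    rw [integral_Ioi_of_hasDerivAt_of_tendsto (hd1 0).continuousAt.continuousWithinAt
      (fun y _ => hd1 y) i1 hl, h0val]
    ring
  have m2 : ∫ y in Set.Ioi 0, ((y + κ * β) ^ 2 * Real.exp (-(y + κ * β) ^ 2 / (2 * κ)))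
      = κ * gaussTail β κ + κ ^ 2 * β * Real.exp (-(κ * β ^ 2 / 2)) := by
    have hd2 : ∀ y, HasDerivAt
        (fun y => -κ * ((y + κ * β) * Real.exp (-(y + κ * β) ^ 2 / (2 * κ))))
        ((y + κ * β) ^ 2 * Real.exp (-(y + κ * β) ^ 2 / (2 * κ))
          - κ * Real.exp (-(y + κ * β) ^ 2 / (2 * κ))) y := fun y => by
      refine ((((hasDerivAt_id y).add_const (κ * β)).mul (hd y)).const_mul (-κ)).congr_deriv ?_
      simp only [id]
      field_simp
      ring
    have hi := i2.sub (i0.const_mul κ)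
    have hl := tendsto_zero_of_hasDerivAt_of_integrableOn_Ioi (a := 0) (fun y _ => hd2 y) hi
      (i1.const_mul (-κ))
    have key := integral_Ioi_of_hasDerivAt_of_tendsto (hd2 0).continuousAt.continuousWithinAt
      (fun y _ => hd2 y) hi hl
    rw [integral_sub i2 (i0.const_mul κ), integral_const_mul, h0val] at key
    rw [gaussTail]
    linear_combination key
  have n1 : ∫ y in Set.Ioi 0, y * Real.exp (-(y + κ * β) ^ 2 / (2 * κ))
      = κ * Real.exp (-(κ * β ^ 2 / 2)) - κ * β * gaussTail β κ := by
    rw [gaussTail, ← m1, ← integral_const_mul, ← integral_sub i1 (i0.const_mul (κ * β))]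
    congr 1; ext y; ring
  refine ⟨n1, ?_⟩
  have e : ∀ y, y ^ 2 * Real.exp (-(y + κ * β) ^ 2 / (2 * κ))
      = (y + κ * β) ^ 2 * Real.exp (-(y + κ * β) ^ 2 / (2 * κ))
        - (2 * (κ * β) * ((y + κ * β) * Real.exp (-(y + κ * β) ^ 2 / (2 * κ)))
        - (κ * β) ^ 2 * Real.exp (-(y + κ * β) ^ 2 / (2 * κ))) := fun y => by ring
  simp only [e]
  have e1 := integral_sub (i1.const_mul (2 * (κ * β))) (i0.const_mul ((κ * β) ^ 2))
  have e2 := integral_sub i2 ((i1.const_mul (2 * (κ * β))).sub (i0.const_mul ((κ * β) ^ 2)))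
  simp only [Pi.sub_apply] at e2
  rw [e2, e1, integral_const_mul, integral_const_mul, m1, m2, gaussTail]
  ring

theorem gaussianReal_integral_max_pow (β : ℝ) {k : ℕ} (hk : k ≠ 0) {p : ℕ} (hp : p ≠ 0) :
    ∫ x, max x 0 ^ p ∂(gaussianReal (-(k * β)) k)
      = (√(2 * Real.pi * k))⁻¹ * ∫ y in Set.Ioi 0, y ^ p * Real.exp (-(y + k * β) ^ 2 / (2 * k)) := by
  rw [integral_gaussianReal_eq_integral_smul (by exact_mod_cast hk), ← integral_const_mul,
    ← setIntegral_eq_integral_of_forall_compl_eq_zero (s := Set.Ioi 0)]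
  · refine setIntegral_congr_fun measurableSet_Ioi fun y hy => ?_
    simp only [gaussianPDFReal, smul_eq_mul, NNReal.coe_natCast, sub_neg_eq_add,
      max_eq_left ((show (0 : ℝ) < y from hy).le)]
    ring
  · intro y hy
    rw [max_eq_right (by simpa using hy), zero_pow hp, smul_zero]

theorem gaussianReal_real_Ioi (β : ℝ) {k : ℕ} (hk : k ≠ 0) :
    (gaussianReal (-(k * β)) k).real (Set.Ioi 0) = (√(2 * Real.pi * k))⁻¹ * gaussTail β k := by
  rw [measureReal_def, gaussianReal_apply_eq_integral _ (by exact_mod_cast hk),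
    ENNReal.toReal_ofReal (setIntegral_nonneg measurableSet_Ioi fun x _ =>
      gaussianPDFReal_nonneg _ _ _), gaussTail, ← integral_const_mul]
  simp only [gaussianPDFReal, NNReal.coe_natCast, sub_neg_eq_add]

/-- The terms of the Spitzer series of the Gaussian random walk as integrals over `t`. -/
theorem gaussian_terms (hβ : 0 < β) {k : ℕ} (hk : k ≠ 0) :
    (gaussianReal (-(k * β)) k).real (Set.Ioi 0) = 1 / Real.pi *
      ∫ t in Set.Ioi (0 : ℝ), β / √2 / (β ^ 2 / 2 + t ^ 2)
        * Real.exp (-(k * (β ^ 2 / 2 + t ^ 2))) ∧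
    (∫ x, max x 0 ^ 1 ∂(gaussianReal (-(k * β)) k)) / k = √2 / Real.pi *
      ∫ t in Set.Ioi (0 : ℝ), t ^ 2 / (β ^ 2 / 2 + t ^ 2)
        * Real.exp (-(k * (β ^ 2 / 2 + t ^ 2))) ∧
    (∫ x, max x 0 ^ 2 ∂(gaussianReal (-(k * β)) k)) / k = √2 * β / Real.pi *
      ∫ t in Set.Ioi (0 : ℝ), t ^ 2 / (β ^ 2 / 2 + t ^ 2) ^ 2
        * Real.exp (-(k * (β ^ 2 / 2 + t ^ 2))) := by
  have hk0 : (0 : ℝ) < k := by exact_mod_cast Nat.pos_of_ne_zero hk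
  have hmom := gaussTail_moments (β := β) hk0
  have s1 : √(2 * Real.pi * k) = √2 * √Real.pi * √k := by
    rw [Real.sqrt_mul (by positivity), Real.sqrt_mul (by positivity)]
  have hsk : √(k : ℝ) ≠ 0 := (Real.sqrt_pos.mpr hk0).ne'
  have hsp : √Real.pi ≠ 0 := (Real.sqrt_pos.mpr Real.pi_pos).ne'
  have hsp2 : √Real.pi ^ 2 = Real.pi := Real.sq_sqrt Real.pi_pos.le
  have hs2 : √(2 : ℝ) ^ 2 = 2 := Real.sq_sqrt (by norm_num)
  have hs20 : √(2 : ℝ) ≠ 0 := by positivity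
  refine ⟨?_, ?_, ?_⟩
  · rw [gaussianReal_real_Ioi β hk, s1]
    have e : ∀ t : ℝ, β / √2 / (β ^ 2 / 2 + t ^ 2) * Real.exp (-(k * (β ^ 2 / 2 + t ^ 2)))
        = β / √2 * ((β ^ 2 / 2 + t ^ 2)⁻¹ * Real.exp (-(k * (β ^ 2 / 2 + t ^ 2)))) := fun t => by
      rw [div_eq_mul_inv (β / √2), mul_assoc]
    simp only [e]
    rw [integral_const_mul, integral_exp_div hβ hk0]
    nth_rw 2 [← hsp2]
    field_simp
  · rw [gaussianReal_integral_max_pow β hk one_ne_zero, s1, integral_sq_div hβ hk0]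
    simp only [pow_one]
    rw [hmom.1]
    field_simp
    rw [hs2, hsp2]
    ring
  · rw [gaussianReal_integral_max_pow β hk two_ne_zero, s1, integral_sq_div_sq hβ hk0, hmom.2]
    field_simp
    rw [hs2, hsp2]
    ring

end GaussianMoments

/-! ### The integrals in the robust approximations -/

section ApproximationIntegrals

theorem exp_hedge_lt_one {c : ℝ} (hc : 0 < c) (t : ℝ) : Real.exp (-(c ^ 2 / 2) - t ^ 2) < 1 := by
  rw [Real.exp_lt_one_iff]
  nlinarith [sq_nonneg t, pow_pos hc 2]

theorem div_one_sub_exp_hedge_le {c₀ c : ℝ} (hc₀ : 0 < c₀) (hc : c₀ ≤ c) (t : ℝ) :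
    Real.exp (-(c ^ 2 / 2) - t ^ 2) / (1 - Real.exp (-(c ^ 2 / 2) - t ^ 2))
      ≤ (1 - Real.exp (-(c₀ ^ 2 / 2)))⁻¹ * Real.exp (-1 * t ^ 2) := by
  have hsq : c₀ ^ 2 ≤ c ^ 2 := pow_le_pow_left₀ hc₀.le hc 2
  have h1 : Real.exp (-(c₀ ^ 2 / 2)) < 1 := by
    rw [Real.exp_lt_one_iff]
    nlinarith [pow_pos hc₀ 2]
  rw [div_eq_inv_mul]
  refine mul_le_mul (inv_anti₀ (by linarith) ?_) ?_ (Real.exp_pos _).le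
    (inv_nonneg.mpr (by linarith))
  · have : Real.exp (-(c ^ 2 / 2) - t ^ 2) ≤ Real.exp (-(c₀ ^ 2 / 2)) :=
      Real.exp_le_exp.mpr (by nlinarith [sq_nonneg t])
    linarith
  · exact Real.exp_le_exp.mpr (by nlinarith [sq_nonneg c])

variable {F : ℝ → ℝ} {C : ℝ}

theorem norm_mul_exp_hedge_le {c₀ c y : ℝ} (hc₀ : 0 < c₀) (hc : c₀ ≤ c)
    (hF : ∀ x ∈ Set.Ioo (0 : ℝ) 1, 0 ≤ F x ∧ F x ≤ x / (1 - x)) (hy : |y| ≤ C) (t : ℝ) :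
    ‖y * F (Real.exp (-(c ^ 2 / 2) - t ^ 2))‖
      ≤ C * ((1 - Real.exp (-(c₀ ^ 2 / 2)))⁻¹ * Real.exp (-1 * t ^ 2)) := by
  obtain ⟨h0, h1⟩ := hF _ ⟨Real.exp_pos _, exp_hedge_lt_one (hc₀.trans_le hc) t⟩
  rw [norm_mul, Real.norm_eq_abs, Real.norm_of_nonneg h0]
  exact mul_le_mul hy (h1.trans (div_one_sub_exp_hedge_le hc₀ hc t)) h0 ((abs_nonneg y).trans hy)

theorem integrable_hedge_bound (C D : ℝ) :
    Integrable fun t : ℝ => C * (D * Real.exp (-1 * t ^ 2)) :=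
  ((integrable_exp_neg_mul_sq one_pos).const_mul _).const_mul _

theorem integrable_mul_exp_hedge {c : ℝ} (hc : 0 < c) {h : ℝ → ℝ} (hm : Measurable h)
    (hC : ∀ t, |h t| ≤ C) (hFm : Measurable F)
    (hF : ∀ x ∈ Set.Ioo (0 : ℝ) 1, 0 ≤ F x ∧ F x ≤ x / (1 - x)) :
    Integrable fun t => h t * F (Real.exp (-(c ^ 2 / 2) - t ^ 2)) := by
  refine (integrable_hedge_bound C _).mono' ?_
    (Eventually.of_forall fun t => norm_mul_exp_hedge_le hc le_rfl hF (hC t) t)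
  exact (hm.mul (hFm.comp (by fun_prop))).aestronglyMeasurable

theorem integral_mul_exp_hedge_pos {c : ℝ} (hc : 0 < c) {h : ℝ → ℝ} (hm : Measurable h)
    (hC : ∀ t, |h t| ≤ C) (hpos : ∀ t, 0 < t → 0 < h t) :
    0 < ∫ t in Set.Ioi (0 : ℝ), h t * (Real.exp (-(c ^ 2 / 2) - t ^ 2)
      / (1 - Real.exp (-(c ^ 2 / 2) - t ^ 2))) := by
  have hp : ∀ t ∈ Set.Ioi (0 : ℝ), 0 < h t * (Real.exp (-(c ^ 2 / 2) - t ^ 2)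
      / (1 - Real.exp (-(c ^ 2 / 2) - t ^ 2))) := fun t ht =>
    mul_pos (hpos t ht) (div_pos (Real.exp_pos _) (sub_pos.mpr (exp_hedge_lt_one hc t)))
  rw [setIntegral_pos_iff_support_of_nonneg_ae
    ((ae_restrict_iff' measurableSet_Ioi).mpr (Eventually.of_forall fun t ht => (hp t ht).le))
    (integrable_mul_exp_hedge (F := fun x => x / (1 - x)) hc hm hC (by fun_prop)
      fun x hx => ⟨div_nonneg hx.1.le (sub_nonneg.mpr hx.2.le), le_rfl⟩).integrableOn]
  have hsub : Set.Ioi (0 : ℝ) ⊆ Function.support fun t => h t * (Real.exp (-(c ^ 2 / 2) - t ^ 2)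
      / (1 - Real.exp (-(c ^ 2 / 2) - t ^ 2))) := fun t ht => (hp t ht).ne'
  rw [Set.inter_eq_self_of_subset_right hsub]
  simp

/-- The integrals depend continuously on the hedge. -/
theorem tendsto_integral_mul_exp_hedge {c : ℕ → ℝ} {β : ℝ} (hβ : 0 < β)
    (hc : Tendsto c atTop (𝓝 β)) {h : ℝ → ℝ → ℝ} (hm : ∀ c, Measurable (h c))
    (hcont : ∀ t, ContinuousAt (fun c => h c t) β)
    (hC : ∀ᶠ x in 𝓝 β, ∀ t, |h x t| ≤ C) (hFm : Measurable F) (hFc : ContinuousOn F (Set.Ioo 0 1))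
    (hF : ∀ x ∈ Set.Ioo (0 : ℝ) 1, 0 ≤ F x ∧ F x ≤ x / (1 - x)) :
    Tendsto (fun n => ∫ t in Set.Ioi (0 : ℝ), h (c n) t * F (Real.exp (-(c n ^ 2 / 2) - t ^ 2)))
      atTop (𝓝 (∫ t in Set.Ioi (0 : ℝ), h β t * F (Real.exp (-(β ^ 2 / 2) - t ^ 2)))) := by
  refine tendsto_integral_filter_of_dominated_convergence
    (fun t => C * ((1 - Real.exp (-((β / 2) ^ 2 / 2)))⁻¹ * Real.exp (-1 * t ^ 2)))
    (Eventually.of_forall fun n => ((hm _).mul (hFm.comp (by fun_prop))).aestronglyMeasurable) ?_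
    (integrable_hedge_bound _ _).integrableOn (Eventually.of_forall fun t => ?_)
  · filter_upwards [hc.eventually hC, hc.eventually (lt_mem_nhds (half_lt_self hβ))] with n h1 h2
    exact Eventually.of_forall fun t =>
      norm_mul_exp_hedge_le (half_pos hβ) (le_of_lt h2) hF (h1 t) t
  · have hFat : ContinuousAt F (Real.exp (-(β ^ 2 / 2) - t ^ 2)) :=
      hFc.continuousAt (Ioo_mem_nhds (Real.exp_pos _) (exp_hedge_lt_one hβ t))
    have hE : ContinuousAt (fun c : ℝ => F (Real.exp (-(c ^ 2 / 2) - t ^ 2))) β :=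
      ContinuousAt.comp (f := fun c : ℝ => Real.exp (-(c ^ 2 / 2) - t ^ 2)) hFat
        (by fun_prop)
    exact ((hcont t).mul hE).tendsto.comp hc

/-- Termwise integration of a power series in `e ^ (-β² / 2 - t²)`. -/
theorem hasSum_integral_mul_exp_hedge {β : ℝ} (hβ : 0 < β) {h : ℝ → ℝ} (hm : Measurable h)
    (hC : ∀ t, |h t| ≤ C) {w : ℕ → ℝ} (hw : ∀ k, 0 ≤ w k ∧ w k ≤ 1)
    (hF : ∀ x ∈ Set.Ioo (0 : ℝ) 1, HasSum (fun k => w k * x ^ (k + 1)) (F x)) :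
    HasSum (fun k : ℕ => w k * ∫ t in Set.Ioi (0 : ℝ),
        h t * Real.exp (-(((k + 1 : ℕ) : ℝ) * (β ^ 2 / 2 + t ^ 2))))
      (∫ t in Set.Ioi (0 : ℝ), h t * F (Real.exp (-(β ^ 2 / 2) - t ^ 2))) := by
  have hC0 : 0 ≤ C := (abs_nonneg _).trans (hC 0)
  have hint : ∀ k : ℕ, Integrable (fun t => w k * (h t
      * Real.exp (-(((k + 1 : ℕ) : ℝ) * (β ^ 2 / 2 + t ^ 2))))) := fun k =>
    (integrable_mul_exp_of_bounded (by positivity) hm hC).const_mul _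
  have hr1 : Real.exp (-(β ^ 2 / 2)) < 1 := by
    rw [Real.exp_lt_one_iff]
    nlinarith [pow_pos hβ 2]
  have hsum : Summable fun k : ℕ => ∫ t in Set.Ioi (0 : ℝ), ‖w k * (h t
      * Real.exp (-(((k + 1 : ℕ) : ℝ) * (β ^ 2 / 2 + t ^ 2))))‖ := by
    refine Summable.of_nonneg_of_le (fun k => integral_nonneg fun t => norm_nonneg _)
      (fun k => ?_) ((summable_geometric_of_lt_one (Real.exp_pos _).le hr1).mul_right
        (∫ t in Set.Ioi (0 : ℝ), C * (1 * Real.exp (-1 * t ^ 2))))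
    rw [← integral_const_mul]
    refine integral_mono (hint k).norm.integrableOn
      ((integrable_hedge_bound C 1).const_mul _).integrableOn fun t => ?_
    have hexp : Real.exp (-(((k + 1 : ℕ) : ℝ) * (β ^ 2 / 2 + t ^ 2)))
        ≤ Real.exp (-(β ^ 2 / 2)) ^ k * Real.exp (-1 * t ^ 2) := by
      rw [← Real.exp_nat_mul, ← Real.exp_add, Real.exp_le_exp]
      push_cast
      have : (0 : ℝ) ≤ k * t ^ 2 := by positivity
      nlinarith [pow_pos hβ 2]
    simp only [norm_mul, Real.norm_eq_abs, Real.abs_exp, abs_of_nonneg (hw k).1]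
    calc w k * (|h t| * Real.exp (-(((k + 1 : ℕ) : ℝ) * (β ^ 2 / 2 + t ^ 2))))
        ≤ 1 * (C * (Real.exp (-(β ^ 2 / 2)) ^ k * Real.exp (-1 * t ^ 2))) := by
          gcongr
          · exact (hw k).2
          · exact hC t
      _ = _ := by ring
  have key := hasSum_integral_of_summable_integral_norm (μ := volume.restrict (Set.Ioi 0))
    (fun k => (hint k).integrableOn) hsum
  simp only [integral_const_mul] at key
  suffices h : ∀ t, ∑' k : ℕ, w k * (h t * Real.exp (-(((k + 1 : ℕ) : ℝ) * (β ^ 2 / 2 + t ^ 2))))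
      = h t * F (Real.exp (-(β ^ 2 / 2) - t ^ 2)) by simpa only [h] using key
  intro t
  have ht := (hF _ ⟨Real.exp_pos _, exp_hedge_lt_one hβ t⟩).mul_left (h t)
  refine (tsum_congr fun k => ?_).trans ht.tsum_eq
  rw [← Real.exp_nat_mul]
  have : ((k + 1 : ℕ) : ℝ) * (-(β ^ 2 / 2) - t ^ 2)
      = -(((k + 1 : ℕ) : ℝ) * (β ^ 2 / 2 + t ^ 2)) := by ring
  rw [this]
  ring

theorem hasSum_pow_succ {x : ℝ} (hx : x ∈ Set.Ioo (0 : ℝ) 1) :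
    HasSum (fun k : ℕ => (1 : ℝ) * x ^ (k + 1)) (x / (1 - x)) := by
  simpa [pow_succ', div_eq_mul_inv] using
    (hasSum_geometric_of_lt_one hx.1.le hx.2).mul_left x

theorem hasSum_neg_log {x : ℝ} (hx : x ∈ Set.Ioo (0 : ℝ) 1) :
    HasSum (fun k : ℕ => ((k : ℝ) + 1)⁻¹ * x ^ (k + 1)) (-Real.log (1 - x)) := by
  simpa [div_eq_inv_mul] using
    Real.hasSum_pow_div_log_of_abs_lt_one (abs_lt.mpr ⟨by linarith [hx.1], hx.2⟩)

theorem neg_log_one_sub_bounds {x : ℝ} (hx : x ∈ Set.Ioo (0 : ℝ) 1) :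
    0 ≤ -Real.log (1 - x) ∧ -Real.log (1 - x) ≤ x / (1 - x) := by
  have h1 : 0 < 1 - x := sub_pos.mpr hx.2
  refine ⟨neg_nonneg.mpr (Real.log_nonpos h1.le (by linarith [hx.1])), ?_⟩
  have := Real.one_sub_inv_le_log_of_pos h1
  have e : x / (1 - x) = (1 - x)⁻¹ - 1 := by field_simp; ring
  linarith

theorem abs_hedge_weights_le {c : ℝ} (hc : 0 < c) (t : ℝ) :
    |c / √2 / (c ^ 2 / 2 + t ^ 2)| ≤ 2 / c ∧ |t ^ 2 / (c ^ 2 / 2 + t ^ 2)| ≤ 1 ∧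
      |t ^ 2 / (c ^ 2 / 2 + t ^ 2) ^ 2| ≤ 2 / c ^ 2 := by
  have hpos : 0 < c ^ 2 / 2 + t ^ 2 := by positivity
  have h2 : 1 ≤ √(2 : ℝ) := Real.one_le_sqrt.mpr one_le_two
  have ht : t ^ 2 / (c ^ 2 / 2 + t ^ 2) ≤ 1 := by
    rw [div_le_one hpos]
    nlinarith [sq_nonneg c]
  refine ⟨?_, by rwa [abs_of_nonneg (by positivity)], ?_⟩
  · rw [abs_of_nonneg (by positivity), div_le_iff₀ hpos]
    have h3 : c / √2 ≤ c := div_le_self hc.le h2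
    have h4 : 2 / c * (c ^ 2 / 2 + t ^ 2) = c + 2 / c * t ^ 2 := by field_simp
    have h5 : 0 ≤ 2 / c * t ^ 2 := by positivity
    linarith
  · rw [abs_of_nonneg (by positivity), sq (c ^ 2 / 2 + t ^ 2), ← div_div,
      div_le_iff₀ hpos]
    have h4 : 2 / c ^ 2 * (c ^ 2 / 2 + t ^ 2) = 1 + 2 / c ^ 2 * t ^ 2 := by field_simp
    have h5 : 0 ≤ 2 / c ^ 2 * t ^ 2 := by positivity
    linarith

/-- The Spitzer series of the Gaussian random walk with drift `-β`. -/
theorem gaussian_series {β : ℝ} (hβ : 0 < β) :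
    ∑' k : ℕ, (gaussianReal (-((k + 1 : ℕ) * β)) (k + 1 : ℕ)).real (Set.Ioi 0) / ((k : ℝ) + 1)
      = -(1 / Real.pi * ∫ t in Set.Ioi (0 : ℝ), β / √2 / (β ^ 2 / 2 + t ^ 2)
        * Real.log (1 - Real.exp (-(β ^ 2 / 2) - t ^ 2))) ∧
    ∑' k : ℕ, (∫ x, max x 0 ^ 1 ∂(gaussianReal (-((k + 1 : ℕ) * β)) (k + 1 : ℕ))) / ((k : ℝ) + 1)
      = √2 / Real.pi * ∫ t in Set.Ioi (0 : ℝ), t ^ 2 / (β ^ 2 / 2 + t ^ 2)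
        * (Real.exp (-(β ^ 2 / 2) - t ^ 2) / (1 - Real.exp (-(β ^ 2 / 2) - t ^ 2))) ∧
    ∑' k : ℕ, (∫ x, max x 0 ^ 2 ∂(gaussianReal (-((k + 1 : ℕ) * β)) (k + 1 : ℕ))) / ((k : ℝ) + 1)
      = √2 * β / Real.pi * ∫ t in Set.Ioi (0 : ℝ), t ^ 2 / (β ^ 2 / 2 + t ^ 2) ^ 2
        * (Real.exp (-(β ^ 2 / 2) - t ^ 2) / (1 - Real.exp (-(β ^ 2 / 2) - t ^ 2))) := by
  have hb := abs_hedge_weights_le hβ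
  have hterm := fun k : ℕ => gaussian_terms hβ k.succ_ne_zero
  refine ⟨?_, ?_, ?_⟩
  · have h := hasSum_integral_mul_exp_hedge hβ (h := fun t => β / √2 / (β ^ 2 / 2 + t ^ 2))
      (by fun_prop) (fun t => (hb t).1) (w := fun k => ((k : ℝ) + 1)⁻¹)
      (fun k => ⟨by positivity, inv_le_one_of_one_le₀ (by linarith [k.cast_nonneg (α := ℝ)])⟩)
      (F := fun x => -Real.log (1 - x)) fun x hx => hasSum_neg_log hx
    simp only [mul_neg, integral_neg] at h
    rw [← mul_neg, ← h.tsum_eq, ← tsum_mul_left]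
    refine tsum_congr fun k => ?_
    rw [(hterm k).1]
    ring
  · have h := hasSum_integral_mul_exp_hedge hβ (h := fun t => t ^ 2 / (β ^ 2 / 2 + t ^ 2))
      (by fun_prop) (fun t => (hb t).2.1) (w := fun _ => 1) (fun k => ⟨zero_le_one, le_rfl⟩)
      (F := fun x => x / (1 - x)) fun x hx => hasSum_pow_succ hx
    rw [← h.tsum_eq, ← tsum_mul_left]
    refine tsum_congr fun k => ?_
    rw [one_mul, ← (hterm k).2.1, Nat.cast_succ]
  · have h := hasSum_integral_mul_exp_hedge hβ (h := fun t => t ^ 2 / (β ^ 2 / 2 + t ^ 2) ^ 2)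
      (by fun_prop) (fun t => (hb t).2.2) (w := fun _ => 1) (fun k => ⟨zero_le_one, le_rfl⟩)
      (F := fun x => x / (1 - x)) fun x hx => hasSum_pow_succ hx
    rw [← h.tsum_eq, ← tsum_mul_left]
    refine tsum_congr fun k => ?_
    rw [one_mul, ← (hterm k).2.2, Nat.cast_succ]

/-- The integrals in the robust approximations converge as the hedge does. -/
theorem tendsto_hedge_integrals {c : ℕ → ℝ} {β : ℝ} (hβ : 0 < β) (hc : Tendsto c atTop (𝓝 β)) :
    Tendsto (fun n => ∫ t in Set.Ioi (0 : ℝ), c n / √2 / (c n ^ 2 / 2 + t ^ 2)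
        * Real.log (1 - Real.exp (-(c n ^ 2 / 2) - t ^ 2))) atTop
      (𝓝 (∫ t in Set.Ioi (0 : ℝ), β / √2 / (β ^ 2 / 2 + t ^ 2)
        * Real.log (1 - Real.exp (-(β ^ 2 / 2) - t ^ 2)))) ∧
    Tendsto (fun n => ∫ t in Set.Ioi (0 : ℝ), t ^ 2 / (c n ^ 2 / 2 + t ^ 2)
        * (Real.exp (-(c n ^ 2 / 2) - t ^ 2) / (1 - Real.exp (-(c n ^ 2 / 2) - t ^ 2)))) atTop
      (𝓝 (∫ t in Set.Ioi (0 : ℝ), t ^ 2 / (β ^ 2 / 2 + t ^ 2)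
        * (Real.exp (-(β ^ 2 / 2) - t ^ 2) / (1 - Real.exp (-(β ^ 2 / 2) - t ^ 2))))) ∧
    Tendsto (fun n => ∫ t in Set.Ioi (0 : ℝ), t ^ 2 / (c n ^ 2 / 2 + t ^ 2) ^ 2
        * (Real.exp (-(c n ^ 2 / 2) - t ^ 2) / (1 - Real.exp (-(c n ^ 2 / 2) - t ^ 2)))) atTop
      (𝓝 (∫ t in Set.Ioi (0 : ℝ), t ^ 2 / (β ^ 2 / 2 + t ^ 2) ^ 2
        * (Real.exp (-(β ^ 2 / 2) - t ^ 2) / (1 - Real.exp (-(β ^ 2 / 2) - t ^ 2))))) := by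
  have hpos : ∀ t : ℝ, β ^ 2 / 2 + t ^ 2 ≠ 0 := fun t => by positivity
  have hpos2 : ∀ t : ℝ, (β ^ 2 / 2 + t ^ 2) ^ 2 ≠ 0 := fun t => by positivity
  have hnear : ∀ᶠ x in 𝓝 β, β / 2 < x := lt_mem_nhds (half_lt_self hβ)
  have hdiv : ContinuousOn (fun x : ℝ => x / (1 - x)) (Set.Ioo 0 1) :=
    ContinuousOn.div (by fun_prop) (by fun_prop) fun x hx => (sub_pos.mpr hx.2).ne'
  have hdivb : ∀ x ∈ Set.Ioo (0 : ℝ) 1, 0 ≤ x / (1 - x) ∧ x / (1 - x) ≤ x / (1 - x) :=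
    fun x hx => ⟨div_nonneg hx.1.le (sub_nonneg.mpr hx.2.le), le_rfl⟩
  refine ⟨?_, ?_, ?_⟩
  · have h := tendsto_integral_mul_exp_hedge (C := 2 / (β / 2))
      (h := fun c t => c / √2 / (c ^ 2 / 2 + t ^ 2))
      (F := fun x => -Real.log (1 - x)) hβ hc (fun c => by fun_prop)
      (fun t => by have := hpos t; fun_prop (disch := assumption))
      (hnear.mono fun x hx t => (abs_hedge_weights_le ((half_pos hβ).trans hx) t).1.trans
        (div_le_div_of_nonneg_left two_pos.le (half_pos hβ) hx.le))
      (by fun_prop)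
      (ContinuousOn.neg (ContinuousOn.log (by fun_prop) fun x hx => (sub_pos.mpr hx.2).ne'))
      fun x hx => neg_log_one_sub_bounds hx
    simpa only [mul_neg, integral_neg, neg_neg] using h.neg
  · exact tendsto_integral_mul_exp_hedge (C := 1) (h := fun c t => t ^ 2 / (c ^ 2 / 2 + t ^ 2))
      (F := fun x => x / (1 - x)) hβ hc (fun c => by fun_prop)
      (fun t => by have := hpos t; fun_prop (disch := assumption))
      (hnear.mono fun x hx t => (abs_hedge_weights_le ((half_pos hβ).trans hx) t).2.1)
      (by fun_prop) hdiv hdivb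
  · exact tendsto_integral_mul_exp_hedge (C := 2 / (β / 2) ^ 2)
      (h := fun c t => t ^ 2 / (c ^ 2 / 2 + t ^ 2) ^ 2)
      (F := fun x => x / (1 - x)) hβ hc (fun c => by fun_prop)
      (fun t => by have := hpos2 t; fun_prop (disch := assumption))
      (hnear.mono fun x hx t => (abs_hedge_weights_le ((half_pos hβ).trans hx) t).2.2.trans
        (div_le_div_of_nonneg_left two_pos.le (by positivity)
          (pow_le_pow_left₀ (half_pos hβ).le hx.le 2)))
      (by fun_prop) hdiv hdivb


end ApproximationIntegrals

/-! ### Heavy traffic -/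

section HeavyTraffic

variable {a b : ℕ → ℝ} {s : ℕ → ℕ} {β : ℝ}

/-- In heavy traffic the utilization tends to `1`, the hedge to `β`, and `b √a` is the scale of
the queue length. -/
theorem heavyTraffic_limits (ha : ∀ n, 0 < a n) (hb : ∀ n, 0 < b n) (hβ : 0 < β)
    (ha_lim : Tendsto a atTop atTop) (hb_lim : Tendsto b atTop atTop)
    (hheavy : Tendsto (fun n => (1 - utilization (a n) (b n) (s n)) * √(a n)) atTop (𝓝 β)) :
    (∀ᶠ n in atTop, a n * b n < s n) ∧
    Tendsto (fun n => (s n - a n * b n) / (b n * √(a n))) atTop (𝓝 β) ∧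
    Tendsto (fun n => robustHedge (b n) (utilization (a n) (b n) (s n)) (s n)) atTop (𝓝 β) ∧
    Tendsto (fun n => (b n + utilization (a n) (b n) (s n)) / (b n + 1)) atTop (𝓝 1) ∧
    Tendsto (fun n => (b n + utilization (a n) (b n) (s n))
      / (1 - utilization (a n) (b n) (s n)) / (b n * √(a n))) atTop (𝓝 β⁻¹) := by
  set ρ : ℕ → ℝ := fun n => utilization (a n) (b n) (s n) with hρdef
  change Tendsto (fun n => (1 - ρ n) * √(a n)) atTop (𝓝 β) at hheavy
  have hsq : ∀ n, 0 < √(a n) := fun n => Real.sqrt_pos.mpr (ha n)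
  have hρ1 : Tendsto ρ atTop (𝓝 1) := by
    have h1 : Tendsto (fun n => (√(a n))⁻¹) atTop (𝓝 0) :=
      tendsto_inv_atTop_zero.comp (Real.tendsto_sqrt_atTop.comp ha_lim)
    have h2 := (hheavy.mul h1).const_sub 1
    rw [mul_zero, sub_zero] at h2
    refine h2.congr fun n => ?_
    have := (hsq n).ne'
    field_simp
    ring
  have hρ0 : ∀ᶠ n in atTop, 0 < ρ n := hρ1.eventually (lt_mem_nhds one_pos)
  have hlt : ∀ᶠ n in atTop, ρ n < 1 := by
    filter_upwards [hheavy.eventually (lt_mem_nhds hβ)] with n hn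
    exact sub_pos.mp (pos_of_mul_pos_left hn (hsq n).le)
  have hs : ∀ᶠ n in atTop, 0 < (s n : ℝ) ∧ (s n : ℝ) = a n * b n / ρ n := by
    filter_upwards [hρ0] with n hn
    -- a vanishing capacity would give the junk value `ρ = 0`
    have h0 : (s n : ℝ) ≠ 0 := fun h0 => by simp [hρdef, utilization, h0] at hn
    have hab := mul_pos (ha n) (hb n)
    refine ⟨lt_of_le_of_ne (s n).cast_nonneg h0.symm, ?_⟩
    exact (div_div_cancel₀ hab.ne').symm
  have hone : Tendsto (fun n => (b n + 1)⁻¹) atTop (𝓝 0) :=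
    tendsto_inv_atTop_zero.comp (tendsto_atTop_add_const_right _ _ hb_lim)
  have hb1 : ∀ n, b n + 1 ≠ 0 := fun n => by linarith [hb n]
  have hbb : Tendsto (fun n => b n / (b n + 1)) atTop (𝓝 1) := by
    have := hone.const_sub 1
    rw [sub_zero] at this
    refine this.congr fun n => ?_
    have := hb1 n
    field_simp
    ring
  have hbρ : Tendsto (fun n => (b n + ρ n) / (b n + 1)) atTop (𝓝 1) := by
    have := hbb.add (hρ1.mul hone)
    rw [mul_zero, add_zero] at this
    refine this.congr fun n => ?_
    rw [add_div, div_eq_mul_inv (ρ n)]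
  refine ⟨?_, ?_, ?_, hbρ, ?_⟩
  · filter_upwards [hlt, hs, hρ0] with n h1 h2 h3
    rw [h2.2]
    exact (lt_div_iff₀ h3).mpr (mul_lt_of_lt_one_right (mul_pos (ha n) (hb n)) h1)
  · have h := hheavy.div hρ1 one_ne_zero
    rw [div_one] at h
    refine h.congr' ?_
    filter_upwards [hs, hρ0] with n h2 h3
    have e1 := (hb n).ne'
    have e2 := (hsq n).ne'
    have e3 : √(a n) ^ 2 = a n := Real.sq_sqrt (ha n).le
    simp only [Pi.div_apply]
    rw [h2.2]
    field_simp
    rw [e3]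
  · have h := ((((hheavy.pow 2).mul hbb).mul hbρ).div (hρ1.pow 2) (by norm_num)).sqrt
    simp only [mul_one, one_pow, div_one, Real.sqrt_sq hβ.le] at h
    refine h.congr' ?_
    filter_upwards [hs, hρ0] with n h2 h3
    have e1 := hb1 n
    have e3 : √(a n) ^ 2 = a n := Real.sq_sqrt (ha n).le
    simp only [robustHedge, Pi.div_apply]
    congr 1
    change _ = (s n : ℝ) * ((1 - ρ n) / (b n + 1)) ^ 2 * (1 + b n / ρ n)
    rw [h2.2, mul_pow, e3]
    field_simp
    ring
  · have h := (hbρ.div hbb one_ne_zero).div hheavy hβ.ne'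
    rw [div_one, one_div] at h
    refine h.congr' ?_
    filter_upwards [hlt] with n h1
    have e1 := hb1 n
    have e2 := (hsq n).ne'
    have e3 := (hb n).ne'
    have e4 : 1 - ρ n ≠ 0 := (sub_pos.mpr h1).ne'
    simp only [Pi.div_apply]
    change _ = (b n + ρ n) / (1 - ρ n) / (b n * √(a n))
    field_simp

end HeavyTraffic

/-- Two sequences with the same nonzero limit after division by a scale are equivalent. -/
theorem isEquivalent_of_tendsto_div {u v σ : ℕ → ℝ} {x : ℝ} (hx : x ≠ 0) (hσ : ∀ n, σ n ≠ 0)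
    (hu : Tendsto (fun n => u n / σ n) atTop (𝓝 x))
    (hv : Tendsto (fun n => v n / σ n) atTop (𝓝 x)) : u ~[atTop] v := by
  have h := (((isEquivalent_const_iff_tendsto hx).mpr hu).trans
    ((isEquivalent_const_iff_tendsto hx).mpr hv).symm).mul (IsEquivalent.refl (u := σ))
  refine (h.congr_left ?_).congr_right ?_ <;>
  exact Eventually.of_forall fun n => div_mul_cancel₀ _ (hσ n)

/-- The queue length distributions of the actual process converge to `limitLaw`, which is hence
its stationary law. -/
theorem stationaryLaw_eq {Ω : Type*} [MeasurableSpace Ω] {P : Measure Ω} [IsProbabilityMeasure P]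
    {ν : Measure ℕ} [IsProbabilityMeasure ν] {A : ℕ → Ω → ℕ} (s : ℕ)
    (hA : ∀ k, HasLaw (A k) ν P) (hindep : iIndepFun A P) :
    (∀ i k, P {ω | queue s A k ω = i} = queueLaw ν s k {i}) ∧
      stationaryLaw P s A = limitLaw ν s := by
  have h : ∀ i k, P {ω | queue s A k ω = i} = queueLaw ν s k {i} := fun i k => by
    rw [← map_queue s hA hindep k, Measure.map_apply_of_aemeasurable
      (aemeasurable_queue s (fun k => (hA k).aemeasurable) k) (measurableSet_singleton i)]
    rfl
  exact ⟨h, by simp only [stationaryLaw, limitLaw, h]⟩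

/-- Stability makes the Spitzer series of the second moments converge. -/
theorem gammaPoisson_stable {a b : ℝ} (ha : 0 < a) (hb : 0 < b) {s : ℕ} (hs : a * b < s) :
    Integrable (fun j : ℕ => (j : ℝ) ^ 2) (gammaPoisson a b) ∧
      Summable fun k : ℕ =>
        (∫ j, (j : ℝ) ^ 2 ∂excessLaw (gammaPoisson a b) s (k + 1)) / ((k : ℝ) + 1) := by
  have := isProbabilityMeasure_gammaPoisson ha hb
  obtain ⟨θ, hθ, hint, hr⟩ := exists_exp_moment_lt_one ha hb hs
  exact ⟨integrable_pow_of_exp hθ hint 2, summable_sq_excessLaw hθ hint hr⟩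

/-! ### Limits of the stationary characteristics and of their approximations -/

/-- Dominated convergence for series with terms divided by the period number. -/
theorem tendsto_spitzer_series {f : ℕ → ℕ → ℝ} {g : ℕ → ℝ} {r C : ℝ} (hr0 : 0 ≤ r) (hr1 : r < 1)
    (hf : ∀ n k, 0 ≤ f n k) (hlim : ∀ k, Tendsto (fun n => f n k) atTop (𝓝 (g k)))
    (hbound : ∀ᶠ n in atTop, ∀ k, f n k ≤ C * r ^ (k + 1)) :
    Tendsto (fun n => ∑' k : ℕ, f n k / ((k : ℝ) + 1)) atTop
      (𝓝 (∑' k : ℕ, g k / ((k : ℝ) + 1))) := by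
  refine tendsto_tsum_of_dominated_convergence (bound := fun k => C * r ^ (k + 1))
    (((summable_nat_add_iff 1).mpr (summable_geometric_of_lt_one hr0 hr1)).mul_left C)
    (fun k => (hlim k).div_const _) ?_
  filter_upwards [hbound] with n hn k
  rw [Real.norm_of_nonneg (div_nonneg (hf n k) (by positivity))]
  exact (div_le_self (hf n k) (by linarith [k.cast_nonneg (α := ℝ)])).trans (hn k)

section Moments

variable {a b : ℕ → ℝ} {s : ℕ → ℕ} {β : ℝ}

/-- The limits of the mean, of the probability of an empty queue and of the variance, the queue
length being measured in units of `b √a`. -/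
theorem tendsto_limitLaw_moments (ha : ∀ n, 0 < a n) (hb : ∀ n, 0 < b n) (hβ : 0 < β)
    (ha_lim : Tendsto a atTop atTop) (hb_lim : Tendsto b atTop atTop)
    (hstable : ∀ᶠ n in atTop, a n * b n < s n)
    (hs : Tendsto (fun n => (s n - a n * b n) / (b n * √(a n))) atTop (𝓝 β)) :
    Tendsto (fun n => (∫ q, (q : ℝ) ∂(limitLaw (gammaPoisson (a n) (b n)) (s n)))
        / (b n * √(a n))) atTop
      (𝓝 (√2 / Real.pi * ∫ t in Set.Ioi (0 : ℝ), t ^ 2 / (β ^ 2 / 2 + t ^ 2)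
        * (Real.exp (-(β ^ 2 / 2) - t ^ 2) / (1 - Real.exp (-(β ^ 2 / 2) - t ^ 2))))) ∧
    Tendsto (fun n => (limitLaw (gammaPoisson (a n) (b n)) (s n)).real {0}) atTop
      (𝓝 (Real.exp (1 / Real.pi * ∫ t in Set.Ioi (0 : ℝ), β / √2 / (β ^ 2 / 2 + t ^ 2)
        * Real.log (1 - Real.exp (-(β ^ 2 / 2) - t ^ 2))))) ∧
    Tendsto (fun n => variance (fun q : ℕ => (q : ℝ)) (limitLaw (gammaPoisson (a n) (b n)) (s n))
        / (b n * √(a n)) ^ 2) atTop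
      (𝓝 (√2 * β / Real.pi * ∫ t in Set.Ioi (0 : ℝ), t ^ 2 / (β ^ 2 / 2 + t ^ 2) ^ 2
        * (Real.exp (-(β ^ 2 / 2) - t ^ 2) / (1 - Real.exp (-(β ^ 2 / 2) - t ^ 2))))) := by
  have hσ : ∀ n, 0 < b n * √(a n) := fun n => mul_pos (hb n) (Real.sqrt_pos.mpr (ha n))
  obtain ⟨hprob, hmom, r, hr0, hr1, hbound⟩ := excessLaw_limits ha hb hβ ha_lim hb_lim hs
  have hspec : ∀ᶠ n in atTop, _ := hstable.mono fun n hn =>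
    have := isProbabilityMeasure_gammaPoisson (ha n) (hb n)
    limitLaw_spec (gammaPoisson_stable (ha n) (hb n) hn).1
      (gammaPoisson_stable (ha n) (hb n) hn).2
  have hser : ∀ p : ℕ, p ≠ 0 → Tendsto (fun n => ∑' k : ℕ,
      (∫ j, (j : ℝ) ^ p ∂(excessLaw (gammaPoisson (a n) (b n)) (s n) (k + 1)))
        / (b n * √(a n)) ^ p / ((k : ℝ) + 1)) atTop
      (𝓝 (∑' k : ℕ, (∫ x, max x 0 ^ p ∂(gaussianReal (-((k + 1 : ℕ) * β)) (k + 1 : ℕ)))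
        / ((k : ℝ) + 1))) := fun p hp =>
    tendsto_spitzer_series hr0 hr1 (fun n k => div_nonneg (integral_nonneg fun j => by positivity)
      (pow_pos (hσ n) p).le) (fun k => hmom _ k.succ_ne_zero p hp)
      (hbound.mono fun n hn k => (hn (k + 1)).2 p hp)
  obtain ⟨g0, g1, g2⟩ := gaussian_series hβ
  refine ⟨?_, ?_, ?_⟩
  · rw [← g1]
    refine (hser 1 one_ne_zero).congr' ?_
    filter_upwards [hspec] with n hn
    rw [hn.2.2.1, ← tsum_div_const]
    exact tsum_congr fun k => by simp only [pow_one]; ring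
  · have h := tendsto_spitzer_series hr0 hr1 (C := 1) (fun n k => measureReal_nonneg)
      (fun k => hprob _ k.succ_ne_zero) (hbound.mono fun n hn k => by simpa using (hn (k + 1)).1)
    rw [← neg_neg (1 / Real.pi * _), ← g0]
    refine ((Real.continuous_exp.tendsto _).comp h.neg).congr' ?_
    filter_upwards [hspec] with n hn
    exact hn.2.2.2.1.symm
  · rw [← g2]
    refine (hser 2 two_ne_zero).congr' ?_
    filter_upwards [hspec] with n hn
    rw [hn.2.2.2.2, ← tsum_div_const]
    exact tsum_congr fun k => by ring

/-- The robust approximations have the same limits in the units `b √a`. -/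
theorem tendsto_approximations {ρ c : ℕ → ℝ} (hβ : 0 < β)
    (hc : Tendsto c atTop (𝓝 β))
    (h1 : Tendsto (fun n => (b n + ρ n) / (b n + 1)) atTop (𝓝 1))
    (h2 : Tendsto (fun n => (b n + ρ n) / (1 - ρ n) / (b n * √(a n))) atTop (𝓝 β⁻¹)) :
    Tendsto (fun n => meanApprox (b n) (ρ n) (c n) / (b n * √(a n))) atTop
      (𝓝 (√2 / Real.pi * ∫ t in Set.Ioi (0 : ℝ), t ^ 2 / (β ^ 2 / 2 + t ^ 2)
        * (Real.exp (-(β ^ 2 / 2) - t ^ 2) / (1 - Real.exp (-(β ^ 2 / 2) - t ^ 2))))) ∧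
    Tendsto (fun n => emptyApprox (b n) (ρ n) (c n)) atTop
      (𝓝 (Real.exp (1 / Real.pi * ∫ t in Set.Ioi (0 : ℝ), β / √2 / (β ^ 2 / 2 + t ^ 2)
        * Real.log (1 - Real.exp (-(β ^ 2 / 2) - t ^ 2))))) ∧
    Tendsto (fun n => varianceApprox (b n) (ρ n) (c n) / (b n * √(a n)) ^ 2) atTop
      (𝓝 (√2 * β / Real.pi * ∫ t in Set.Ioi (0 : ℝ), t ^ 2 / (β ^ 2 / 2 + t ^ 2) ^ 2
        * (Real.exp (-(β ^ 2 / 2) - t ^ 2) / (1 - Real.exp (-(β ^ 2 / 2) - t ^ 2))))) := by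
  obtain ⟨i0, i1, i2⟩ := tendsto_hedge_integrals hβ hc
  refine ⟨?_, ?_, ?_⟩
  · have h := (((hc.const_mul √2).div_const Real.pi).mul h2).mul i1
    have e : √2 * β / Real.pi * β⁻¹ = √2 / Real.pi := by field_simp
    rw [e] at h
    refine h.congr fun n => ?_
    simp only [meanApprox]
    ring
  · have h := ((h1.const_mul (1 / Real.pi)).mul i0).rexp
    rw [mul_one] at h
    exact h
  · have h3 := (h1.inv₀ one_ne_zero).add_const 1
    have h := ((((hc.pow 3).div_const √2).div_const Real.pi).mul ((h2.pow 2).mul h3)).mul i2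
    have e : β ^ 3 / √2 / Real.pi * (β⁻¹ ^ 2 * (1⁻¹ + 1)) = √2 * β / Real.pi := by
      have hs2 : √(2 : ℝ) ^ 2 = 2 := Real.sq_sqrt (by norm_num)
      field_simp
      rw [hs2]
      norm_num
    rw [e] at h
    refine h.congr fun n => ?_
    simp only [varianceApprox, inv_div, div_pow]
    ring

end Moments

end RobustQueue

theorem theorem2
    -- Gamma parameters and capacities, in the overdispersed heavy-traffic regime
    (a b : ℕ → ℝ) (s : ℕ → ℕ) (β : ℝ)
    (ha : ∀ n, 0 < a n) (hb : ∀ n, 0 < b n) (hβ : 0 < β)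
    (ha_lim : Tendsto a atTop atTop) (hb_lim : Tendsto b atTop atTop)
    (hheavy : Tendsto
      (fun n => (1 - RobustQueue.utilization (a n) (b n) (s n)) * Real.sqrt (a n)) atTop (𝓝 β))
    -- the demands `A n k` in period `k` of system `n`: i.i.d. in `k`, Gamma-Poisson
    {Ω : ℕ → Type*} [∀ n, MeasurableSpace (Ω n)] (P : ∀ n, Measure (Ω n))
    [∀ n, IsProbabilityMeasure (P n)] (A : ∀ n, ℕ → Ω n → ℕ)
    (hA_indep : ∀ n, iIndepFun (A n) (P n))
    (hA_law : ∀ n k, HasLaw (A n k) (RobustQueue.gammaPoisson (a n) (b n)) (P n))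
    -- the utilizations, the robust hedges and the stationary queue length distributions
    (ρ c : ℕ → ℝ) (π : ℕ → Measure ℕ)
    (hρ : ∀ n, ρ n = RobustQueue.utilization (a n) (b n) (s n))
    (hc : ∀ n, c n = RobustQueue.robustHedge (b n) (ρ n) (s n))
    (hπ : ∀ n, π n = RobustQueue.stationaryLaw (P n) (s n) (A n)) :
    -- every stable system has a stationary distribution, with finite variance
    (∀ n, a n * b n < s n →
      (∀ i : ℕ, Tendsto (fun k => P n {ω | RobustQueue.queue (s n) (A n) k ω = i}) atTop
        (𝓝 (π n {i}))) ∧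
      IsProbabilityMeasure (π n) ∧ MemLp (fun q : ℕ => (q : ℝ)) 2 (π n)) ∧
    -- all but finitely many systems are stable
    (∀ᶠ n in atTop, a n * b n < s n) ∧
    -- leading-order asymptotics of the mean, the empty-queue probability and the variance
    (fun n => ∫ q, (q : ℝ) ∂(π n)) ~[atTop]
      (fun n => RobustQueue.meanApprox (b n) (ρ n) (c n)) ∧
    (fun n => (π n).real {0}) ~[atTop]
      (fun n => RobustQueue.emptyApprox (b n) (ρ n) (c n)) ∧
    (fun n => variance (fun q : ℕ => (q : ℝ)) (π n)) ~[atTop]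
      (fun n => RobustQueue.varianceApprox (b n) (ρ n) (c n)) := by
  have hprob : ∀ n, IsProbabilityMeasure (RobustQueue.gammaPoisson (a n) (b n)) := fun n =>
    RobustQueue.isProbabilityMeasure_gammaPoisson (ha n) (hb n)
  have hlaw := fun n => RobustQueue.stationaryLaw_eq (s n) (hA_law n) (hA_indep n)
  obtain rfl : ρ = fun n => RobustQueue.utilization (a n) (b n) (s n) := funext hρ
  obtain rfl : c = fun n => RobustQueue.robustHedge (b n)
    (RobustQueue.utilization (a n) (b n) (s n)) (s n) := funext hc
  obtain rfl : π = fun n => RobustQueue.limitLaw (RobustQueue.gammaPoisson (a n) (b n)) (s n) :=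
    funext fun n => (hπ n).trans (hlaw n).2
  obtain ⟨hstable, hdrift, hhedge, hone, hscale⟩ :=
    RobustQueue.heavyTraffic_limits ha hb hβ ha_lim hb_lim hheavy
  have hσ : ∀ n, b n * √(a n) ≠ 0 := fun n =>
    (mul_pos (hb n) (Real.sqrt_pos.mpr (ha n))).ne'
  obtain ⟨q1, q0, q2⟩ :=
    RobustQueue.tendsto_limitLaw_moments ha hb hβ ha_lim hb_lim hstable hdrift
  obtain ⟨p1, p0, p2⟩ := RobustQueue.tendsto_approximations hβ hhedge hone hscale
  have hw := RobustQueue.abs_hedge_weights_le hβ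
  have hpi := Real.pi_pos
  refine ⟨fun n hn => ?_, hstable, ?_, ?_, ?_⟩
  · obtain ⟨hint, hsum⟩ := RobustQueue.gammaPoisson_stable (ha n) (hb n) hn
    have hspec := RobustQueue.limitLaw_spec hint hsum
    refine ⟨fun i => ?_, hspec.1, hspec.2.1⟩
    simp only [(hlaw n).1 i]
    exact RobustQueue.tendsto_queueLaw_singleton (s n) i
  · refine RobustQueue.isEquivalent_of_tendsto_div (ne_of_gt (mul_pos (by positivity) ?_)) hσ q1 p1
    exact RobustQueue.integral_mul_exp_hedge_pos hβ (by fun_prop) (fun t => (hw t).2.1)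
      fun t ht => by positivity
  · exact RobustQueue.isEquivalent_of_tendsto_div (σ := fun _ => 1) (Real.exp_pos _).ne'
      (fun _ => one_ne_zero) (by simpa using q0) (by simpa using p0)
  · refine RobustQueue.isEquivalent_of_tendsto_div (ne_of_gt (mul_pos (by positivity) ?_))
      (fun n => pow_ne_zero 2 (hσ n)) q2 p2
    exact RobustQueue.integral_mul_exp_hedge_pos hβ (by fun_prop) (fun t => (hw t).2.2)
      fun t ht => by positivity
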